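/- **Setting.** Let $X$ be a finite set of pairwise non-translate prototiles in $\mathbb R^d$, all of them closed nondegenerate $d$-rectangles with sides parallel to the axes, and let $T$ be a tiling of $\mathbb R^d$ by translates of elements of $X$ which is *perfect*: it is aperiodic ($T+x\ne T$ for $x\neq 0$), it has finitely many patches of diameter $<s$ up to translation for every $s>0$, and it is repetitive (every patch of $T$ has translates in $T$ inside every ball of a certain radius). The tilings by translates of elements of $X$ carry the tiling distance ($T',T''$ are $\varepsilon$-close if translates of them by vectors of norm $\le\varepsilon$ coincide on the ball of radius $1/\varepsilon$ around $0$); the hull $\Omega_T$ is the closure of $\{T+x: x\in\mathbb R^d\}$, with the action $\omega$ of $\mathbb R^d$ by translations. $\mathcal M(\Omega_T,\omega)$ is the set of finite $\mathbb R^d$-invariant Borel measures on $\Omega_T$. **Box decompositions.** A *block* is a connected finite union of closed nondegenerate rectangles with sides parallel to the axes. A *box* is a set $\{S-v: v\in \operatorname{int}P,\ S\in C\}\subset\Omega_T$, where $P$ is a block and $C\ne\emptyset$ a compact subset of $\Omega_T$ in which sufficiently close elements coincide exactly on any prescribed ball, such that $(v,S)\mapsto S-v$ is an open embedding of $\operatorname{int}P\times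 C$. Its *verticals* are the sets $C-v$, $v\in\operatorname{int}P$; its *vertical boundary* is $\{S-v:v\in\partial P,S\in C\}$. A *box decomposition* $\mathcal B$ is a finite family of pairwise disjoint boxes $(P_i,C_i)$ whose closures cover $\Omega_T$; the sets $u+P_i$ with $S-u\in C_i$ are the *tiles of $\mathcal B$ in $S$*. Let $\mathcal B'$ be another box decomposition, with boxes $(P'_j,C'_j)$. It is *zoomed out* of $\mathcal B$ if (1) at every point that lies in a box of $\mathcal B'$ and in a box of $\mathcal B$ the vertical in the former is contained in the vertical in the latter, (2) the vertical boundaries of $\mathcal B'$ are contained in the union of those of $\mathcal B$, (3) for $S\in C'_j$ the set $\operatorname{int}P'_j$ contains a tile of $\mathcal B$ in $S$. It *forces its border* over $\mathcal B$ if for each $j$ the tiles of $\mathcal B$ in $S$ (with their index) that meet $P'_j$ are the same for all $S\in C'_j$. **The expanding flattening sequence.** Let $\mathcal B^{(0)}$ consist of the boxes $P=p$, $C=\{S\in\Omega_T: p \text{ is a tile of } S\}$, where $p$ runs over the prototiles occurring in $T$, and let $\mathcal B^{(1)},\mathcal B^{(2)},\dots$ be box decompositions such that each $\mathcal B^{(n+1)}$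 is zoomed out of $\mathcal B^{(n)}$ and forces its border. The branched oriented flat (BOF) $d$-manifold $B_n$ is the quotient of $\Omega_T$ by the equivalence relation generated by $S-v\sim S'-v$ for $S,S'\in C_j$, $v\in P_j$, $(P_j,C_j)$ a box of $\mathcal B^{(n)}$ (that is, the union of the blocks $P_j$ glued as they abut in tilings of $\Omega_T$). Let $\pi_n:\Omega_T\to B_n$ be the projection and $f_n:B_{n+1}\to B_n$ the map with $f_n\circ\pi_{n+1}=\pi_n$; these form the EFS $\mathcal F$. Every block $P_j$ of $\mathcal B^{(n)}$ is tiled by those translates of prototiles that are tiles of all $S\in C_j$; their interiors are the *$d$-regions* of $B_n$. **Weights.** $W(B_n)$ (resp. $W^*(B_n)$) is the cone of all functions $w$ from the $d$-regions of $B_n$ to $[0,\infty)$ (resp. $(0,\infty)$) that obey the switching rules, i.e. of nonnegative (resp. positive) real $d$-cycles of $B_n$: at each point $p$ of a $(d-1)$-region of $B_n$ (a point at which all germs of closed $d$-regions are half-spaces bounded by one and the same coordinate hyperplane) having finitely many germs of $d$-regions, the sum of the weights of the germs of $d$-regions at $p$ on one side of the hyperplane equals the sum on the other side. Let $(f_n)_*w(F)=\sum_{F':\,f_n(F')=F}w(F')$,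 and let $$\mathcal M(\mathcal F)=\varprojlim\big(W(B_n),(f_n)_*\big),\qquad \mathcal M^\star(\mathcal F)=\varprojlim\big(W^*(B_n),(f_n)_*\big).$$ **Theorem.** $\mathcal M(\Omega_T,\omega)\cong\mathcal M^\star(\mathcal F)$. Precisely, the map $$\mu\longmapsto(\tau_n(\mu))_{n\ge0},\qquad \tau_n(\mu)(F)=\frac{\mu(\pi_n^{-1}(F))}{\lambda_d(F)}\quad(F\text{ a }d\text{-region of }B_n,\ \lambda_d\text{ Lebesgue measure}),$$ is additive, commutes with multiplication by nonnegative scalars, restricts to a bijection from the nonzero measures in $\mathcal M(\Omega_T,\omega)$ onto $\mathcal M^\star(\mathcal F)$, and is a bijection from $\mathcal M(\Omega_T,\omega)$ onto $\mathcal M(\mathcal F)$. -/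

import Mathlib

open Set Filter Topology MeasureTheory Metric
open scoped Pointwise NNReal

namespace TilingSpace

/-- The oriented Euclidean space `ℝ^d`. -/
abbrev Euc (d : ℕ) : Type := EuclideanSpace ℝ (Fin d)

variable {d : ℕ}

/-! ## Rectangles and blocks -/

/-- The closed rectangle with opposite corners `a` and `b` and sides parallel to the axes. -/
def rect (a b : Euc d) : Set (Euc d) := {x | ∀ k, a k ≤ x k ∧ x k ≤ b k}

/-- A (nondegenerate) well oriented `d`-rectangle. -/
def IsRectangle (R : Set (Euc d)) : Prop := ∃ a b : Euc d, (∀ k, a k < b k) ∧ R = rect a b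

/-- A block: a connected set which is a finite union of well oriented `d`-rectangles. -/
def IsBlock (P : Set (Euc d)) : Prop :=
  IsConnected P ∧ ∃ 𝓡 : Set (Set (Euc d)), 𝓡.Finite ∧ (∀ R ∈ 𝓡, IsRectangle R) ∧ P = ⋃₀ 𝓡

/-- Relative interior of the facet of the rectangle `t` on which the `k`-th coordinate is
maximal. -/
def upperFacet (t : Set (Euc d)) (k : Fin d) : Set (Euc d) :=
  {x | ∃ a b : Euc d, (∀ l, a l < b l) ∧ t = rect a b ∧ x k = b k ∧
    ∀ l, l ≠ k → a l < x l ∧ x l < b l}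

/-- Relative interior of the facet of the rectangle `t` on which the `k`-th coordinate is
minimal. -/
def lowerFacet (t : Set (Euc d)) (k : Fin d) : Set (Euc d) :=
  {x | ∃ a b : Euc d, (∀ l, a l < b l) ∧ t = rect a b ∧ x k = a k ∧
    ∀ l, l ≠ k → a l < x l ∧ x l < b l}

/-! ## Tilings -/

/-- A finite set of prototiles, of pairwise distinct types up to translation. -/
structure IsPrototileSet (X : Set (Set (Euc d))) : Prop where
  finite : X.Finite
  isCompact : ∀ p ∈ X, IsCompact p
  isConnected : ∀ p ∈ X, IsConnected p
  regular : ∀ p ∈ X, closure (interior p) = p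
  distinct : ∀ p ∈ X, ∀ q ∈ X, ∀ v : Euc d, v +ᵥ p = q → p = q

/-- The tilings of `ℝ^d` all of whose tiles are translates of elements of `X`. -/
@[ext]
structure Tiling (X : Set (Set (Euc d))) where
  tiles : Set (Set (Euc d))
  tile_type : ∀ t ∈ tiles, ∃ p ∈ X, ∃ v : Euc d, t = v +ᵥ p
  covers : ⋃₀ tiles = univ
  disjoint_interior : tiles.Pairwise fun s t => Disjoint (interior s) (interior t)

namespace Tiling

variable {X : Set (Set (Euc d))}

/-- Translation of a tiling by a vector. -/
instance : VAdd (Euc d) (Tiling X) where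
  vadd v T :=
    { tiles := v +ᵥ T.tiles
      tile_type := by
        rintro _ ⟨t, ht, rfl⟩
        obtain ⟨p, hp, w, rfl⟩ := T.tile_type t ht
        exact ⟨p, hp, v + w, vadd_vadd v w p⟩
      covers := by
        rw [eq_univ_iff_forall]
        intro x
        have hx : -v + x ∈ ⋃₀ T.tiles := by rw [T.covers]; trivial
        obtain ⟨t, ht, hxt⟩ := hx
        exact ⟨v +ᵥ t, ⟨t, ht, rfl⟩, -v + x, hxt, by simp⟩
      disjoint_interior := by
        rintro _ ⟨s, hs, rfl⟩ _ ⟨t, ht, rfl⟩ hst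
        have hne : s ≠ t := fun h => hst (by rw [h])
        have h := T.disjoint_interior hs ht hne
        simp only [interior_vadd]
        exact (disjoint_image_iff (add_right_injective v)).2 h }

theorem vadd_tiles (v : Euc d) (T : Tiling X) : (v +ᵥ T).tiles = v +ᵥ T.tiles := rfl

/-- The action `ω` of `ℝ^d` on tilings by translations. -/
instance : AddAction (Euc d) (Tiling X) where
  zero_vadd T := Tiling.ext (by rw [vadd_tiles, zero_vadd])
  add_vadd v w T := Tiling.ext (by simp only [vadd_tiles, add_vadd])

/-- The trace `T ∩ K` of a tiling on a region `K`: the nonempty sets `t ∩ K`, `t` a tile. -/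
def restrict (T : Tiling X) (K : Set (Euc d)) : Set (Set (Euc d)) :=
  {s | s.Nonempty ∧ ∃ t ∈ T.tiles, s = t ∩ K}

/-- The set `A` of those `ε ∈ ]0,1[` for which there are `x`, `x'` of norm at most `ε` such that
`T + x` and `T' + x'` coincide on the ball of radius `1/ε` around the origin. -/
def closeness (T T' : Tiling X) : Set ℝ :=
  {ε | 0 < ε ∧ ε < 1 ∧ ∃ x ∈ closedBall (0 : Euc d) ε, ∃ x' ∈ closedBall (0 : Euc d) ε,
    (x +ᵥ T).restrict (closedBall 0 (1 / ε)) = (x' +ᵥ T').restrict (closedBall 0 (1 / ε))}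

open Classical in
/-- The tiling distance `δ`. -/
noncomputable def tilingDist (T T' : Tiling X) : ℝ :=
  if (closeness T T').Nonempty then sInf (closeness T T') else 1

/-- The topology of the distance `δ`. -/
instance : TopologicalSpace (Tiling X) where
  IsOpen U := ∀ T ∈ U, ∃ ε > 0, ∀ T', tilingDist T T' < ε → T' ∈ U
  isOpen_univ := fun _ _ => ⟨1, one_pos, fun _ _ => trivial⟩
  isOpen_inter := by
    rintro U V hU hV T ⟨hTU, hTV⟩
    obtain ⟨ε, hε, h⟩ := hU T hTU
    obtain ⟨η, hη, h'⟩ := hV T hTV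
    exact ⟨min ε η, lt_min hε hη, fun T' hT' =>
      ⟨h T' (hT'.trans_le (min_le_left _ _)), h' T' (hT'.trans_le (min_le_right _ _))⟩⟩
  isOpen_sUnion := by
    rintro 𝓤 h𝓤 T ⟨U, hU, hTU⟩
    obtain ⟨ε, hε, h⟩ := h𝓤 U hU T hTU
    exact ⟨ε, hε, fun T' hT' => ⟨U, hU, h T' hT'⟩⟩

instance : MeasurableSpace (Tiling X) := borel _

instance : BorelSpace (Tiling X) := ⟨rfl⟩

theorem isOpen_def {U : Set (Tiling X)} :
    IsOpen U ↔ ∀ T ∈ U, ∃ ε > 0, ∀ T', tilingDist T T' < ε → T' ∈ U := Iff.rfl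

theorem restrict_mono {T T' : Tiling X} {K K' : Set (Euc d)} (hK : K' ⊆ K)
    (h : T.restrict K = T'.restrict K) : T.restrict K' = T'.restrict K' := by
  have key : ∀ {T T' : Tiling X}, T.restrict K = T'.restrict K →
      T.restrict K' ⊆ T'.restrict K' := by
    rintro T T' h _ ⟨hne, t, ht, rfl⟩
    have hmem : t ∩ K ∈ T.restrict K :=
      ⟨hne.mono (inter_subset_inter_right _ hK), t, ht, rfl⟩
    rw [h] at hmem
    obtain ⟨-, t', ht', he⟩ := hmem
    refine ⟨hne, t', ht', ?_⟩
    have h1 : ∀ s : Set (Euc d), s ∩ K' = s ∩ K ∩ K' := fun s => by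
      rw [inter_assoc, inter_eq_right.2 hK]
    rw [h1 t, he, ← h1 t']
  exact (key h).antisymm (key h.symm)

theorem restrict_vadd (v : Euc d) (T : Tiling X) (K : Set (Euc d)) :
    (v +ᵥ T).restrict (v +ᵥ K) = v +ᵥ T.restrict K := by
  ext s
  constructor
  · rintro ⟨hne, _, ⟨t, ht, rfl⟩, rfl⟩
    have e : v +ᵥ (t ∩ K) = (v +ᵥ t) ∩ (v +ᵥ K) := vadd_set_inter
    refine ⟨t ∩ K, ⟨?_, t, ht, rfl⟩, e⟩
    have hne' : (v +ᵥ (t ∩ K)).Nonempty := by rw [e]; exact hne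
    exact vadd_set_nonempty.1 hne'
  · rintro ⟨_, ⟨hne, t, ht, rfl⟩, rfl⟩
    exact ⟨hne.vadd_set, v +ᵥ t, ⟨t, ht, rfl⟩, vadd_set_inter⟩

theorem continuous_vadd (v : Euc d) : Continuous fun T : Tiling X => v +ᵥ T := by
  refine ⟨fun U hU => ?_⟩
  rw [isOpen_def] at hU ⊢
  intro T hT
  obtain ⟨ε, hε, h⟩ := hU _ hT
  set e' : ℝ := min ε 1 / 2 with he'
  have he'0 : 0 < e' := by positivity
  have hm : min ε 1 ≤ ε := min_le_left _ _
  have hm1 : min ε 1 ≤ 1 := min_le_right _ _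
  have hm0 : 0 < min ε 1 := lt_min hε one_pos
  have he'1 : e' < 1 := by rw [he']; linarith
  have he'ε : e' < ε := by rw [he']; linarith
  have hden : 0 < 1 / e' + ‖v‖ := by positivity
  refine ⟨1 / (1 / e' + ‖v‖), by positivity, fun T' hT' => h _ ?_⟩
  have hle : 1 / (1 / e' + ‖v‖) ≤ e' := by
    rw [div_le_iff₀ hden, mul_add, mul_one_div_cancel he'0.ne']
    have : 0 ≤ e' * ‖v‖ := by positivity
    linarith
  have hne : (closeness T T').Nonempty := by
    by_contra hne
    rw [tilingDist, if_neg hne] at hT'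
    linarith
  rw [tilingDist, if_pos hne] at hT'
  obtain ⟨e, ⟨he0, he1, x, hx, x', hx', hxx⟩, hee⟩ := exists_lt_of_csInf_lt hne hT'
  have hbig : 1 / e' + ‖v‖ < 1 / e := by
    rw [lt_div_iff₀ he0]
    rwa [lt_div_iff₀ hden, mul_comm] at hee
  have hsub : closedBall (-v) (1 / e') ⊆ closedBall (0 : Euc d) (1 / e) := by
    refine closedBall_subset_closedBall' ?_
    rw [dist_zero_right, norm_neg]
    exact hbig.le
  have hball : v +ᵥ closedBall (-v) (1 / e') = closedBall (0 : Euc d) (1 / e') := by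
    rw [vadd_closedBall, vadd_eq_add, add_neg_cancel]
  have hmem : e' ∈ closeness (v +ᵥ T) (v +ᵥ T') := by
    refine ⟨he'0, he'1, x, closedBall_subset_closedBall (hee.le.trans hle) hx, x',
      closedBall_subset_closedBall (hee.le.trans hle) hx', ?_⟩
    rw [vadd_comm x v T, vadd_comm x' v T', ← hball, restrict_vadd, restrict_vadd,
      restrict_mono hsub hxx]
  rw [tilingDist, if_pos ⟨e', hmem⟩]
  exact (csInf_le ⟨0, fun y hy => hy.1.le⟩ hmem).trans_lt he'ε

/-- Finite pattern condition: for every `s > 0` there are, up to translation, only finitely many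
patches (finite sets of tiles) of diameter less than `s`. -/
def FinitePattern (T : Tiling X) : Prop :=
  ∀ s : ℝ, 0 < s → ∃ 𝒬 : Set (Set (Set (Euc d))), 𝒬.Finite ∧
    ∀ Q ⊆ T.tiles, Q.Finite → diam (⋃₀ Q) < s → ∃ Q₀ ∈ 𝒬, ∃ v : Euc d, Q = v +ᵥ Q₀

/-- Repetitivity: every patch occurs, up to translation, in every ball of some radius `s`. -/
def Repetitive (T : Tiling X) : Prop :=
  ∀ Q ⊆ T.tiles, Q.Finite → ∃ s : ℝ, 0 < s ∧
    ∀ x : Euc d, ∃ v : Euc d, v +ᵥ Q ⊆ T.tiles ∧ ⋃₀ (v +ᵥ Q) ⊆ closedBall x s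

def Aperiodic (T : Tiling X) : Prop := ∀ x : Euc d, x ≠ 0 → x +ᵥ T ≠ T

/-- Perfect tilings: aperiodic, with finite patterns, repetitive. -/
structure IsPerfect (T : Tiling X) : Prop where
  aperiodic : T.Aperiodic
  finitePattern : T.FinitePattern
  repetitive : T.Repetitive

/-- The continuous hull of `T`: the closure of its orbit. -/
def hull (T : Tiling X) : Set (Tiling X) := closure (range fun v : Euc d => v +ᵥ T)

end Tiling

variable {X : Set (Set (Euc d))} {T : Tiling X}

/-- The continuous hull `Ω_T` as a topological and Borel space. -/
abbrev Hull (T : Tiling X) : Type := ↥(T.hull)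

/-- The action `ω` of `ℝ^d` on `Ω_T` by translations. -/
instance : AddAction (Euc d) (Hull T) where
  vadd v S := ⟨v +ᵥ S.1, by
    refine map_mem_closure (Tiling.continuous_vadd v) S.2 ?_
    rintro _ ⟨w, rfl⟩
    exact ⟨v + w, add_vadd v w T⟩⟩
  zero_vadd S := Subtype.ext (zero_vadd _ S.1)
  add_vadd v w S := Subtype.ext (add_vadd v w S.1)

/-- The set `𝓜(Ω_T, ω)` of finite invariant Borel measures on the hull. -/
def invariantMeasures (T : Tiling X) : Set (Measure (Hull T)) :=
  {μ | IsFiniteMeasure μ ∧ VAddInvariantMeasure (Euc d) (Hull T) μ}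

/-! ## Box decompositions of the hull

A box is given by a block `P` of `ℝ^d` and a compact subset `C` of the hull, its vertical: it
consists of the tilings `S - v`, `v ∈ int P`, `S ∈ C`. If one regards `P` as a patch of the tilings
`S ∈ C`, then `v` is the position of the origin in that patch. -/

/-- A box decomposition of block type of the hull. -/
structure BoxDecomposition (T : Tiling X) where
  card : ℕ
  block : Fin card → Set (Euc d)
  vert : Fin card → Set (Hull T)
  isBlock : ∀ i, IsBlock (block i)
  vert_nonempty : ∀ i, (vert i).Nonempty
  vert_isCompact : ∀ i, IsCompact (vert i)
  /-- `C` is a vertical of the flat lamination structure of the hull: nearby elements of `C`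
  coincide, without any translation, on large balls. -/
  vert_flat : ∀ i, ∀ S ∈ vert i, ∀ R : ℝ, ∀ᶠ S' in 𝓝[vert i] S,
    S'.1.restrict (closedBall 0 R) = S.1.restrict (closedBall 0 R)
  chart : ∀ i, IsOpenEmbedding fun q : ↥(interior (block i)) × ↥(vert i) =>
    -(q.1 : Euc d) +ᵥ (q.2 : Hull T)
  disjoint : Pairwise fun i j => Disjoint
    {x : Hull T | ∃ v ∈ interior (block i), ∃ S ∈ vert i, x = -v +ᵥ S}
    {x : Hull T | ∃ v ∈ interior (block j), ∃ S ∈ vert j, x = -v +ᵥ S}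
  covers : ⋃ i, closure {x : Hull T | ∃ v ∈ interior (block i), ∃ S ∈ vert i, x = -v +ᵥ S} = univ

namespace BoxDecomposition

/-- The `i`-th box. -/
def box (𝓑 : BoxDecomposition T) (i : Fin 𝓑.card) : Set (Hull T) :=
  {x | ∃ v ∈ interior (𝓑.block i), ∃ S ∈ 𝓑.vert i, x = -v +ᵥ S}

/-- The vertical boundary of the `i`-th box. -/
def verticalBoundary (𝓑 : BoxDecomposition T) (i : Fin 𝓑.card) : Set (Hull T) :=
  {x | ∃ v ∈ frontier (𝓑.block i), ∃ S ∈ 𝓑.vert i, x = -v +ᵥ S}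

/-- The vertical of the point `x` in the `i`-th box. -/
def verticalOf (𝓑 : BoxDecomposition T) (i : Fin 𝓑.card) (x : Hull T) : Set (Hull T) :=
  {y | ∃ v ∈ interior (𝓑.block i), ∃ S ∈ 𝓑.vert i, ∃ S' ∈ 𝓑.vert i, x = -v +ᵥ S ∧ y = -v +ᵥ S'}

/-- `𝓑'` is zoomed out of `𝓑`. -/
structure ZoomedOut (𝓑' 𝓑 : BoxDecomposition T) : Prop where
  verticalOf_subset : ∀ j i, ∀ x ∈ 𝓑'.box j, x ∈ 𝓑.box i → 𝓑'.verticalOf j x ⊆ 𝓑.verticalOf i x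
  verticalBoundary_subset : ∀ j, 𝓑'.verticalBoundary j ⊆ ⋃ i, 𝓑.verticalBoundary i
  /-- Every tile of the tiling of a leaf by `𝓑'` contains in its interior a tile of the tiling of
  that leaf by `𝓑`. -/
  exists_interior_tile : ∀ j, ∀ S ∈ 𝓑'.vert j, ∃ i, ∃ u : Euc d,
    -u +ᵥ S ∈ 𝓑.vert i ∧ u +ᵥ 𝓑.block i ⊆ interior (𝓑'.block j)

/-- `𝓑'` forces its border over `𝓑`: for every box of `𝓑'`, all the tiles of the tiling by `𝓑`
that meet a tile of the tiling by `𝓑'` lying in that box are determined, up to translation, by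
the box. -/
def ForcesBorder (𝓑' 𝓑 : BoxDecomposition T) : Prop :=
  ∀ j, ∀ S ∈ 𝓑'.vert j, ∀ S' ∈ 𝓑'.vert j, ∀ i, ∀ u : Euc d,
    -u +ᵥ S ∈ 𝓑.vert i → ((u +ᵥ 𝓑.block i) ∩ 𝓑'.block j).Nonempty → -u +ᵥ S' ∈ 𝓑.vert i

/-! ## The branched oriented flat manifold of a box decomposition -/

/-- Two points of the hull are on the same vertical in the closure of a box. -/
def SameVertical (𝓑 : BoxDecomposition T) (x y : Hull T) : Prop :=
  ∃ i, ∃ v ∈ 𝓑.block i, ∃ S ∈ 𝓑.vert i, ∃ S' ∈ 𝓑.vert i, x = -v +ᵥ S ∧ y = -v +ᵥ S'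

/-- The branched oriented flat manifold `B` of a box decomposition: the quotient of the hull by the
equivalence relation generated by being on the same vertical of a closed box. Equivalently: the
disjoint union of the blocks, in which two points are identified if they are the positions of the
origin in two blocks of one tiling of the hull. -/
def BOF (𝓑 : BoxDecomposition T) : Type := Quot 𝓑.SameVertical

instance (𝓑 : BoxDecomposition T) : TopologicalSpace 𝓑.BOF :=
  inferInstanceAs (TopologicalSpace (Quot 𝓑.SameVertical))

/-- The projection `π : Ω_T → B`. -/
def proj (𝓑 : BoxDecomposition T) (x : Hull T) : 𝓑.BOF := Quot.mk _ x

/-- The `d`-regions of `B`: every block is tiled by the tiles (copies of prototiles) of the tilings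
of its vertical, and these tiles are the `d`-regions. -/
structure Region (𝓑 : BoxDecomposition T) where
  idx : Fin 𝓑.card
  tile : Set (Euc d)
  tile_subset : tile ⊆ 𝓑.block idx
  tile_mem : ∀ S ∈ 𝓑.vert idx, tile ∈ S.1.tiles

/-- The `d`-region as an open cell of `B`. -/
def cell (𝓑 : BoxDecomposition T) (F : 𝓑.Region) : Set 𝓑.BOF :=
  𝓑.proj '' {x | ∃ v ∈ interior F.tile, ∃ S ∈ 𝓑.vert F.idx, x = -v +ᵥ S}

/-- The germs of `d`-regions at a point `p` of `B`: the pairs of a `d`-region `F` and a point `x` of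
the closed rectangle `F` that represents `p`. -/
def germs (𝓑 : BoxDecomposition T) (p : 𝓑.BOF) : Set (𝓑.Region × Euc d) :=
  {g | g.2 ∈ g.1.tile ∧ ∃ S ∈ 𝓑.vert g.1.idx, 𝓑.proj (-g.2 +ᵥ S) = p}

/-- `p` lies in a `(d-1)`-region of `B` orthogonal to the `k`-th axis: the germs of `d`-regions at
`p` are half spaces bounded by the hyperplane orthogonal to that axis. -/
def IsWallPoint (𝓑 : BoxDecomposition T) (k : Fin d) (p : 𝓑.BOF) : Prop :=
  ∀ g ∈ 𝓑.germs p, g.2 ∈ upperFacet g.1.tile k ∪ lowerFacet g.1.tile k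

/-- The switching rules (Kirchhoff laws): along every `(d-1)`-region, the sum of the weights of the
germs of `d`-regions on one side equals the sum of the weights of those on the other side. A rule is
imposed only where `B` is locally a finite union of sheets, that is, at points with finitely many
germs (for tilings that are not face to face, the gluing of the bare prototiles may produce points
with infinitely many germs). -/
def Switching (𝓑 : BoxDecomposition T) (w : 𝓑.Region → ℝ) : Prop :=
  ∀ (k : Fin d) (p : 𝓑.BOF), 𝓑.IsWallPoint k p → (𝓑.germs p).Finite →
    ∑ᶠ g ∈ {g ∈ 𝓑.germs p | g.2 ∈ upperFacet g.1.tile k}, w g.1 =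
    ∑ᶠ g ∈ {g ∈ 𝓑.germs p | g.2 ∈ lowerFacet g.1.tile k}, w g.1

/-- The cone `W(B)` of positive weight systems. -/
def W (𝓑 : BoxDecomposition T) : Set (𝓑.Region → ℝ) := {w | (∀ F, 0 ≤ w F) ∧ 𝓑.Switching w}

/-- The cone `W*(B)` of strictly positive weight systems. -/
def Wstar (𝓑 : BoxDecomposition T) : Set (𝓑.Region → ℝ) := {w | (∀ F, 0 < w F) ∧ 𝓑.Switching w}

end BoxDecomposition

/-- There are only finitely many `d`-regions. -/
theorem finite_region (hX : IsPrototileSet X) (𝓑 : BoxDecomposition T) : Finite 𝓑.Region := by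
  have hcpt : ∀ i, IsCompact (𝓑.block i) := by
    intro i
    obtain ⟨-, 𝓡, hfin, hR, hP⟩ := 𝓑.isBlock i
    rw [hP]
    refine hfin.isCompact_sUnion fun R hR' => ?_
    obtain ⟨a, b, -, rfl⟩ := hR R hR'
    have : rect a b = (EuclideanSpace.equiv (Fin d) ℝ) ⁻¹' (Icc (⇑a) (⇑b)) := by
      ext x
      simp only [rect, mem_ofPred_eq, mem_preimage, mem_Icc, Pi.le_def]
      exact forall_and
    rw [this]
    exact (EuclideanSpace.equiv (Fin d) ℝ).toHomeomorph.isClosedEmbedding.isCompact_preimage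
      isCompact_Icc
  have hmain : ∀ i, {t : Set (Euc d) | t ⊆ 𝓑.block i ∧ ∀ S ∈ 𝓑.vert i, t ∈ S.1.tiles}.Finite := by
    intro i
    obtain ⟨S, hS⟩ := 𝓑.vert_nonempty i
    set Z := {t : Set (Euc d) | t ⊆ 𝓑.block i ∧ ∀ S ∈ 𝓑.vert i, t ∈ S.1.tiles} with hZ
    have hpos : ∀ p ∈ X, 0 < volume (interior p) := by
      intro p hp
      refine isOpen_interior.measure_pos _ ?_
      by_contra hne
      rw [not_nonempty_iff_eq_empty] at hne
      have h1 := hX.regular p hp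
      rw [hne, closure_empty] at h1
      exact (hX.isConnected p hp).nonempty.ne_empty h1.symm
    obtain ⟨c, hc0, hc⟩ : ∃ c : ENNReal, 0 < c ∧ ∀ p ∈ X, c ≤ volume (interior p) := by
      rcases X.eq_empty_or_nonempty with h | h
      · exact ⟨1, one_pos, by simp [h]⟩
      · obtain ⟨p, hp, hmin⟩ := exists_min_image X (fun p => volume (interior p)) hX.finite h
        exact ⟨_, hpos p hp, hmin⟩
    have hfin := Measure.finite_const_le_meas_of_disjoint_iUnion
      (volume : Measure (Euc d)) (As := fun t : Z => interior (t : Set (Euc d))) hc0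
      (fun t => isOpen_interior.measurableSet)
      (fun s t hst => S.1.disjoint_interior (s.2.2 S hS) (t.2.2 S hS) fun h => hst (Subtype.ext h))
      (ne_top_of_le_ne_top (hcpt i).measure_lt_top.ne
        (measure_mono (iUnion_subset fun t => interior_subset.trans t.2.1)))
    have huniv : {t : Z | c ≤ volume (interior (t : Set (Euc d)))} = univ := by
      refine eq_univ_of_forall fun t => ?_
      obtain ⟨p, hp, v, hv⟩ := S.1.tile_type t (t.2.2 S hS)
      change c ≤ volume (interior (t : Set (Euc d)))
      rw [hv, interior_vadd, measure_vadd]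
      exact hc p hp
    rw [huniv, finite_univ_iff] at hfin
    exact toFinite Z
  have hf : ∀ i, Finite {t : Set (Euc d) // t ⊆ 𝓑.block i ∧ ∀ S ∈ 𝓑.vert i, t ∈ S.1.tiles} :=
    fun i => (hmain i).to_subtype
  refine Finite.of_injective
    (fun F : 𝓑.Region => (⟨F.idx, F.tile, F.tile_subset, F.tile_mem⟩ :
      Σ i, {t : Set (Euc d) // t ⊆ 𝓑.block i ∧ ∀ S ∈ 𝓑.vert i, t ∈ S.1.tiles})) ?_
  rintro ⟨i, t, h1, h2⟩ ⟨i', t', h1', h2'⟩ h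
  obtain ⟨rfl, h⟩ := Sigma.mk.inj h
  have := eq_of_heq h
  simp only [Subtype.mk.injEq] at this
  subst this
  rfl

/-! ## The expanding flattening sequence of a tiling -/

/-- The data from which an expanding flattening sequence of `T` is built: a sequence of box
decompositions, beginning with the decomposition of the hull into the boxes
`{S | the origin is interior to a tile of type p}` of the prototiles `p` that occur in `T`, each
of them zoomed out of the preceding one and forcing its border. -/
structure EFS (T : Tiling X) where
  level : ℕ → BoxDecomposition T
  prototile_block : ∀ i, (level 0).block i ∈ X
  prototile_vert : ∀ i, (level 0).vert i = {S : Hull T | (level 0).block i ∈ S.1.tiles}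
  zoomedOut : ∀ n, (level (n + 1)).ZoomedOut (level n)
  forcesBorder : ∀ n, (level (n + 1)).ForcesBorder (level n)

namespace EFS

/-- The branched oriented flat manifold `B_n`. -/
abbrev B (𝓕 : EFS T) (n : ℕ) : Type := (𝓕.level n).BOF

/-- The `d`-regions of `B_n`. -/
abbrev Region (𝓕 : EFS T) (n : ℕ) : Type := (𝓕.level n).Region

/-- The bonding map `f_n : B_{n+1} → B_n`, `f_n(x) = π_n(π_{n+1}⁻¹(x))`; the right hand side does
not depend on the chosen preimage of `x`. -/
noncomputable def f (𝓕 : EFS T) (n : ℕ) (x : 𝓕.B (n + 1)) : 𝓕.B n :=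
  (𝓕.level n).proj (Quot.out x)

/-- The map `(f_n)_*` induced by `f_n` on `d`-chains: every `d`-region of `B_{n+1}` is sent to the
`d`-region of `B_n` onto which `f_n` maps it. -/
noncomputable def push (𝓕 : EFS T) (n : ℕ) (w : 𝓕.Region (n + 1) → ℝ) : 𝓕.Region n → ℝ :=
  fun F => ∑ᶠ F' ∈ {F' : 𝓕.Region (n + 1) |
    𝓕.f n '' (𝓕.level (n + 1)).cell F' = (𝓕.level n).cell F}, w F'

/-- The inverse limit `𝓜(𝓕)` of the cones `W(B_n)`. -/
def M (𝓕 : EFS T) : Set (∀ n, 𝓕.Region n → ℝ) :=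
  {β | (∀ n, β n ∈ (𝓕.level n).W) ∧ ∀ n, 𝓕.push n (β (n + 1)) = β n}

/-- The inverse limit `𝓜*(𝓕)` of the cones `W*(B_n)`. -/
def Mstar (𝓕 : EFS T) : Set (∀ n, 𝓕.Region n → ℝ) :=
  {β | (∀ n, β n ∈ (𝓕.level n).Wstar) ∧ ∀ n, 𝓕.push n (β (n + 1)) = β n}

/-- The weights `τ_n(μ)(F) = μ(π_n⁻¹(F)) / λ_d(F)` of a measure on the hull. -/
noncomputable def τ (𝓕 : EFS T) (μ : Measure (Hull T)) : ∀ n, 𝓕.Region n → ℝ :=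
  fun n F => μ.real ((𝓕.level n).proj ⁻¹' (𝓕.level n).cell F) /
    (volume : Measure (Euc d)).real F.tile

end EFS

end TilingSpace

/-!
Invariant measures on the hull and weights on an expanding flattening sequence.

*Addresses.* By the zooming conditions every tile of every tiling represents, at every level `n`,
exactly one region of `B_n` (`EFS.exists_occurs`). As borders are forced, the region of level
`n + 1` that a tile represents determines the regions of level `n` of all tiles that touch it. Hence
two tilings in which one tile has the same addresses at all levels are equal
(`EFS.eq_of_forall_occurs`), and the transversal of a tile `p`, that is, the compact set of the
tilings that contain `p`, is the inverse limit of the finite sets of its addresses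
(`EFS.isRefining_address`). A measure on such a limit is the same thing as a compatible system of
weights (`IsRefining.ext_measure`, `IsRefining.exists_measure`; the latter is Carathéodory's theorem
for the algebra of open compact sets).

*From measures to weights.* In a box, an invariant measure is the product of Lebesgue measure and a
transverse measure (`BoxDecomposition.measure_slab_mul`), and `τ` records the transverse measures of
the verticals. The weights are compatible because the preimage in the hull of a
region of `B_n` is the disjoint union of the preimages of the regions of `B_{n+1}` over it
(`EFS.push_τ`). The switching rule at a wall point
compares the measures of two translates of the same set, a thickened fibre over this point, one of
which lies on either side of the wall (`EFS.switching_τ`). As the measure is determined by its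
transverse measures, `τ` is injective (`EFS.injOn_τ`). The hull is minimal because the tiling is
repetitive, so nonzero invariant measures have positive weights (`EFS.τ_pos`).

*From weights to measures.* Compatible weights define a measure on the transversal of every tile
(`EFS.exists_isTransverse`), and together with Lebesgue measure a measure on the hull
(`EFS.ofTransverse`) which has the given weights (`IsTransverse.τ_ofTransverse`). It remains to see
that this measure is invariant. If two tiles `t`, `t'` abut in a wall point `w`, then on the
tilings that contain both tiles the transverse measures of `t` and `t'` coincide, since their values
on the fibres over the image of `w` in `B_{n+1}` are the two sides of a switching rule
(`IsTransverse.restrict_cylinder_eq`). The germs at this image are finite in number because borders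
are forced from level one on. A small translation parallel to an axis moves almost every
point of the hull either within a tile or across a single wall, so it preserves the measure piece by
piece (`IsTransverse.ofTransverse_preimage_single_le`), and such translations generate `ℝ^d`.
-/

namespace TilingSpace

section

variable {d : ℕ} {X : Set (Set (Euc d))}

/-! ### Tiles of a tiling -/

/-- A nonempty compact set is a translate of itself in a unique way. -/
theorem vadd_set_injective {t : Set (Euc d)} (ht : IsCompact t) (hne : t.Nonempty)
    {v w : Euc d} (h : v +ᵥ t = w +ᵥ t) : v = w := by
  -- a point of `t` that is extremal in the direction of `v - w`
  obtain ⟨x, hx, hmax⟩ := ht.exists_isMaxOn hne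
    (f := fun x => inner ℝ (v - w) x) (by fun_prop)
  have hmem : -w +ᵥ (v +ᵥ x) ∈ t := by
    rw [← mem_vadd_set_iff_neg_vadd_mem, ← h]
    exact vadd_mem_vadd_set hx
  have hle : inner ℝ (v - w) (-w +ᵥ (v +ᵥ x)) ≤ inner ℝ (v - w) x := hmax hmem
  have he : -w +ᵥ (v +ᵥ x) = (v - w) + x := by simp only [vadd_eq_add]; abel
  rw [he, inner_add_right] at hle
  have h0 : inner ℝ (v - w) (v - w) ≤ 0 := by linarith
  exact sub_eq_zero.1 (real_inner_self_nonpos.1 h0)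

namespace Tiling

theorem mem_vadd_tiles {v : Euc d} {S : Tiling X} {t : Set (Euc d)} :
    t ∈ (v +ᵥ S).tiles ↔ -v +ᵥ t ∈ S.tiles := by
  rw [vadd_tiles, mem_vadd_set_iff_neg_vadd_mem]

theorem isCompact_of_mem_tiles (hX : IsPrototileSet X) {S : Tiling X} {t : Set (Euc d)}
    (ht : t ∈ S.tiles) : IsCompact t := by
  obtain ⟨p, hp, v, rfl⟩ := S.tile_type t ht
  exact (hX.isCompact p hp).vadd v

theorem closure_interior_of_mem_tiles (hX : IsPrototileSet X) {S : Tiling X} {t : Set (Euc d)}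
    (ht : t ∈ S.tiles) : closure (interior t) = t := by
  obtain ⟨p, hp, v, rfl⟩ := S.tile_type t ht
  rw [interior_vadd, closure_vadd, hX.regular p hp]

theorem nonempty_of_mem_tiles (hX : IsPrototileSet X) {S : Tiling X} {t : Set (Euc d)}
    (ht : t ∈ S.tiles) : t.Nonempty := by
  obtain ⟨p, hp, v, rfl⟩ := S.tile_type t ht
  exact (hX.isConnected p hp).nonempty.vadd_set

theorem nonempty_interior_of_mem_tiles (hX : IsPrototileSet X) {S : Tiling X} {t : Set (Euc d)}
    (ht : t ∈ S.tiles) : (interior t).Nonempty := by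
  rw [← closure_nonempty_iff, closure_interior_of_mem_tiles hX ht]
  exact nonempty_of_mem_tiles hX ht

/-- A tile whose interior contains a point of another tile is equal to it. -/
theorem eq_of_mem_interior (hX : IsPrototileSet X) {S : Tiling X} {s t : Set (Euc d)}
    (hs : s ∈ S.tiles) (ht : t ∈ S.tiles) {x : Euc d} (hxs : x ∈ interior s) (hxt : x ∈ t) :
    s = t := by
  by_contra hne
  rw [← closure_interior_of_mem_tiles hX ht, _root_.mem_closure_iff] at hxt
  obtain ⟨y, hys, hyt⟩ := hxt _ isOpen_interior hxs
  exact (S.disjoint_interior hs ht hne).le_bot ⟨hys, hyt⟩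

theorem exists_mem_tile (S : Tiling X) (x : Euc d) : ∃ t ∈ S.tiles, x ∈ t := by
  have : x ∈ ⋃₀ S.tiles := S.covers ▸ mem_univ x
  exact this

theorem exists_dist_le (hX : IsPrototileSet X) :
    ∃ D : ℝ, 0 < D ∧ ∀ S : Tiling X, ∀ t ∈ S.tiles, ∀ x ∈ t, ∀ y ∈ t, dist x y ≤ D := by
  have hb : ∀ p ∈ X, Bornology.IsBounded p := fun p hp => (hX.isCompact p hp).isBounded
  obtain ⟨D, hD⟩ := (hX.finite.image diam).bddAbove
  refine ⟨max D 1, by positivity, fun S t ht x hx y hy => ?_⟩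
  obtain ⟨p, hp, v, rfl⟩ := S.tile_type t ht
  obtain ⟨x, hx, rfl⟩ := hx
  obtain ⟨y, hy, rfl⟩ := hy
  simp only [dist_vadd_cancel_left]
  exact (dist_le_diam_of_mem (hb p hp) hx hy).trans
    ((hD (mem_image_of_mem _ hp)).trans (le_max_left _ _))

/-- All prototiles have an inner ball of one and the same radius. -/
theorem exists_ball_subset (hX : IsPrototileSet X) :
    ∃ r : ℝ, 0 < r ∧ ∀ S : Tiling X, ∀ t ∈ S.tiles, ∃ c, ball c r ⊆ interior t := by
  have h : ∀ p ∈ X, ∃ r : ℝ, 0 < r ∧ ∃ c, ball c r ⊆ interior p := by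
    intro p hp
    have hne : (interior p).Nonempty := by
      rw [← closure_nonempty_iff, hX.regular p hp]
      exact (hX.isConnected p hp).nonempty
    obtain ⟨c, hc⟩ := hne
    obtain ⟨r, hr, h⟩ := Metric.isOpen_iff.1 isOpen_interior c hc
    exact ⟨r, hr, c, h⟩
  choose! r hr h using h
  obtain ⟨r₀, hr₀, hle⟩ : ∃ r₀ : ℝ, 0 < r₀ ∧ ∀ p ∈ X, r₀ ≤ r p := by
    rcases X.eq_empty_or_nonempty with h | h
    · exact ⟨1, one_pos, by simp [h]⟩
    · obtain ⟨p, hp, hmin⟩ := exists_min_image X r hX.finite h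
      exact ⟨_, hr p hp, hmin⟩
  refine ⟨r₀, hr₀, fun S t ht => ?_⟩
  obtain ⟨p, hp, v, rfl⟩ := S.tile_type t ht
  obtain ⟨c, hc⟩ := h p hp
  refine ⟨v +ᵥ c, ?_⟩
  rw [interior_vadd, ← vadd_ball]
  exact vadd_set_mono ((ball_subset_ball (hle p hp)).trans hc)

/-- Only finitely many tiles meet a bounded set, since they have disjoint interiors of volume
bounded below. -/
theorem finite_tiles_inter (hX : IsPrototileSet X) (S : Tiling X) {K : Set (Euc d)}
    (hK : Bornology.IsBounded K) : {t ∈ S.tiles | (t ∩ K).Nonempty}.Finite := by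
  obtain ⟨D, hD, hdist⟩ := exists_dist_le hX
  obtain ⟨r, hr, hball⟩ := exists_ball_subset hX
  obtain ⟨R, hR⟩ := hK.subset_closedBall (0 : Euc d)
  set Z := {t ∈ S.tiles | (t ∩ K).Nonempty} with hZ
  have hsub : ∀ t : Z, (t : Set (Euc d)) ⊆ closedBall 0 (R + D) := by
    rintro ⟨t, ht, x, hxt, hxK⟩ y hy
    have h1 := hdist S t ht y hy x hxt
    have h2 := mem_closedBall.1 (hR hxK)
    rw [mem_closedBall]
    linarith [dist_triangle y x 0]
  have hfin := Measure.finite_const_le_meas_of_disjoint_iUnion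
    (volume : Measure (Euc d)) (As := fun t : Z => interior (t : Set (Euc d)))
    (measure_ball_pos volume (0 : Euc d) hr)
    (fun t => isOpen_interior.measurableSet)
    (fun s t hst => S.disjoint_interior s.2.1 t.2.1 fun h => hst (Subtype.ext h))
    (ne_top_of_le_ne_top (isCompact_closedBall (0 : Euc d) (R + D)).measure_lt_top.ne
      (measure_mono (iUnion_subset fun t => interior_subset.trans (hsub t))))
  have huniv : {t : Z | volume (ball (0 : Euc d) r) ≤
      volume (interior (t : Set (Euc d)))} = univ := by
    refine eq_univ_of_forall fun t => ?_
    obtain ⟨c, hc⟩ := hball S t t.2.1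
    refine le_trans (le_of_eq ?_) (measure_mono hc)
    rw [Measure.addHaar_ball_center volume c]
  rw [huniv, finite_univ_iff] at hfin
  exact toFinite Z

theorem countable_tiles (hX : IsPrototileSet X) (S : Tiling X) : S.tiles.Countable := by
  have : S.tiles ⊆ ⋃ n : ℕ, {t ∈ S.tiles | (t ∩ closedBall (0 : Euc d) n).Nonempty} := by
    intro t ht
    obtain ⟨x, hx⟩ := nonempty_of_mem_tiles hX ht
    obtain ⟨n, hn⟩ := exists_nat_ge (dist x 0)
    exact mem_iUnion.2 ⟨n, ht, x, hx, hn⟩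
  exact (countable_iUnion fun n =>
    (finite_tiles_inter hX S isBounded_closedBall).countable).mono this

/-- The union of any family of tiles of a tiling is closed. -/
theorem isClosed_sUnion (hX : IsPrototileSet X) (S : Tiling X) {𝒜 : Set (Set (Euc d))}
    (h𝒜 : 𝒜 ⊆ S.tiles) : IsClosed (⋃₀ 𝒜) := by
  rw [sUnion_eq_iUnion]
  refine LocallyFinite.isClosed_iUnion (fun x => ?_)
    fun t => (isCompact_of_mem_tiles hX (h𝒜 t.2)).isClosed
  refine ⟨ball x 1, ball_mem_nhds x one_pos, ?_⟩
  refine Finite.of_finite_image (f := Subtype.val) ?_ Subtype.val_injective.injOn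
  refine (finite_tiles_inter hX S (isBounded_ball (x := x) (r := 1))).subset ?_
  rintro _ ⟨t, ht, rfl⟩
  exact ⟨h𝒜 t.2, ht⟩

/-! ### The topology of the space of tilings -/

theorem restrict_vadd_closedBall {A A' : Tiling X} {R r : ℝ} {y : Euc d}
    (h : A.restrict (closedBall 0 R) = A'.restrict (closedBall 0 R)) (hr : r + ‖y‖ ≤ R) :
    (y +ᵥ A).restrict (closedBall 0 r) = (y +ᵥ A').restrict (closedBall 0 r) := by
  have hsub : closedBall (-y) r ⊆ closedBall (0 : Euc d) R := by
    refine closedBall_subset_closedBall' ?_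
    rwa [dist_zero_right, norm_neg]
  have hball : y +ᵥ closedBall (-y) r = closedBall (0 : Euc d) r := by
    rw [vadd_closedBall, vadd_eq_add, add_neg_cancel]
  rw [← hball, restrict_vadd, restrict_vadd, restrict_mono hsub h]

theorem mem_tiles_of_restrict_eq {A A' : Tiling X} {R r D : ℝ}
    (hD : ∀ S : Tiling X, ∀ t ∈ S.tiles, ∀ x ∈ t, ∀ y ∈ t, dist x y ≤ D)
    (h : A.restrict (closedBall 0 R) = A'.restrict (closedBall 0 R)) (hr : r + D ≤ R)
    {t : Set (Euc d)} (ht : t ∈ A.tiles) (hne : (t ∩ closedBall 0 r).Nonempty) :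
    t ∈ A'.tiles := by
  have hsub : ∀ S : Tiling X, ∀ s ∈ S.tiles, (s ∩ closedBall 0 r).Nonempty →
      s ∩ closedBall 0 R = s := by
    rintro S s hs ⟨x, hx, hxr⟩
    refine inter_eq_left.2 fun y hy => ?_
    have := hD S s hs y hy x hx
    rw [mem_closedBall] at hxr ⊢
    linarith [dist_triangle y x 0]
  have hmem : t ∈ A.restrict (closedBall 0 R) := by
    refine ⟨hne.mono inter_subset_left, t, ht, (hsub A t ht hne).symm⟩
  rw [h] at hmem
  obtain ⟨-, s, hs, he⟩ := hmem
  have : (s ∩ closedBall 0 r).Nonempty := by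
    obtain ⟨x, hx, hxr⟩ := hne
    exact ⟨x, (he ▸ hx : x ∈ s ∩ closedBall 0 R).1, hxr⟩
  rw [hsub A' s hs this] at he
  rwa [he]

/-- The relation behind the tiling distance: up to translations by vectors of norm at most `ε`
the two tilings coincide on the ball of radius `1/ε`. -/
def Close (ε : ℝ) (S S' : Tiling X) : Prop :=
  ∃ x ∈ closedBall (0 : Euc d) ε, ∃ x' ∈ closedBall (0 : Euc d) ε,
    (x +ᵥ S).restrict (closedBall 0 (1 / ε)) = (x' +ᵥ S').restrict (closedBall 0 (1 / ε))

theorem Close.mono {ε ε' : ℝ} {S S' : Tiling X} (h : Close ε S S') (h0 : 0 < ε) (hε : ε ≤ ε') :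
    Close ε' S S' := by
  obtain ⟨x, hx, x', hx', he⟩ := h
  exact ⟨x, closedBall_subset_closedBall hε hx, x', closedBall_subset_closedBall hε hx',
    restrict_mono (closedBall_subset_closedBall (one_div_le_one_div_of_le h0 hε)) he⟩

theorem Close.refl {ε : ℝ} (h0 : 0 < ε) (S : Tiling X) : Close ε S S :=
  ⟨0, mem_closedBall_self h0.le, 0, mem_closedBall_self h0.le, rfl⟩

theorem Close.symm {ε : ℝ} {S S' : Tiling X} (h : Close ε S S') : Close ε S' S := by
  obtain ⟨x, hx, x', hx', he⟩ := h
  exact ⟨x', hx', x, hx, he.symm⟩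

theorem Close.trans {ε : ℝ} {S S' S'' : Tiling X} (h0 : 0 < ε) (hε : ε ≤ 1 / 2)
    (h : Close ε S S') (h' : Close ε S' S'') : Close (2 * ε) S S'' := by
  obtain ⟨x, hx, x', hx', he⟩ := h
  obtain ⟨y, hy, y', hy', he'⟩ := h'
  rw [mem_closedBall_zero_iff] at hx hx' hy hy'
  have hr : ∀ z : Euc d, ‖z‖ ≤ ε → 1 / (2 * ε) + ‖z‖ ≤ 1 / ε := by
    intro z hz
    have h1 : 1 / ε = 1 / (2 * ε) + 1 / (2 * ε) := by field_simp; norm_num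
    have h2 : 1 / 2 ≤ 1 / (2 * ε) := by
      apply one_div_le_one_div_of_le <;> linarith
    linarith [h1]
  refine ⟨y + x, ?_, x' + y', ?_, ?_⟩
  · rw [mem_closedBall_zero_iff]; linarith [norm_add_le y x]
  · rw [mem_closedBall_zero_iff]; linarith [norm_add_le x' y']
  · rw [add_vadd, add_vadd, restrict_vadd_closedBall he (hr y hy), vadd_comm y x' S',
      restrict_vadd_closedBall he' (hr x' hx')]

theorem tilingDist_lt_iff {ε : ℝ} (hε : ε ≤ 1) {S S' : Tiling X} :
    tilingDist S S' < ε ↔ ∃ e, 0 < e ∧ e < ε ∧ Close e S S' := by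
  have hbdd : BddBelow (closeness S S') := ⟨0, fun y hy => hy.1.le⟩
  constructor
  · intro h
    by_cases hne : (closeness S S').Nonempty
    · rw [tilingDist, if_pos hne] at h
      obtain ⟨e, ⟨h0, -, hc⟩, he⟩ := exists_lt_of_csInf_lt hne h
      exact ⟨e, h0, he, hc⟩
    · rw [tilingDist, if_neg hne] at h
      linarith
  · rintro ⟨e, h0, he, hc⟩
    have hm : e ∈ closeness S S' := ⟨h0, he.trans_le hε, hc⟩
    rw [tilingDist, if_pos ⟨e, hm⟩]
    exact (csInf_le hbdd hm).trans_lt he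

theorem isOpen_iff_close {U : Set (Tiling X)} :
    IsOpen U ↔ ∀ S ∈ U, ∃ ε > 0, ∀ S', Close ε S S' → S' ∈ U := by
  rw [isOpen_def]
  refine forall₂_congr fun S _ => ⟨?_, ?_⟩
  · rintro ⟨ε, hε, h⟩
    have hm : 0 < min ε 1 := lt_min hε one_pos
    refine ⟨min ε 1 / 2, by positivity, fun S' hS' => h S' ?_⟩
    exact ((tilingDist_lt_iff (min_le_right ε 1)).2
      ⟨_, by positivity, half_lt_self hm, hS'⟩).trans_le (min_le_left _ _)
  · rintro ⟨ε, hε, h⟩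
    refine ⟨min ε 1, lt_min hε one_pos, fun S' hS' => h S' ?_⟩
    obtain ⟨e, h0, he, hc⟩ := (tilingDist_lt_iff (min_le_right ε 1)).1 hS'
    exact hc.mono h0 (he.le.trans (min_le_left _ _))

theorem mem_nhds_iff_close {S : Tiling X} {s : Set (Tiling X)} :
    s ∈ 𝓝 S ↔ ∃ ε > 0, ∀ S', Close ε S S' → S' ∈ s := by
  constructor
  · intro h
    obtain ⟨U, hUs, hU, hS⟩ := _root_.mem_nhds_iff.1 h
    obtain ⟨ε, hε, h⟩ := isOpen_iff_close.1 hU S hS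
    exact ⟨ε, hε, fun S' hS' => hUs (h S' hS')⟩
  · rintro ⟨ε, hε, h⟩
    rw [_root_.mem_nhds_iff]
    refine ⟨{y | ∃ δ > 0, ∀ z, Close δ y z → z ∈ s}, ?_, ?_, ⟨ε, hε, h⟩⟩
    · rintro y ⟨δ, hδ, hy⟩
      exact hy y (Close.refl hδ y)
    · rw [isOpen_iff_close]
      rintro y ⟨δ, hδ, hy⟩
      set η := min (δ / 2) (1 / 2) with hη
      have hη0 : 0 < η := by positivity
      refine ⟨η, hη0, fun y' hy' => ⟨η, hη0, fun z hz => hy z ?_⟩⟩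
      refine (hy'.trans hη0 (min_le_right _ _) hz).mono (by positivity) ?_
      linarith [min_le_left (δ / 2) (1 / 2 : ℝ)]

/-- The action of `ℝ^d` on the space of tilings is jointly continuous. -/
theorem continuous_vadd_prod : Continuous fun q : Euc d × Tiling X => q.1 +ᵥ q.2 := by
  rw [continuous_iff_continuousAt]
  rintro ⟨v, S⟩ s hs
  obtain ⟨ε, hε, h⟩ := mem_nhds_iff_close.1 hs
  rw [mem_map]
  set η := min (ε / 2) (1 / (1 / ε + ‖v‖)) with hη
  have hη0 : 0 < η := by positivity
  have h1 : ball v (ε / 2) ∈ 𝓝 v := ball_mem_nhds _ (by positivity)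
  have h2 : {S' | Close η S S'} ∈ 𝓝 S := mem_nhds_iff_close.2 ⟨η, hη0, fun _ h => h⟩
  filter_upwards [prod_mem_nhds h1 h2]
  rintro ⟨v', S'⟩ ⟨hv', x, hx, x', hx', he⟩
  refine h _ ⟨x, ?_, v - v' + x', ?_, ?_⟩
  · exact closedBall_subset_closedBall ((min_le_left _ _).trans (by linarith)) hx
  · rw [mem_closedBall_zero_iff] at hx' ⊢
    have h3 : ‖v - v'‖ < ε / 2 := by rw [← dist_eq_norm, dist_comm]; exact hv'
    linarith [norm_add_le (v - v') x', min_le_left (ε / 2) (1 / (1 / ε + ‖v‖))]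
  · have h4 : 1 / ε + ‖v‖ ≤ 1 / η := by
      rw [le_one_div (by positivity) hη0]
      exact min_le_right _ _
    have h5 := restrict_vadd_closedBall he h4
    rw [vadd_comm x v S]
    convert h5 using 2
    simp only [← add_vadd]
    congr 1
    abel

/-- Tilings at distance `0` are equal: a tile of one of them is a tile of the other up to
arbitrarily small displacements, and two such displaced tiles would overlap. -/
theorem eq_of_forall_close (hX : IsPrototileSet X) {S S' : Tiling X}
    (h : ∀ ε, 0 < ε → Close ε S S') : S = S' := by
  obtain ⟨D, hD, hdist⟩ := exists_dist_le hX
  suffices key : ∀ {S S' : Tiling X}, (∀ ε, 0 < ε → Close ε S S') → S.tiles ⊆ S'.tiles from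
    Tiling.ext ((key h).antisymm (key fun ε hε => (h ε hε).symm))
  intro S S' h t ht
  obtain ⟨c, hc⟩ := nonempty_interior_of_mem_tiles hX ht
  obtain ⟨r, hr, hball⟩ := Metric.isOpen_iff.1 isOpen_interior c hc
  have hstep : ∀ ε, 0 < ε → ∃ z : Euc d, ‖z‖ ≤ ε ∧ z +ᵥ t ∈ S'.tiles := by
    intro ε hε
    set η := min (ε / 2) (1 / (‖c‖ + ε + D)) with hη
    have hη0 : 0 < η := by positivity
    have hηε : η ≤ ε / 2 := min_le_left _ _
    obtain ⟨x, hx, x', hx', he⟩ := h η hη0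
    rw [mem_closedBall_zero_iff] at hx hx'
    have h4 : ‖c‖ + ε + D ≤ 1 / η := by
      rw [le_one_div (by positivity) hη0]
      exact min_le_right _ _
    have hmem : x +ᵥ t ∈ (x' +ᵥ S').tiles := by
      refine mem_tiles_of_restrict_eq hdist he h4 ?_ ⟨x +ᵥ c, ?_, ?_⟩
      · rw [vadd_tiles]; exact vadd_mem_vadd_set ht
      · exact vadd_mem_vadd_set (interior_subset hc)
      · rw [mem_closedBall_zero_iff, vadd_eq_add]
        linarith [norm_add_le x c]
    rw [mem_vadd_tiles, ← add_vadd] at hmem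
    refine ⟨-x' + x, ?_, hmem⟩
    have := norm_add_le (-x') x
    rw [norm_neg] at this
    linarith
  obtain ⟨z, hz, hzt⟩ := hstep (r / 4) (by positivity)
  -- all displacements smaller than `r / 4` are equal to `z`
  have huniq : ∀ z', ‖z'‖ ≤ r / 4 → z' +ᵥ t ∈ S'.tiles → z' = z := by
    intro z' hz' hzt'
    refine vadd_set_injective (isCompact_of_mem_tiles hX ht) (nonempty_of_mem_tiles hX ht) ?_
    refine eq_of_mem_interior hX hzt' hzt (x := z' +ᵥ c) ?_ ?_
    · rw [interior_vadd]; exact vadd_mem_vadd_set hc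
    · rw [mem_vadd_set_iff_neg_vadd_mem]
      refine interior_subset (hball ?_)
      rw [mem_ball, dist_eq_norm, vadd_eq_add, vadd_eq_add]
      have : -z + (z' + c) - c = z' - z := by abel
      rw [this]
      linarith [norm_sub_le z' z]
  have hz0 : z = 0 := by
    rw [← norm_le_zero_iff]
    refine le_of_forall_pos_le_add fun ε hε => ?_
    obtain ⟨z', hz', hzt'⟩ := hstep (min ε (r / 4)) (by positivity)
    rw [← huniq z' (hz'.trans (min_le_right _ _)) hzt']
    linarith [min_le_left ε (r / 4)]
  rwa [hz0, zero_vadd] at hzt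

theorem t2Space (hX : IsPrototileSet X) : T2Space (Tiling X) := by
  rw [t2_iff_nhds]
  intro S S' hne
  refine eq_of_forall_close hX fun ε hε => ?_
  set η := min (ε / 2) (1 / 2) with hη
  have hη0 : 0 < η := by positivity
  have h1 : {y | Close η S y} ∈ 𝓝 S := mem_nhds_iff_close.2 ⟨η, hη0, fun _ h => h⟩
  have h2 : {y | Close η S' y} ∈ 𝓝 S' := mem_nhds_iff_close.2 ⟨η, hη0, fun _ h => h⟩
  obtain ⟨y, hy, hy'⟩ :=
    hne.nonempty_of_mem (inter_mem (mem_inf_of_left h1) (mem_inf_of_right h2))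
  refine (hy.trans hη0 (min_le_right _ _) hy'.symm).mono (by positivity) ?_
  linarith [min_le_left (ε / 2) (1 / 2 : ℝ)]

end Tiling

end

section

variable {d : ℕ} {X : Set (Set (Euc d))} {T : Tiling X}

/-! ### Rectangles -/

theorem rect_eq_preimage (a b : Euc d) :
    rect a b = EuclideanSpace.equiv (Fin d) ℝ ⁻¹' (univ.pi fun k => Icc (a k) (b k)) := by
  ext x
  rw [mem_preimage, mem_univ_pi]
  rfl

theorem interior_rect (a b : Euc d) : interior (rect a b) = {x | ∀ k, a k < x k ∧ x k < b k} := by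
  have h := (EuclideanSpace.equiv (Fin d) ℝ).toHomeomorph.preimage_interior
    (univ.pi fun k => Icc (a k) (b k))
  rw [rect_eq_preimage]
  refine h.symm.trans ?_
  rw [interior_pi_set finite_univ]
  ext x
  simp

theorem isCompact_rect (a b : Euc d) : IsCompact (rect a b) := by
  rw [rect_eq_preimage]
  exact (EuclideanSpace.equiv (Fin d) ℝ).toHomeomorph.isClosedEmbedding.isCompact_preimage
    (isCompact_univ_pi fun k => isCompact_Icc)

theorem convex_rect (a b : Euc d) : Convex ℝ (rect a b) := by
  rw [rect_eq_preimage]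
  exact (convex_pi fun k _ => convex_Icc (a k) (b k)).is_linear_preimage
    (EuclideanSpace.equiv (Fin d) ℝ).toLinearMap.isLinear

theorem nonempty_interior_rect {a b : Euc d} (h : ∀ k, a k < b k) :
    (interior (rect a b)).Nonempty := by
  refine ⟨WithLp.toLp 2 fun k => (a k + b k) / 2, ?_⟩
  rw [interior_rect]
  intro k
  have := h k
  constructor <;> simp only [] <;> linarith

theorem vadd_rect (v a b : Euc d) : v +ᵥ rect a b = rect (v + a) (v + b) := by
  ext x
  rw [mem_vadd_set_iff_neg_vadd_mem]
  refine forall_congr' fun k => ?_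
  simp only [vadd_eq_add, PiLp.add_apply, PiLp.neg_apply]
  constructor <;> rintro ⟨h1, h2⟩ <;> constructor <;> linarith

theorem rect_injective {a b a' b' : Euc d} (h : ∀ k, a k < b k)
    (he : rect a b = rect a' b') : a = a' ∧ b = b' := by
  have ha : a ∈ rect a' b' := he ▸ fun k => ⟨le_rfl, (h k).le⟩
  have hb : b ∈ rect a' b' := he ▸ fun k => ⟨(h k).le, le_rfl⟩
  have ha' : a' ∈ rect a b := he ▸ fun k => ⟨le_rfl, (ha k).1.trans (ha k).2⟩
  have hb' : b' ∈ rect a b := he ▸ fun k => ⟨(ha k).1.trans (ha k).2, le_rfl⟩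
  exact ⟨PiLp.ext fun k => le_antisymm (ha' k).1 (ha k).1,
    PiLp.ext fun k => le_antisymm (hb k).2 (hb' k).2⟩

namespace IsRectangle

variable {R : Set (Euc d)}

theorem vadd (h : IsRectangle R) (v : Euc d) : IsRectangle (v +ᵥ R) := by
  obtain ⟨a, b, hab, rfl⟩ := h
  exact ⟨v + a, v + b, fun k => add_lt_add_right (hab k) (v k), vadd_rect v a b⟩

theorem convex (h : IsRectangle R) : Convex ℝ R := by
  obtain ⟨a, b, hab, rfl⟩ := h
  exact convex_rect a b

theorem isCompact (h : IsRectangle R) : IsCompact R := by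
  obtain ⟨a, b, hab, rfl⟩ := h
  exact isCompact_rect a b

theorem nonempty_interior (h : IsRectangle R) : (interior R).Nonempty := by
  obtain ⟨a, b, hab, rfl⟩ := h
  exact nonempty_interior_rect hab

theorem closure_interior (h : IsRectangle R) : closure (interior R) = R := by
  rw [h.convex.closure_interior_eq_closure_of_nonempty_interior h.nonempty_interior,
    h.isCompact.isClosed.closure_eq]

end IsRectangle

theorem IsBlock.isCompact {P : Set (Euc d)} (h : IsBlock P) : IsCompact P := by
  obtain ⟨-, 𝓡, hfin, hR, rfl⟩ := h
  exact hfin.isCompact_sUnion fun R hR' => (hR R hR').isCompact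

theorem IsBlock.closure_interior {P : Set (Euc d)} (h : IsBlock P) : closure (interior P) = P := by
  refine (closure_minimal interior_subset h.isCompact.isClosed).antisymm ?_
  obtain ⟨-, 𝓡, hfin, hR, rfl⟩ := h
  refine sUnion_subset fun R hR' => ?_
  rw [← (hR R hR').closure_interior]
  exact closure_mono (interior_mono (subset_sUnion_of_mem hR'))

namespace Tiling

theorem isRectangle_of_mem_tiles (hrect : ∀ p ∈ X, IsRectangle p) {S : Tiling X} {t : Set (Euc d)}
    (ht : t ∈ S.tiles) : IsRectangle t := by
  obtain ⟨p, hp, v, rfl⟩ := S.tile_type t ht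
  exact (hrect p hp).vadd v

/-- Almost every point of `ℝ^d` is interior to a tile. -/
theorem volume_compl_interior_tiles (hX : IsPrototileSet X) (hrect : ∀ p ∈ X, IsRectangle p)
    (S : Tiling X) : volume {v : Euc d | ∀ t ∈ S.tiles, v ∉ interior t} = 0 := by
  have hsub : {v : Euc d | ∀ t ∈ S.tiles, v ∉ interior t} ⊆ ⋃ t ∈ S.tiles, frontier t := by
    intro v hv
    obtain ⟨t, ht, hvt⟩ := S.exists_mem_tile v
    exact mem_biUnion ht ⟨subset_closure hvt, hv t ht⟩
  refine measure_mono_null hsub ((measure_biUnion_null_iff (countable_tiles hX S)).2 fun t ht => ?_)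
  exact (isRectangle_of_mem_tiles hrect ht).convex.addHaar_frontier volume

/-- If `A` contains all tiles of `S` near the ball of radius `r`, then both tilings coincide
there. -/
theorem restrict_eq_of_subset (hX : IsPrototileSet X) {S A : Tiling X} {r : ℝ}
    (h : ∀ t ∈ S.tiles, (t ∩ closedBall 0 (r + 1)).Nonempty → t ∈ A.tiles) :
    S.restrict (closedBall 0 r) = A.restrict (closedBall 0 r) := by
  have hA : ∀ t ∈ A.tiles, (t ∩ closedBall 0 r).Nonempty → t ∈ S.tiles := by
    rintro t ht ⟨x, hxt, hxr⟩
    have hxt' := hxt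
    rw [← closure_interior_of_mem_tiles hX ht, Metric.mem_closure_iff] at hxt'
    obtain ⟨y, hy, hxy⟩ := hxt' 1 one_pos
    obtain ⟨s, hs, hys⟩ := S.exists_mem_tile y
    have hsA : s ∈ A.tiles := by
      refine h s hs ⟨y, hys, ?_⟩
      rw [mem_closedBall] at hxr ⊢
      rw [dist_comm] at hxy
      linarith [dist_triangle y x 0]
    rwa [eq_of_mem_interior hX ht hsA hy hys]
  have hS : ∀ t ∈ S.tiles, (t ∩ closedBall 0 r).Nonempty → t ∈ A.tiles := fun t ht hne =>
    h t ht (hne.mono (inter_subset_inter_right _ (closedBall_subset_closedBall (by linarith))))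
  ext s
  constructor
  · rintro ⟨hne, t, ht, rfl⟩
    exact ⟨hne, t, hS t ht hne, rfl⟩
  · rintro ⟨hne, t, ht, rfl⟩
    exact ⟨hne, t, hA t ht hne, rfl⟩

end Tiling

/-! ### The hull -/

theorem Hull.vadd_val (v : Euc d) (x : Hull T) : (v +ᵥ x).1 = v +ᵥ x.1 := rfl

theorem Hull.mem_vadd_tiles {v : Euc d} {x : Hull T} {t : Set (Euc d)} :
    t ∈ (v +ᵥ x).1.tiles ↔ -v +ᵥ t ∈ x.1.tiles := Tiling.mem_vadd_tiles

theorem Hull.vadd_mem_vadd_tiles {v : Euc d} {x : Hull T} {t : Set (Euc d)}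
    (ht : t ∈ x.1.tiles) : v +ᵥ t ∈ (v +ᵥ x).1.tiles := by
  rwa [Hull.mem_vadd_tiles, neg_vadd_vadd]

theorem Hull.continuous_vadd_prod : Continuous fun q : Euc d × Hull T => q.1 +ᵥ q.2 :=
  Continuous.subtype_mk (Tiling.continuous_vadd_prod.comp
    (continuous_fst.prodMk (continuous_subtype_val.comp continuous_snd))) _

theorem Hull.continuous_vadd (v : Euc d) : Continuous fun x : Hull T => v +ᵥ x :=
  Hull.continuous_vadd_prod.comp (continuous_const.prodMk continuous_id)

theorem Hull.continuous_vadd_left (x : Hull T) : Continuous fun v : Euc d => v +ᵥ x :=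
  Hull.continuous_vadd_prod.comp (continuous_id.prodMk continuous_const)

theorem Hull.t2Space (hX : IsPrototileSet X) (T : Tiling X) : T2Space (Hull T) :=
  haveI := Tiling.t2Space hX
  inferInstance

theorem Hull.measurable_vadd_prod : Measurable fun q : Euc d × Hull T => q.1 +ᵥ q.2 :=
  Hull.continuous_vadd_prod.measurable

/-- The tiling `T` as a point of its hull. -/
def Hull.base (T : Tiling X) : Hull T :=
  ⟨T, subset_closure ⟨0, zero_vadd (Euc d) T⟩⟩

/-- The hull of a repetitive tiling is minimal: every orbit meets every nonempty open set. -/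
theorem Hull.exists_vadd_mem (hX : IsPrototileSet X) (hT : T.Repetitive) {U : Set (Hull T)}
    (hU : IsOpen U) (hne : U.Nonempty) (S : Hull T) : ∃ v : Euc d, v +ᵥ S ∈ U := by
  obtain ⟨D, hD, hdist⟩ := Tiling.exists_dist_le hX
  obtain ⟨V, hV, rfl⟩ := isOpen_induced_iff.1 hU
  obtain ⟨y, hy⟩ := hne
  obtain ⟨_, hwV, w, rfl⟩ := _root_.mem_closure_iff.1 y.2 V hV hy
  obtain ⟨ε, hε, h⟩ := Tiling.isOpen_iff_close.1 hV _ hwV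
  -- the patch of `T` which determines that a tiling is close to `w +ᵥ T`
  set Q : Set (Set (Euc d)) :=
    {t ∈ T.tiles | (t ∩ (-w +ᵥ closedBall (0 : Euc d) (1 / ε + 1))).Nonempty} with hQ
  have hQfin : Q.Finite := Tiling.finite_tiles_inter hX T (isBounded_closedBall.vadd (-w))
  obtain ⟨s, hs, hrep⟩ := hT Q (fun t ht => ht.1) hQfin
  set δ := 1 / (s + D) with hδ
  have hδ0 : 0 < δ := by positivity
  have hnb : {y : Tiling X | Tiling.Close δ S.1 y} ∈ 𝓝 S.1 :=
    Tiling.mem_nhds_iff_close.2 ⟨δ, hδ0, fun _ h => h⟩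
  obtain ⟨_, hc, a, rfl⟩ := mem_closure_iff_nhds.1 S.2 _ hnb
  obtain ⟨x, -, x', -, he⟩ := hc
  have h1δ : 1 / δ = s + D := by rw [hδ, one_div_one_div]
  rw [h1δ] at he
  obtain ⟨v, hvT, hvs⟩ := hrep (-(x' + a))
  set z : Euc d := -x + (x' + a + v) with hz
  -- the translate by `z` of the patch occurs in `S`
  have key : ∀ t ∈ Q, z +ᵥ t ∈ S.1.tiles := by
    intro t ht
    have h1 : (x' + a) +ᵥ (v +ᵥ t) ∈ (x +ᵥ S.1).tiles := by
      refine Tiling.mem_tiles_of_restrict_eq hdist he.symm le_rfl ?_ ?_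
      · rw [Tiling.mem_vadd_tiles, Tiling.mem_vadd_tiles]
        convert hvT (vadd_mem_vadd_set ht) using 1
        simp only [← add_vadd]
        congr 1
        abel
      · obtain ⟨q, hq⟩ := Tiling.nonempty_of_mem_tiles hX ht.1
        refine ⟨_, vadd_mem_vadd_set (vadd_mem_vadd_set hq), ?_⟩
        have h2 : v +ᵥ q ∈ closedBall (-(x' + a)) s :=
          hvs ⟨_, vadd_mem_vadd_set ht, vadd_mem_vadd_set hq⟩
        rw [mem_closedBall, dist_eq_norm] at h2 ⊢
        convert h2 using 2
        simp only [vadd_eq_add]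
        abel
    rw [Tiling.mem_vadd_tiles] at h1
    convert h1 using 1
    simp only [← add_vadd, hz]
  refine ⟨w - z, h _ ⟨0, mem_closedBall_self hε.le, 0, mem_closedBall_self hε.le, ?_⟩⟩
  rw [zero_vadd, zero_vadd]
  refine Tiling.restrict_eq_of_subset hX fun t ht hmeet => ?_
  rw [Hull.vadd_val, Tiling.mem_vadd_tiles]
  have ht' : -w +ᵥ t ∈ Q := by
    refine ⟨Tiling.mem_vadd_tiles.1 ht, ?_⟩
    rw [← vadd_set_inter]
    exact hmeet.vadd_set
  convert key _ ht' using 1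
  rw [← add_vadd]
  congr 1
  abel

end

section

variable {d : ℕ} {X : Set (Set (Euc d))} {T : Tiling X}

/-! ### Boxes and cells -/

namespace BoxDecomposition

variable (𝓑 : BoxDecomposition T)

theorem isOpen_vadd_vert (i : Fin 𝓑.card) {V : Set (Euc d)} (hV : IsOpen V)
    (hVi : V ⊆ interior (𝓑.block i)) {D : Set (Hull T)} (hD : IsOpen D) :
    IsOpen {x : Hull T | ∃ v ∈ V, ∃ S ∈ 𝓑.vert i, S ∈ D ∧ x = -v +ᵥ S} := by
  have h1 : IsOpen {q : ↥(interior (𝓑.block i)) × ↥(𝓑.vert i) | q.1.1 ∈ V ∧ q.2.1 ∈ D} :=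
    (hV.preimage (continuous_subtype_val.comp continuous_fst)).inter
      (hD.preimage (continuous_subtype_val.comp continuous_snd))
  convert (𝓑.chart i).isOpenMap _ h1 using 1
  ext x
  constructor
  · rintro ⟨v, hv, S, hS, hSD, rfl⟩
    exact ⟨(⟨v, hVi hv⟩, ⟨S, hS⟩), ⟨hv, hSD⟩, rfl⟩
  · rintro ⟨⟨⟨v, hv⟩, ⟨S, hS⟩⟩, ⟨hvV, hSD⟩, rfl⟩
    exact ⟨v, hvV, S, hS, hSD, rfl⟩

theorem isOpen_vadd_vert_univ (i : Fin 𝓑.card) {V : Set (Euc d)} (hV : IsOpen V)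
    (hVi : V ⊆ interior (𝓑.block i)) :
    IsOpen {x : Hull T | ∃ v ∈ V, ∃ S ∈ 𝓑.vert i, x = -v +ᵥ S} := by
  simpa using 𝓑.isOpen_vadd_vert i hV hVi isOpen_univ

theorem isOpen_box (i : Fin 𝓑.card) : IsOpen (𝓑.box i) :=
  𝓑.isOpen_vadd_vert_univ i isOpen_interior subset_rfl

theorem idx_eq_of_mem_box {x : Hull T} {i j : Fin 𝓑.card} (hi : x ∈ 𝓑.box i)
    (hj : x ∈ 𝓑.box j) : i = j := by
  by_contra hne
  exact (𝓑.disjoint hne).le_bot ⟨hi, hj⟩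

/-- The points of a box lie in the closed chart of no other box, and have only one pair of
coordinates, even when the closed block is used. -/
theorem eq_of_mem_block {i j : Fin 𝓑.card} {v w : Euc d} {S S' : Hull T}
    (hv : v ∈ interior (𝓑.block i)) (hS : S ∈ 𝓑.vert i) (hw : w ∈ 𝓑.block j)
    (hS' : S' ∈ 𝓑.vert j) (h : -v +ᵥ S = -w +ᵥ S') : i = j ∧ v = w ∧ S = S' := by
  -- the points `-w' +ᵥ S'` with `w'` in the interior of the block and near `w`
  have hcl : w ∈ closure (interior (𝓑.block j)) := (𝓑.isBlock j).closure_interior.symm ▸ hw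
  have hlim : Tendsto (fun w' : Euc d => -w' +ᵥ S') (𝓝 w) (𝓝 (-v +ᵥ S)) := by
    rw [h]
    exact ((Hull.continuous_vadd_left S').comp continuous_neg).tendsto w
  have hbox : -v +ᵥ S ∈ 𝓑.box i := ⟨v, hv, S, hS, rfl⟩
  obtain ⟨w', hw'i, hw'j⟩ := mem_closure_iff_nhds.1 hcl _
    (hlim ((𝓑.isOpen_box i).mem_nhds hbox))
  obtain rfl : i = j := 𝓑.idx_eq_of_mem_box hw'i ⟨w', hw'j, S', hS', rfl⟩
  have hvw : v = w := by
    by_contra hne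
    obtain ⟨A, B, hA, hB, hvA, hwB, hAB⟩ := t2_separation hne
    have hopen := 𝓑.isOpen_vadd_vert_univ i (hA.inter isOpen_interior) inter_subset_right
    obtain ⟨u, ⟨⟨a, ⟨haA, hai⟩, S₁, hS₁, hu⟩, huB⟩, hui⟩ := mem_closure_iff_nhds.1 hcl _
      (inter_mem (hlim (hopen.mem_nhds ⟨v, ⟨hvA, hv⟩, S, hS, rfl⟩)) (hB.mem_nhds hwB))
    have := (𝓑.chart i).injective
      (a₁ := (⟨u, hui⟩, ⟨S', hS'⟩)) (a₂ := (⟨a, hai⟩, ⟨S₁, hS₁⟩)) hu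
    have hua : u = a := congrArg (fun q => q.1.1) this
    exact hAB.le_bot ⟨hua ▸ haA, huB⟩
  subst hvw
  exact ⟨rfl, rfl, (vadd_left_cancel_iff (-v)).1 h⟩

theorem proj_eq_of_mem_vert {i : Fin 𝓑.card} {v : Euc d} (hv : v ∈ 𝓑.block i) {S S' : Hull T}
    (hS : S ∈ 𝓑.vert i) (hS' : S' ∈ 𝓑.vert i) : 𝓑.proj (-v +ᵥ S) = 𝓑.proj (-v +ᵥ S') :=
  Quot.sound ⟨i, v, hv, S, hS, S', hS', rfl, rfl⟩

theorem SameVertical.symm {𝓑 : BoxDecomposition T} {x y : Hull T} (h : 𝓑.SameVertical x y) :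
    𝓑.SameVertical y x := by
  obtain ⟨i, v, hv, S, hS, S', hS', hx, hy⟩ := h
  exact ⟨i, v, hv, S', hS', S, hS, hy, hx⟩

/-- A property that passes from a point to the points on the same vertical of a closed box
is constant on the fibres of the projection. -/
theorem of_proj_eq {x y : Hull T} (h : 𝓑.proj x = 𝓑.proj y) {p : Hull T → Prop}
    (hp : ∀ x y, 𝓑.SameVertical x y → p x → p y) (hx : p x) : p y := by
  have hxy := Quot.eqvGen_exact h
  have : p x ↔ p y := by
    clear hx h
    induction hxy with
    | rel x y h => exact ⟨hp x y h, hp y x h.symm⟩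
    | refl x => exact Iff.rfl
    | symm x y _ ih => exact ih.symm
    | trans x y z _ _ ih1 ih2 => exact ih1.trans ih2
  exact this.1 hx

/-- In the interior of a box the fibres of the projection are the verticals. -/
theorem proj_eq_iff {i : Fin 𝓑.card} {v : Euc d} (hv : v ∈ interior (𝓑.block i)) {S : Hull T}
    (hS : S ∈ 𝓑.vert i) {y : Hull T} :
    𝓑.proj y = 𝓑.proj (-v +ᵥ S) ↔ ∃ S' ∈ 𝓑.vert i, y = -v +ᵥ S' := by
  constructor
  · intro h
    refine 𝓑.of_proj_eq h.symm (p := fun y => ∃ S' ∈ 𝓑.vert i, y = -v +ᵥ S') ?_ ⟨S, hS, rfl⟩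
    rintro x y ⟨j, w, hw, S₁, hS₁, S₂, hS₂, hx, rfl⟩ ⟨S', hS', hx'⟩
    obtain ⟨rfl, rfl, -⟩ := 𝓑.eq_of_mem_block hv hS' hw hS₁ (hx'.symm.trans hx)
    exact ⟨S₂, hS₂, rfl⟩
  · rintro ⟨S', hS', rfl⟩
    exact 𝓑.proj_eq_of_mem_vert (interior_subset hv) hS' hS

/-- The open subset of the hull over a `d`-region: the tilings in which the origin is interior to
the tile given by the region. -/
def tower (F : 𝓑.Region) : Set (Hull T) :=
  {x | ∃ v ∈ interior F.tile, ∃ S ∈ 𝓑.vert F.idx, x = -v +ᵥ S}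

theorem preimage_cell (F : 𝓑.Region) : 𝓑.proj ⁻¹' 𝓑.cell F = 𝓑.tower F := by
  refine Subset.antisymm (fun y hy => ?_) (subset_preimage_image _ _)
  obtain ⟨_, ⟨v, hv, S, hS, rfl⟩, h⟩ := hy
  obtain ⟨S', hS', rfl⟩ := (𝓑.proj_eq_iff (interior_mono F.tile_subset hv) hS).1 h.symm
  exact ⟨v, hv, S', hS', rfl⟩

theorem isOpen_tower (F : 𝓑.Region) : IsOpen (𝓑.tower F) :=
  𝓑.isOpen_vadd_vert_univ F.idx isOpen_interior (interior_mono F.tile_subset)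

namespace Region

variable {𝓑} {R R' : 𝓑.Region}

theorem ext' (h : R.idx = R'.idx) (h' : R.tile = R'.tile) : R = R' := by
  cases R
  cases R'
  simp only at h h'
  subst h h'
  rfl

variable (R) in
theorem exists_vert : ∃ S, S ∈ 𝓑.vert R.idx := 𝓑.vert_nonempty R.idx

theorem isCompact_tile (hX : IsPrototileSet X) (R : 𝓑.Region) : IsCompact R.tile :=
  have ⟨_, hS⟩ := R.exists_vert
  Tiling.isCompact_of_mem_tiles hX (R.tile_mem _ hS)

theorem nonempty_interior_tile (hX : IsPrototileSet X) (R : 𝓑.Region) :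
    (interior R.tile).Nonempty :=
  have ⟨_, hS⟩ := R.exists_vert
  Tiling.nonempty_interior_of_mem_tiles hX (R.tile_mem _ hS)

theorem volume_real_tile_pos (hX : IsPrototileSet X) (R : 𝓑.Region) :
    0 < (volume : Measure (Euc d)).real R.tile := by
  refine ENNReal.toReal_pos ?_ (R.isCompact_tile hX).measure_lt_top.ne
  exact ((isOpen_interior.measure_pos _ (R.nonempty_interior_tile hX)).trans_le
    (measure_mono interior_subset)).ne'

end Region

theorem nonempty_tower (hX : IsPrototileSet X) (R : 𝓑.Region) : (𝓑.tower R).Nonempty := by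
  obtain ⟨v, hv⟩ := R.nonempty_interior_tile hX
  obtain ⟨S, hS⟩ := R.exists_vert
  exact ⟨_, v, hv, S, hS, rfl⟩

/-- The tile that represents the region `R` occurs in the tiling `x`, displaced by `u`. -/
def Occurs (x : Hull T) (R : 𝓑.Region) (u : Euc d) : Prop := -u +ᵥ x ∈ 𝓑.vert R.idx

variable {𝓑} in
theorem Occurs.mem_tiles {x : Hull T} {R : 𝓑.Region} {u : Euc d} (h : 𝓑.Occurs x R u) :
    u +ᵥ R.tile ∈ x.1.tiles := by
  have := R.tile_mem _ h
  rwa [Hull.mem_vadd_tiles, neg_neg] at this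

variable {𝓑} in
theorem Occurs.vadd {x : Hull T} {R : 𝓑.Region} {u : Euc d} (h : 𝓑.Occurs x R u) (v : Euc d) :
    𝓑.Occurs (v +ᵥ x) R (v + u) := by
  unfold Occurs
  rwa [← add_vadd, neg_add_rev, neg_add_cancel_right]

variable {𝓑} in
/-- A tile of a tiling represents at most one region. -/
theorem Occurs.unique (hX : IsPrototileSet X) {x : Hull T} {R R' : 𝓑.Region} {u u' : Euc d}
    (h : 𝓑.Occurs x R u) (h' : 𝓑.Occurs x R' u') (he : u +ᵥ R.tile = u' +ᵥ R'.tile) :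
    R = R' ∧ u = u' := by
  obtain ⟨v, hv⟩ := R.nonempty_interior_tile hX
  have hw : u - u' + v ∈ interior R'.tile := by
    have h1 : u +ᵥ v ∈ u' +ᵥ interior R'.tile := by
      rw [← interior_vadd, ← he, interior_vadd]
      exact vadd_mem_vadd_set hv
    rw [mem_vadd_set_iff_neg_vadd_mem] at h1
    convert h1 using 1
    simp only [vadd_eq_add]
    abel
  obtain ⟨h1, h2, -⟩ := 𝓑.eq_of_mem_block (interior_mono R.tile_subset hv) h
    (interior_subset (interior_mono R'.tile_subset hw)) h' (by
      rw [← add_vadd, ← add_vadd]; congr 1; abel)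
  have hu : u = u' := by
    have : u - u' = 0 := by simpa using h2
    exact sub_eq_zero.1 this
  subst hu
  exact ⟨Region.ext' h1 (vadd_left_cancel _ he), rfl⟩

theorem mem_tower_iff {x : Hull T} {R : 𝓑.Region} :
    x ∈ 𝓑.tower R ↔ ∃ u, 𝓑.Occurs x R u ∧ (0 : Euc d) ∈ interior (u +ᵥ R.tile) := by
  constructor
  · rintro ⟨v, hv, S, hS, rfl⟩
    refine ⟨-v, ?_, ?_⟩
    · unfold Occurs
      rwa [neg_neg, vadd_neg_vadd]
    · rw [interior_vadd, mem_vadd_set_iff_neg_vadd_mem]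
      simpa using hv
  · rintro ⟨u, hu, h0⟩
    rw [interior_vadd, mem_vadd_set_iff_neg_vadd_mem] at h0
    refine ⟨-u, by simpa using h0, _, hu, ?_⟩
    rw [neg_neg, vadd_neg_vadd]

end BoxDecomposition

end

section

variable {d : ℕ} {X : Set (Set (Euc d))} {T : Tiling X}

/-! ### Addresses of tiles in an expanding flattening sequence -/

theorem Tiling.eq_of_tiles_subset (hX : IsPrototileSet X) {S S' : Tiling X}
    (h : S.tiles ⊆ S'.tiles) : S = S' := by
  refine Tiling.ext (h.antisymm fun s hs => ?_)
  obtain ⟨w, hw⟩ := nonempty_interior_of_mem_tiles hX hs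
  obtain ⟨t, ht, hwt⟩ := S.exists_mem_tile w
  rwa [eq_of_mem_interior hX hs (h ht) hw hwt]

theorem BoxDecomposition.exists_mem_block (hX : IsPrototileSet X) (𝓑 : BoxDecomposition T)
    (x : Hull T) : ∃ i, ∃ v ∈ 𝓑.block i, ∃ S ∈ 𝓑.vert i, x = -v +ᵥ S := by
  have := Hull.t2Space hX T
  have hx : x ∈ ⋃ i, closure (𝓑.box i) := by
    have : (⋃ i, closure (𝓑.box i)) = univ := 𝓑.covers
    rw [this]
    trivial
  obtain ⟨i, hi⟩ := mem_iUnion.1 hx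
  have hc : IsCompact ((fun q : Euc d × Hull T => -q.1 +ᵥ q.2) '' (𝓑.block i ×ˢ 𝓑.vert i)) :=
    ((𝓑.isBlock i).isCompact.prod (𝓑.vert_isCompact i)).image
      (Hull.continuous_vadd_prod.comp (continuous_fst.neg.prodMk continuous_snd))
  have hsub : 𝓑.box i ⊆
      (fun q : Euc d × Hull T => -q.1 +ᵥ q.2) '' (𝓑.block i ×ˢ 𝓑.vert i) := by
    rintro _ ⟨v, hv, S, hS, rfl⟩
    exact ⟨(v, S), ⟨interior_subset hv, hS⟩, rfl⟩
  obtain ⟨⟨v, S⟩, ⟨hv, hS⟩, rfl⟩ := closure_minimal hsub hc.isClosed hi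
  exact ⟨i, v, hv, S, hS, rfl⟩

namespace EFS

variable (𝓕 : EFS T)

/-- The boundary of a block contains no interior point of a tile. -/
theorem notMem_interior_of_mem_frontier (hX : IsPrototileSet X) (n : ℕ)
    (i : Fin (𝓕.level n).card) {S : Hull T} (hS : S ∈ (𝓕.level n).vert i) {w : Euc d}
    (hw : w ∈ frontier ((𝓕.level n).block i)) {t : Set (Euc d)} (ht : t ∈ S.1.tiles) :
    w ∉ interior t := by
  induction n generalizing S w t with
  | zero =>
    intro hwt
    have hmem : (𝓕.level 0).block i ∈ S.1.tiles := by
      rw [𝓕.prototile_vert i] at hS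
      exact hS
    have hwb : w ∈ (𝓕.level 0).block i :=
      ((𝓕.level 0).isBlock i).isCompact.isClosed.frontier_subset hw
    obtain rfl := Tiling.eq_of_mem_interior hX ht hmem hwt hwb
    exact hw.2 hwt
  | succ n ih =>
    intro hwt
    have h1 : -w +ᵥ S ∈ (𝓕.level (n + 1)).verticalBoundary i := ⟨w, hw, S, hS, rfl⟩
    obtain ⟨j, w', hw', S', hS', h⟩ := mem_iUnion.1 ((𝓕.zoomedOut n).verticalBoundary_subset i h1)
    have h2 : w' +ᵥ (-w +ᵥ t) ∈ S'.1.tiles := by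
      have h3 : -w +ᵥ t ∈ (-w +ᵥ S).1.tiles := Hull.vadd_mem_vadd_tiles ht
      rwa [h, Hull.mem_vadd_tiles, neg_neg] at h3
    refine ih j hS' hw' h2 ?_
    rw [interior_vadd, interior_vadd, mem_vadd_set_iff_neg_vadd_mem,
      mem_vadd_set_iff_neg_vadd_mem]
    simpa using hwt

/-- A region of `B_n` seen at one point of a vertical of a box of level `n + 1` is seen
at the corresponding point of every tiling of that vertical. -/
theorem occurs_of_mem_vert {n : ℕ} {j : Fin (𝓕.level (n + 1)).card} {S S' : Hull T}
    (hS : S ∈ (𝓕.level (n + 1)).vert j) (hS' : S' ∈ (𝓕.level (n + 1)).vert j)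
    {R : 𝓕.Region n} {u v : Euc d} (hR : (𝓕.level n).Occurs S R u)
    (hv : v ∈ interior ((𝓕.level (n + 1)).block j)) (hvR : v ∈ interior (u +ᵥ R.tile)) :
    (𝓕.level n).Occurs S' R u := by
  have hv' : v - u ∈ interior ((𝓕.level n).block R.idx) := by
    rw [interior_vadd, mem_vadd_set_iff_neg_vadd_mem, vadd_eq_add, neg_add_eq_sub] at hvR
    exact interior_mono R.tile_subset hvR
  have hx : -v +ᵥ S = -(v - u) +ᵥ (-u +ᵥ S) := by
    rw [← add_vadd]
    congr 1
    abel
  have hsub := (𝓕.zoomedOut n).verticalOf_subset j R.idx (-v +ᵥ S) ⟨v, hv, S, hS, rfl⟩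
    ⟨v - u, hv', _, hR, hx⟩
  obtain ⟨v₁, hv₁, S₁, hS₁, S₂, hS₂, h₁, h₂⟩ := hsub ⟨v, hv, S, hS, S', hS', rfl, rfl⟩
  obtain ⟨-, rfl, -⟩ := (𝓕.level n).eq_of_mem_block hv' hR (interior_subset hv₁) hS₁
    (hx.symm.trans h₁)
  have : -u +ᵥ S' = S₂ := by
    rw [← vadd_left_cancel_iff (-(v - u)), ← h₂, ← add_vadd]
    congr 1
    abel
  unfold BoxDecomposition.Occurs
  rwa [this]

/-- Every tile of every tiling represents a region of `B_n`. -/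
theorem exists_occurs (hX : IsPrototileSet X) (hrect : ∀ p ∈ X, IsRectangle p) (n : ℕ)
    (x : Hull T) {t : Set (Euc d)} (ht : t ∈ x.1.tiles) :
    ∃ (R : 𝓕.Region n) (u : Euc d), (𝓕.level n).Occurs x R u ∧ u +ᵥ R.tile = t := by
  induction n with
  | zero =>
    obtain ⟨w, hw⟩ := Tiling.nonempty_interior_of_mem_tiles hX ht
    obtain ⟨i, v, hv, S, hS, h⟩ := (𝓕.level 0).exists_mem_block hX (-w +ᵥ x)
    have hmem : ∀ S ∈ (𝓕.level 0).vert i, (𝓕.level 0).block i ∈ S.1.tiles := by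
      intro S hS
      rw [𝓕.prototile_vert i] at hS
      exact hS
    have hxS : -(w - v) +ᵥ x = S := by
      rw [← vadd_left_cancel_iff (-v), ← h, ← add_vadd]
      congr 1
      abel
    refine ⟨⟨i, _, subset_rfl, hmem⟩, w - v, ?_, ?_⟩
    · unfold BoxDecomposition.Occurs
      rwa [hxS]
    · have h1 : (w - v) +ᵥ (𝓕.level 0).block i ∈ x.1.tiles := by
        have := hmem S hS
        rwa [← hxS, Hull.mem_vadd_tiles, neg_neg] at this
      refine (Tiling.eq_of_mem_interior hX ht h1 hw ?_).symm
      rw [mem_vadd_set_iff_neg_vadd_mem]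
      simpa using hv
  | succ n ih =>
    obtain ⟨R, u₀, hR, rfl⟩ := ih
    set t := u₀ +ᵥ R.tile with htdef
    obtain ⟨w, hw⟩ := Tiling.nonempty_interior_of_mem_tiles hX ht
    obtain ⟨j, v, hv, S, hS, h⟩ := (𝓕.level (n + 1)).exists_mem_block hX (-w +ᵥ x)
    have hxS : -(w - v) +ᵥ x = S := by
      rw [← vadd_left_cancel_iff (-v), ← h, ← add_vadd]
      congr 1
      abel
    set u := w - v with hu
    have htS : -u +ᵥ t ∈ S.1.tiles := by
      rw [← hxS]
      exact Hull.vadd_mem_vadd_tiles ht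
    have hvt : v ∈ interior (-u +ᵥ t) := by
      rw [interior_vadd, mem_vadd_set_iff_neg_vadd_mem]
      simpa [hu] using hw
    -- the tile cannot cross the boundary of the block
    have hsub : interior (-u +ᵥ t) ⊆ (𝓕.level (n + 1)).block j := by
      have hfr : ∀ z ∈ interior (-u +ᵥ t), z ∉ frontier ((𝓕.level (n + 1)).block j) :=
        fun z hz hzf => 𝓕.notMem_interior_of_mem_frontier hX (n + 1) j hS hzf htS hz
      have hcl := ((𝓕.level (n + 1)).isBlock j).isCompact.isClosed
      have hconn : IsPreconnected (interior (-u +ᵥ t)) :=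
        (Tiling.isRectangle_of_mem_tiles hrect htS).convex.interior.isPreconnected
      have hint : ∀ z ∈ interior (-u +ᵥ t), z ∈ (𝓕.level (n + 1)).block j →
          z ∈ interior ((𝓕.level (n + 1)).block j) := by
        intro z hz hzb
        by_contra hzi
        exact hfr z hz ⟨subset_closure hzb, hzi⟩
      refine (hconn.subset_left_of_subset_union isOpen_interior hcl.isOpen_compl
        (disjoint_compl_right.mono_left interior_subset) (fun z hz => ?_)
        ⟨v, hvt, hint v hvt hv⟩).trans interior_subset
      by_cases hzb : z ∈ (𝓕.level (n + 1)).block j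
      · exact Or.inl (hint z hz hzb)
      · exact Or.inr hzb
    have hsub' : -u +ᵥ t ⊆ (𝓕.level (n + 1)).block j := by
      rw [← Tiling.closure_interior_of_mem_tiles hX htS]
      exact closure_minimal hsub ((𝓕.level (n + 1)).isBlock j).isCompact.isClosed
    have hRS : (𝓕.level n).Occurs S R (-u + u₀) := hxS ▸ hR.vadd (-u)
    have htile : (-u + u₀) +ᵥ R.tile = -u +ᵥ t := add_vadd _ _ _
    refine ⟨⟨j, -u +ᵥ t, hsub', fun S' hS' => ?_⟩, u, ?_, vadd_neg_vadd _ _⟩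
    · rw [← htile]
      exact (𝓕.occurs_of_mem_vert hS hS' hRS (interior_maximal hsub isOpen_interior hvt)
        (by rwa [htile])).mem_tiles
    · unfold BoxDecomposition.Occurs
      rwa [hxS]

/-- `f_n` maps the region `R'` of `B_{n+1}` onto the region `R` of `B_n`. -/
def IsParent {n : ℕ} (R' : 𝓕.Region (n + 1)) (R : 𝓕.Region n) : Prop :=
  ∃ u : Euc d, u +ᵥ R.tile = R'.tile ∧
    ∀ S ∈ (𝓕.level (n + 1)).vert R'.idx, (𝓕.level n).Occurs S R u

theorem isParent_of_occurs_vert (hX : IsPrototileSet X) {n : ℕ} {R' : 𝓕.Region (n + 1)}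
    {R : 𝓕.Region n} {S : Hull T} (hS : S ∈ (𝓕.level (n + 1)).vert R'.idx) {u : Euc d}
    (hR : (𝓕.level n).Occurs S R u) (htile : u +ᵥ R.tile = R'.tile) : 𝓕.IsParent R' R := by
  obtain ⟨v, hv⟩ := R'.nonempty_interior_tile hX
  exact ⟨u, htile, fun S' hS' => 𝓕.occurs_of_mem_vert hS hS' hR
    (interior_mono R'.tile_subset hv) (by rwa [htile])⟩

theorem exists_isParent (hX : IsPrototileSet X) (hrect : ∀ p ∈ X, IsRectangle p) {n : ℕ}
    (R' : 𝓕.Region (n + 1)) : ∃ R, 𝓕.IsParent R' R := by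
  obtain ⟨S, hS⟩ := R'.exists_vert
  obtain ⟨R, u, hR, htile⟩ := 𝓕.exists_occurs hX hrect n S (R'.tile_mem S hS)
  exact ⟨R, 𝓕.isParent_of_occurs_vert hX hS hR htile⟩

variable {𝓕} in
theorem IsParent.unique (hX : IsPrototileSet X) {n : ℕ} {R' : 𝓕.Region (n + 1)}
    {R₁ R₂ : 𝓕.Region n} (h₁ : 𝓕.IsParent R' R₁) (h₂ : 𝓕.IsParent R' R₂) : R₁ = R₂ := by
  obtain ⟨S, hS⟩ := R'.exists_vert
  obtain ⟨u₁, ht₁, hu₁⟩ := h₁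
  obtain ⟨u₂, ht₂, hu₂⟩ := h₂
  exact ((hu₁ S hS).unique hX (hu₂ S hS) (ht₁.trans ht₂.symm)).1

variable {𝓕} in
theorem IsParent.exists_occurs {n : ℕ} {R' : 𝓕.Region (n + 1)} {R : 𝓕.Region n}
    (h : 𝓕.IsParent R' R) {x : Hull T} {u' : Euc d} (hx : (𝓕.level (n + 1)).Occurs x R' u') :
    ∃ u, (𝓕.level n).Occurs x R u ∧ u +ᵥ R.tile = u' +ᵥ R'.tile := by
  obtain ⟨u, htile, hu⟩ := h
  refine ⟨u' + u, ?_, by rw [add_vadd, htile]⟩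
  have := (hu _ hx).vadd u'
  rwa [vadd_neg_vadd] at this

/-- If two regions of consecutive levels are represented by one tile, then the finer one is
mapped onto the coarser one. -/
theorem isParent_of_occurs (hX : IsPrototileSet X) {n : ℕ} {R' : 𝓕.Region (n + 1)}
    {R : 𝓕.Region n} {x : Hull T} {u u' : Euc d} (hR : (𝓕.level n).Occurs x R u)
    (hR' : (𝓕.level (n + 1)).Occurs x R' u') (h : u +ᵥ R.tile = u' +ᵥ R'.tile) :
    𝓕.IsParent R' R := by
  refine 𝓕.isParent_of_occurs_vert hX hR' (hR.vadd (-u')) ?_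
  rw [add_vadd, h, neg_vadd_vadd]

theorem exists_isParent_iff (hX : IsPrototileSet X) (hrect : ∀ p ∈ X, IsRectangle p) {n : ℕ}
    {R : 𝓕.Region n} {x : Hull T} :
    x ∈ (𝓕.level n).tower R ↔ ∃ R', 𝓕.IsParent R' R ∧ x ∈ (𝓕.level (n + 1)).tower R' := by
  simp only [BoxDecomposition.mem_tower_iff]
  constructor
  · rintro ⟨u, hu, h0⟩
    obtain ⟨R', u', hu', htile⟩ := 𝓕.exists_occurs hX hrect (n + 1) x hu.mem_tiles
    exact ⟨R', 𝓕.isParent_of_occurs hX hu hu' htile.symm, u', hu', by rwa [htile]⟩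
  · rintro ⟨R', hR', u', hu', h0⟩
    obtain ⟨u, hu, htile⟩ := hR'.exists_occurs hu'
    exact ⟨u, hu, by rwa [htile]⟩

end EFS

/-- The open cells of distinct regions are disjoint. -/
theorem BoxDecomposition.eq_of_mem_tower (hX : IsPrototileSet X) {𝓑 : BoxDecomposition T}
    {x : Hull T} {R R' : 𝓑.Region} (h : x ∈ 𝓑.tower R) (h' : x ∈ 𝓑.tower R') : R = R' := by
  rw [mem_tower_iff] at h h'
  obtain ⟨u, hu, h0⟩ := h
  obtain ⟨u', hu', h0'⟩ := h'
  exact (hu.unique hX hu' (Tiling.eq_of_mem_interior hX hu.mem_tiles hu'.mem_tiles h0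
    (interior_subset h0'))).1

namespace EFS

variable (𝓕 : EFS T)

theorem image_f_cell {n : ℕ} {R' : 𝓕.Region (n + 1)} {R : 𝓕.Region n}
    (h : 𝓕.IsParent R' R) :
    𝓕.f n '' (𝓕.level (n + 1)).cell R' = (𝓕.level n).cell R := by
  obtain ⟨u, htile, hu⟩ := h
  -- the representative chosen by `f` lies on the same vertical
  have key : ∀ v ∈ interior R'.tile, ∀ S ∈ (𝓕.level (n + 1)).vert R'.idx, ∀ S₀,
      S₀ ∈ (𝓕.level n).vert R.idx →
      𝓕.f n ((𝓕.level (n + 1)).proj (-v +ᵥ S)) = (𝓕.level n).proj (-(v - u) +ᵥ S₀) := by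
    intro v hv S hS S₀ hS₀
    have h1 : (𝓕.level (n + 1)).proj (Quot.out ((𝓕.level (n + 1)).proj (-v +ᵥ S))) =
        (𝓕.level (n + 1)).proj (-v +ᵥ S) := Quot.out_eq _
    obtain ⟨S', hS', he⟩ :=
      ((𝓕.level (n + 1)).proj_eq_iff (interior_mono R'.tile_subset hv) hS).1 h1
    unfold f
    rw [he]
    have h2 : -v +ᵥ S' = -(v - u) +ᵥ (-u +ᵥ S') := by
      rw [← add_vadd]
      congr 1
      abel
    rw [h2]
    refine (𝓕.level n).proj_eq_of_mem_vert (R.tile_subset ?_) (hu S' hS') hS₀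
    have := interior_subset hv
    rwa [← htile, mem_vadd_set_iff_neg_vadd_mem, vadd_eq_add, neg_add_eq_sub] at this
  have hint : ∀ v, v ∈ interior R'.tile ↔ v - u ∈ interior R.tile := by
    intro v
    rw [← htile, interior_vadd, mem_vadd_set_iff_neg_vadd_mem, vadd_eq_add, neg_add_eq_sub]
  ext p
  constructor
  · rintro ⟨_, ⟨_, ⟨v, hv, S, hS, rfl⟩, rfl⟩, rfl⟩
    rw [key v hv S hS _ (hu S hS)]
    exact ⟨_, ⟨v - u, (hint v).1 hv, _, hu S hS, rfl⟩, rfl⟩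
  · rintro ⟨_, ⟨v, hv, S₀, hS₀, rfl⟩, rfl⟩
    obtain ⟨S, hS⟩ := R'.exists_vert
    have hv' : v + u ∈ interior R'.tile := by rwa [hint, add_sub_cancel_right]
    refine ⟨_, ⟨_, ⟨v + u, hv', S, hS, rfl⟩, rfl⟩, ?_⟩
    rw [key _ hv' S hS S₀ hS₀, add_sub_cancel_right]

theorem image_f_cell_eq_iff (hX : IsPrototileSet X) (hrect : ∀ p ∈ X, IsRectangle p) {n : ℕ}
    {R' : 𝓕.Region (n + 1)} {R : 𝓕.Region n} :
    𝓕.f n '' (𝓕.level (n + 1)).cell R' = (𝓕.level n).cell R ↔ 𝓕.IsParent R' R := by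
  refine ⟨fun h => ?_, 𝓕.image_f_cell⟩
  obtain ⟨R₁, hR₁⟩ := 𝓕.exists_isParent hX hrect R'
  rw [𝓕.image_f_cell hR₁] at h
  have h' := congrArg (fun s => (𝓕.level n).proj ⁻¹' s) h
  simp only [BoxDecomposition.preimage_cell] at h'
  obtain ⟨x, hx⟩ := (𝓕.level n).nonempty_tower hX R₁
  have he : R₁ = R := BoxDecomposition.eq_of_mem_tower hX hx (by rwa [← h'])
  rwa [← he]

theorem push_apply (hX : IsPrototileSet X) (hrect : ∀ p ∈ X, IsRectangle p) {n : ℕ}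
    (w : 𝓕.Region (n + 1) → ℝ) (R : 𝓕.Region n) :
    𝓕.push n w R = ∑ᶠ R' ∈ {R' | 𝓕.IsParent R' R}, w R' := by
  simp only [push, 𝓕.image_f_cell_eq_iff hX hrect]

/-! ### Flattening: the points of `B_{n+1}` determine the stars of `B_n` -/

theorem occurs_of_proj_eq {n : ℕ} {x y : Hull T}
    (h : (𝓕.level (n + 1)).proj x = (𝓕.level (n + 1)).proj y) {R : 𝓕.Region n} {u : Euc d}
    (hR : (𝓕.level n).Occurs x R u) (h0 : (0 : Euc d) ∈ u +ᵥ R.tile) :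
    (𝓕.level n).Occurs y R u := by
  refine (𝓕.level (n + 1)).of_proj_eq h (p := fun x => (𝓕.level n).Occurs x R u) ?_ hR
  rintro x y ⟨j, v, hv, S, hS, S', hS', rfl, rfl⟩ hx
  have := 𝓕.forcesBorder n j S hS S' hS' R.idx (u + v)
  unfold BoxDecomposition.Occurs at hx ⊢
  rw [← add_vadd, ← neg_add_rev, add_comm v u] at hx ⊢
  refine this hx ⟨v, ?_, hv⟩
  rw [mem_vadd_set_iff_neg_vadd_mem]
  rw [mem_vadd_set_iff_neg_vadd_mem] at h0
  convert R.tile_subset h0 using 1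
  simp only [vadd_eq_add]
  abel

theorem mem_tiles_of_proj_eq (hX : IsPrototileSet X) (hrect : ∀ p ∈ X, IsRectangle p) {n : ℕ}
    {x y : Hull T} (h : (𝓕.level (n + 1)).proj x = (𝓕.level (n + 1)).proj y) {t : Set (Euc d)}
    (ht : t ∈ x.1.tiles) (h0 : (0 : Euc d) ∈ t) : t ∈ y.1.tiles := by
  obtain ⟨R, u, hR, rfl⟩ := 𝓕.exists_occurs hX hrect n x ht
  exact (𝓕.occurs_of_proj_eq h hR h0).mem_tiles

end EFS

/-- Two tilings in which the tile at the origin represents the same region at the same place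
have the same projection. -/
theorem BoxDecomposition.Occurs.proj_eq {𝓑 : BoxDecomposition T} {x y : Hull T} {R : 𝓑.Region}
    {u : Euc d} (hx : 𝓑.Occurs x R u) (hy : 𝓑.Occurs y R u) (h0 : (0 : Euc d) ∈ u +ᵥ R.tile) :
    𝓑.proj x = 𝓑.proj y := by
  rw [mem_vadd_set_iff_neg_vadd_mem, vadd_eq_add, add_zero] at h0
  have := 𝓑.proj_eq_of_mem_vert (R.tile_subset h0) hx hy
  rwa [neg_neg, vadd_neg_vadd, vadd_neg_vadd] at this

namespace EFS

variable (𝓕 : EFS T)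

theorem proj_eq_of_proj_succ_eq (hX : IsPrototileSet X) (hrect : ∀ p ∈ X, IsRectangle p) {n : ℕ}
    {x y : Hull T} (h : (𝓕.level (n + 1)).proj x = (𝓕.level (n + 1)).proj y) :
    (𝓕.level n).proj x = (𝓕.level n).proj y := by
  obtain ⟨t, ht, h0⟩ := x.1.exists_mem_tile 0
  obtain ⟨R, u, hR, rfl⟩ := 𝓕.exists_occurs hX hrect n x ht
  exact hR.proj_eq (𝓕.occurs_of_proj_eq h hR h0) h0

/-- Two tilings in which a certain tile represents the same regions at all levels are equal: as
borders are forced, the adjacent tiles again represent the same regions at all levels. -/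
theorem eq_of_forall_occurs (hX : IsPrototileSet X) (hrect : ∀ p ∈ X, IsRectangle p)
    {x y : Hull T} {t : Set (Euc d)} (ht : t ∈ x.1.tiles)
    (h : ∀ n, ∃ (R : 𝓕.Region n) (u : Euc d),
      (𝓕.level n).Occurs x R u ∧ (𝓕.level n).Occurs y R u ∧ u +ᵥ R.tile = t) : x = y := by
  set 𝒜 : Set (Set (Euc d)) := {t | t ∈ x.1.tiles ∧ ∀ n, ∃ (R : 𝓕.Region n) (u : Euc d),
      (𝓕.level n).Occurs x R u ∧ (𝓕.level n).Occurs y R u ∧ u +ᵥ R.tile = t} with h𝒜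
  have hspread : ∀ t ∈ 𝒜, ∀ s ∈ x.1.tiles, (s ∩ t).Nonempty → s ∈ 𝒜 := by
    rintro t ⟨-, ht⟩ s hs ⟨q, hqs, hqt⟩
    refine ⟨hs, fun n => ?_⟩
    obtain ⟨R', u', hx', hy', rfl⟩ := ht (n + 1)
    obtain ⟨R, u, hx, rfl⟩ := 𝓕.exists_occurs hX hrect n x hs
    refine ⟨R, u, hx, ?_, rfl⟩
    have := 𝓕.forcesBorder n R'.idx _ hx' _ hy' R.idx (u - u')
    have he : ∀ z : Hull T, -(u - u') +ᵥ (-u' +ᵥ z) = -u +ᵥ z := by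
      intro z
      rw [← add_vadd]
      congr 1
      abel
    rw [he, he] at this
    refine this hx ⟨q - u', ?_, ?_⟩
    · rw [mem_vadd_set_iff_neg_vadd_mem] at hqs ⊢
      convert R.tile_subset hqs using 1
      simp only [vadd_eq_add]
      abel
    · rw [mem_vadd_set_iff_neg_vadd_mem, vadd_eq_add, neg_add_eq_sub] at hqt
      exact R'.tile_subset hqt
  have hcover : ⋃₀ 𝒜 = univ := by
    have hA : IsClosed (⋃₀ 𝒜) := Tiling.isClosed_sUnion hX x.1 fun t ht => ht.1
    have hB : IsClosed (⋃₀ (x.1.tiles \ 𝒜)) := Tiling.isClosed_sUnion hX x.1 sdiff_subset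
    have hc : (⋃₀ 𝒜)ᶜ = ⋃₀ (x.1.tiles \ 𝒜) := by
      ext q
      constructor
      · intro hq
        obtain ⟨s, hs, hqs⟩ := x.1.exists_mem_tile q
        exact ⟨s, ⟨hs, fun hsA => hq ⟨s, hsA, hqs⟩⟩, hqs⟩
      · rintro ⟨s, ⟨hs, hsA⟩, hqs⟩ ⟨t, htA, hqt⟩
        exact hsA (hspread t htA s hs ⟨q, hqs, hqt⟩)
    have hclopen : IsClopen (⋃₀ 𝒜) := ⟨hA, isClosed_compl_iff.1 (hc ▸ hB)⟩
    obtain ⟨q, hq⟩ := Tiling.nonempty_of_mem_tiles hX ht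
    exact hclopen.eq_univ ⟨q, t, ⟨ht, h⟩, hq⟩
  refine Subtype.ext (Tiling.eq_of_tiles_subset hX fun s hs => ?_)
  obtain ⟨w, hw⟩ := Tiling.nonempty_interior_of_mem_tiles hX hs
  have hwA : w ∈ ⋃₀ 𝒜 := hcover ▸ mem_univ w
  obtain ⟨t, ⟨ht, htA⟩, hwt⟩ := hwA
  obtain ⟨R, u, -, hy, rfl⟩ := htA 0
  rw [Tiling.eq_of_mem_interior hX hs ht hw hwt]
  exact hy.mem_tiles

end EFS

end

section

/-! ### Measures on inverse limits of finite sets -/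

section Refining

variable {Y : Type*} {ι : ℕ → Type*}

/-- A union of fibres of a map. -/
def IsSaturated {κ : Type*} (g : Y → κ) (A : Set Y) : Prop := ∀ x y, g x = g y → x ∈ A → y ∈ A

namespace IsSaturated

variable {κ : Type*} {g : Y → κ} {A B : Set Y}

theorem union (hA : IsSaturated g A) (hB : IsSaturated g B) : IsSaturated g (A ∪ B) :=
  fun x y h hx => hx.imp (hA x y h) (hB x y h)

theorem sdiff (hA : IsSaturated g A) (hB : IsSaturated g B) : IsSaturated g (A \ B) :=
  fun x y h hx => ⟨hA x y h hx.1, fun hy => hx.2 (hB y x h.symm hy)⟩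

theorem compl (hA : IsSaturated g A) : IsSaturated g Aᶜ :=
  fun x y h hx hy => hx (hA y x h.symm hy)

theorem inter (hA : IsSaturated g A) (hB : IsSaturated g B) : IsSaturated g (A ∩ B) :=
  fun x y h hx => ⟨hA x y h hx.1, hB x y h hx.2⟩

theorem disjoint_image (hA : IsSaturated g A) (hAB : Disjoint A B) :
    Disjoint (g '' A) (g '' B) := by
  rw [Set.disjoint_left]
  rintro _ ⟨x, hx, rfl⟩ ⟨y, hy, h⟩
  exact hAB.le_bot ⟨hA x y h.symm hx, hy⟩

end IsSaturated

variable [TopologicalSpace Y]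

/-- A sequence of maps whose fibres are successively finer partitions of a space into open sets,
and which together separate points. On a compact space it amounts to a presentation as an inverse
limit of finite sets. -/
structure IsRefining (ρ : ∀ n, Y → ι n) : Prop where
  isOpen_fiber : ∀ n x, IsOpen {y | ρ n y = ρ n x}
  refines : ∀ n x y, ρ (n + 1) x = ρ (n + 1) y → ρ n x = ρ n y
  separates : ∀ x y, (∀ n, ρ n x = ρ n y) → x = y

namespace IsRefining

variable {ρ : ∀ n, Y → ι n}

theorem refines_le (h : IsRefining ρ) {m n : ℕ} (hmn : m ≤ n) {x y : Y} (hxy : ρ n x = ρ n y) :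
    ρ m x = ρ m y := by
  induction n, hmn using Nat.le_induction with
  | base => exact hxy
  | succ n _ ih => exact ih (h.refines n x y hxy)

theorem isSaturated_le (h : IsRefining ρ) {m n : ℕ} (hmn : m ≤ n) {A : Set Y}
    (hA : IsSaturated (ρ m) A) : IsSaturated (ρ n) A :=
  fun x y hxy hx => hA x y (h.refines_le hmn hxy) hx

theorem isOpen_of_isSaturated (h : IsRefining ρ) {n : ℕ} {A : Set Y}
    (hA : IsSaturated (ρ n) A) : IsOpen A := by
  rw [isOpen_iff_mem_nhds]
  intro x hx
  exact mem_of_superset ((h.isOpen_fiber n x).mem_nhds rfl) fun y hy => hA x y (Eq.symm hy) hx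

theorem isClosed_of_isSaturated (h : IsRefining ρ) {n : ℕ} {A : Set Y}
    (hA : IsSaturated (ρ n) A) : IsClosed A :=
  isOpen_compl_iff.1 (h.isOpen_of_isSaturated hA.compl)

theorem finite_range [CompactSpace Y] (h : IsRefining ρ) (n : ℕ) : (range (ρ n)).Finite := by
  obtain ⟨t, ht⟩ := CompactSpace.elim_nhds_subcover (fun x => {y | ρ n y = ρ n x})
    fun x => (h.isOpen_fiber n x).mem_nhds rfl
  refine (t.finite_toSet.image (ρ n)).subset ?_
  rintro _ ⟨y, rfl⟩
  have hy : y ∈ ⋃ x ∈ t, {y | ρ n y = ρ n x} := ht ▸ mem_univ y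
  obtain ⟨x, hx, hxy⟩ := mem_iUnion₂.1 hy
  exact ⟨x, hx, Eq.symm hxy⟩

/-- A closed set is the intersection of its saturations. -/
theorem iInter_saturation [CompactSpace Y] (h : IsRefining ρ) {A : Set Y} (hA : IsClosed A) :
    ⋂ n, {y | ∃ x ∈ A, ρ n x = ρ n y} = A := by
  refine Subset.antisymm (fun y hy => ?_) fun y hy => mem_iInter.2 fun n => ⟨y, hy, rfl⟩
  rw [mem_iInter] at hy
  have hcl : ∀ n, IsClosed (A ∩ {x | ρ n x = ρ n y}) := fun n =>
    hA.inter (h.isClosed_of_isSaturated (n := n) fun x z hxz hx => hxz.symm.trans hx)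
  obtain ⟨x, hx⟩ := IsCompact.nonempty_iInter_of_sequence_nonempty_isCompact_isClosed
    (fun n => A ∩ {x | ρ n x = ρ n y})
    (fun n x hx => ⟨hx.1, h.refines n x y hx.2⟩)
    (fun n => hy n) (hcl 0).isCompact hcl
  rw [mem_iInter] at hx
  rw [← h.separates x y fun n => (hx n).2]
  exact (hx 0).1

variable [MeasurableSpace Y] [BorelSpace Y]

theorem borel_eq_generateFrom [CompactSpace Y] (h : IsRefining ρ) :
    ‹MeasurableSpace Y› = MeasurableSpace.generateFrom {A | ∃ n, IsSaturated (ρ n) A} := by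
  refine le_antisymm ?_ ?_
  · rw [BorelSpace.measurable_eq (α := Y), borel_eq_generateFrom_isClosed]
    refine MeasurableSpace.generateFrom_le fun A hA => ?_
    rw [← h.iInter_saturation hA]
    refine @MeasurableSet.iInter _ _ (MeasurableSpace.generateFrom _) _ _ fun n => ?_
    refine MeasurableSpace.measurableSet_generateFrom ⟨n, ?_⟩
    rintro x y hxy ⟨z, hz, hzx⟩
    exact ⟨z, hz, hzx.trans hxy⟩
  · refine MeasurableSpace.generateFrom_le ?_
    rintro A ⟨n, hA⟩
    exact (h.isOpen_of_isSaturated hA).measurableSet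

theorem measurableSet_of_isSaturated (h : IsRefining ρ) {n : ℕ} {A : Set Y}
    (hA : IsSaturated (ρ n) A) : MeasurableSet A :=
  (h.isOpen_of_isSaturated hA).measurableSet

/-- A finite measure is determined by its values on the fibres. -/
theorem ext_measure [CompactSpace Y] (h : IsRefining ρ) {μ ν : Measure Y} [IsFiniteMeasure μ]
    (hμν : ∀ n x, μ {y | ρ n y = ρ n x} = ν {y | ρ n y = ρ n x}) : μ = ν := by
  have key : ∀ n, ∀ A, IsSaturated (ρ n) A → μ A = ν A := by
    intro n A hA
    have hfin : (ρ n '' A).Finite := (h.finite_range n).subset (image_subset_range _ _)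
    have hU : A = ⋃ r ∈ ρ n '' A, ρ n ⁻¹' {r} := by
      ext x
      simp only [mem_iUnion, mem_preimage, mem_singleton_iff, exists_prop, exists_eq_right']
      refine ⟨fun hx => mem_image_of_mem _ hx, ?_⟩
      rintro ⟨y, hy, hyx⟩
      exact hA y x hyx hy
    have hdisj : (ρ n '' A).PairwiseDisjoint fun r => ρ n ⁻¹' {r} := fun r _ s _ hrs =>
      Disjoint.preimage _ (disjoint_singleton.2 hrs)
    have hmeas : ∀ r ∈ ρ n '' A, MeasurableSet (ρ n ⁻¹' {r}) := fun r _ =>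
      h.measurableSet_of_isSaturated (n := n) fun x y hxy hx => hxy.symm.trans hx
    rw [hU, measure_biUnion hfin.countable hdisj hmeas, measure_biUnion hfin.countable hdisj hmeas]
    refine tsum_congr ?_
    rintro ⟨_, x, -, rfl⟩
    exact hμν n x
  refine ext_of_generate_finite _ h.borel_eq_generateFrom ?_ ?_ (key 0 univ fun _ _ _ _ => trivial)
  · rintro A ⟨m, hA⟩ B ⟨n, hB⟩ -
    exact ⟨max m n, (h.isSaturated_le (le_max_left m n) hA).inter
      (h.isSaturated_le (le_max_right m n) hB)⟩
  · rintro A ⟨n, hA⟩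
    exact key n A hA

/-- A compatible system of weights on the fibres comes from a finite measure. The weights define
an additive content on the sets that are open and compact, so that Carathéodory's theorem
applies. -/
theorem exists_measure [CompactSpace Y] (h : IsRefining ρ) (b : ∀ n, ι n → ℝ≥0)
    (hb : ∀ n x, b n (ρ n x) = ∑ᶠ r ∈ ρ (n + 1) '' {y | ρ n y = ρ n x}, b (n + 1) r) :
    ∃ ν : Measure Y, IsFiniteMeasure ν ∧ ∀ n x, ν {y | ρ n y = ρ n x} = b n (ρ n x) := by
  classical
  set c : ℕ → Set Y → ℝ≥0 := fun n A => ∑ᶠ r ∈ ρ n '' A, b n r with hc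
  have hfin : ∀ n A, (ρ n '' A).Finite := fun n A =>
    (h.finite_range n).subset (image_subset_range _ _)
  have hc_succ : ∀ n A, IsSaturated (ρ n) A → c n A = c (n + 1) A := by
    intro n A hA
    have hU : ρ (n + 1) '' A = ⋃ r ∈ ρ n '' A, ρ (n + 1) '' (ρ n ⁻¹' {r}) := by
      ext r'
      simp only [mem_iUnion, exists_prop]
      constructor
      · rintro ⟨x, hx, rfl⟩
        exact ⟨ρ n x, mem_image_of_mem _ hx, x, rfl, rfl⟩
      · rintro ⟨_, ⟨x, hx, rfl⟩, y, hy, rfl⟩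
        exact ⟨y, hA x y (Eq.symm hy) hx, rfl⟩
    have hdisj : (ρ n '' A).PairwiseDisjoint fun r => ρ (n + 1) '' (ρ n ⁻¹' {r}) := by
      intro r _ s _ hrs
      rw [Function.onFun, Set.disjoint_left]
      rintro _ ⟨x, hx, rfl⟩ ⟨y, hy, hxy⟩
      exact hrs (Eq.symm (hy.symm.trans ((h.refines n y x hxy).trans hx)))
    simp only [hc]
    rw [hU, finsum_mem_biUnion hdisj (hfin n A) fun r _ => hfin (n + 1) _]
    refine finsum_mem_congr rfl ?_
    rintro _ ⟨x, -, rfl⟩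
    exact hb n x
  have hc_le : ∀ {m n : ℕ}, m ≤ n → ∀ A, IsSaturated (ρ m) A → c m A = c n A := by
    intro m n hmn A hA
    induction n, hmn using Nat.le_induction with
    | base => rfl
    | succ n hmn ih => rw [ih, hc_succ n A (h.isSaturated_le hmn hA)]
  set C : Set (Set Y) := {A | ∃ n, IsSaturated (ρ n) A} with hC
  set m : Set Y → ENNReal := fun A => if hA : ∃ n, IsSaturated (ρ n) A then c (Nat.find hA) A else 0
    with hm
  have hm_eq : ∀ n A, IsSaturated (ρ n) A → m A = c n A := by
    intro n A hA
    have hex : ∃ n, IsSaturated (ρ n) A := ⟨n, hA⟩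
    simp only [hm]
    rw [dif_pos hex, hc_le (Nat.find_min' hex hA) A (Nat.find_spec hex)]
  have hring : IsSetRing C :=
    { empty_mem := ⟨0, fun _ _ _ hx => hx⟩
      union_mem := by
        rintro A B ⟨k, hA⟩ ⟨n, hB⟩
        exact ⟨max k n, (h.isSaturated_le (le_max_left k n) hA).union
          (h.isSaturated_le (le_max_right k n) hB)⟩
      sdiff_mem := by
        rintro A B ⟨k, hA⟩ ⟨n, hB⟩
        exact ⟨max k n, (h.isSaturated_le (le_max_left k n) hA).sdiff
          (h.isSaturated_le (le_max_right k n) hB)⟩ }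
  have hm_empty : m ∅ = 0 := by
    rw [hm_eq 0 ∅ fun _ _ _ hx => hx]
    simp [hc]
  set M : AddContent ENNReal C := hring.addContent_of_union m hm_empty (by
    rintro A B ⟨k, hA⟩ ⟨n, hB⟩ hAB
    have hA' := h.isSaturated_le (le_max_left k n) hA
    have hB' := h.isSaturated_le (le_max_right k n) hB
    rw [hm_eq _ _ (hA'.union hB'), hm_eq _ _ hA', hm_eq _ _ hB', ← ENNReal.coe_add]
    simp only [hc]
    rw [image_union, finsum_mem_union (hA'.disjoint_image hAB) (hfin _ _) (hfin _ _)]) with hM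
  have hM_apply : ∀ A, M A = m A := fun A => rfl
  have hM_top : ∀ A ∈ C, M A ≠ ⊤ := by
    rintro A ⟨n, hA⟩
    rw [hM_apply, hm_eq n A hA]
    exact ENNReal.coe_ne_top
  have hsub : M.IsSigmaSubadditive := by
    refine isSigmaSubadditive_of_addContent_iUnion_eq_tsum hring fun f hf hUf hd =>
      addContent_iUnion_eq_sum_of_tendsto_zero hring M hM_top ?_ hf hUf hd
    intro s hs hanti hempty
    have hcl : ∀ n, IsClosed (s n) := fun n =>
      have ⟨_, hk⟩ := hs n
      h.isClosed_of_isSaturated hk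
    -- a decreasing sequence of compact sets with empty intersection is finally empty
    obtain ⟨N, hN⟩ : ∃ N, s N = ∅ := by
      by_contra hne
      push Not at hne
      have := IsCompact.nonempty_iInter_of_sequence_nonempty_isCompact_isClosed s
        (fun n => hanti n.le_succ) (fun n => hne n)
        (hcl 0).isCompact hcl
      rw [hempty] at this
      exact this.ne_empty rfl
    refine tendsto_const_nhds.congr' ?_
    filter_upwards [eventually_ge_atTop N] with n hn
    have : s n = ∅ := subset_empty_iff.1 (hN ▸ hanti hn)
    rw [this, hM_apply, hm_empty]
  have hval : ∀ n A, IsSaturated (ρ n) A →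
      M.measure hring.isSetSemiring h.borel_eq_generateFrom.le hsub A = c n A := by
    intro n A hA
    rw [AddContent.measure_eq M hring.isSetSemiring h.borel_eq_generateFrom hsub ⟨n, hA⟩,
      hM_apply, hm_eq n A hA]
  refine ⟨M.measure hring.isSetSemiring h.borel_eq_generateFrom.le hsub, ⟨?_⟩, fun n x => ?_⟩
  · rw [hval 0 univ fun _ _ _ _ => trivial]
    exact ENNReal.coe_lt_top
  · rw [hval n {y | ρ n y = ρ n x} fun y z hyz hy => hyz.symm.trans hy]
    have : ρ n '' {y | ρ n y = ρ n x} = {ρ n x} := by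
      ext r
      constructor
      · rintro ⟨y, hy, rfl⟩
        exact hy
      · rintro rfl
        exact ⟨x, rfl, rfl⟩
    simp only [hc]
    rw [this, finsum_mem_singleton]

end IsRefining

end Refining

/-! ### Local uniqueness of Lebesgue measure -/

/-- A finite measure which is invariant under those translations that keep a set within `U` is
proportional to Lebesgue measure on `U`: both sides are the measure of the set of pairs `(x, t)`
with `x ∈ V` and `x + t ∈ W`. -/
theorem measure_mul_volume_eq {d : ℕ} {m : Measure (Euc d)} [IsFiniteMeasure m] {U : Set (Euc d)}
    (hinv : ∀ (v : Euc d) (A : Set (Euc d)), MeasurableSet A → A ⊆ U → v +ᵥ A ⊆ U →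
      m (v +ᵥ A) = m A) {V W : Set (Euc d)} (hV : MeasurableSet V) (hW : MeasurableSet W)
    (hVU : V ⊆ U) (hWU : W ⊆ U) : m V * volume W = m W * volume V := by
  have hA : MeasurableSet {q : Euc d × Euc d | q.1 ∈ V ∧ q.2 + q.1 ∈ W} :=
    (measurable_fst hV).inter ((measurable_snd.add measurable_fst) hW)
  have hB : MeasurableSet {q : Euc d × Euc d | q.1 ∈ W ∧ -q.2 + q.1 ∈ V} :=
    (measurable_fst hW).inter ((measurable_snd.neg.add measurable_fst) hV)
  have h1 : (m.prod volume) {q : Euc d × Euc d | q.1 ∈ V ∧ q.2 + q.1 ∈ W} =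
      m V * volume W := by
    rw [Measure.prod_apply hA]
    have : ∀ x, volume (Prod.mk x ⁻¹' {q : Euc d × Euc d | q.1 ∈ V ∧ q.2 + q.1 ∈ W}) =
        V.indicator (fun _ => volume W) x := by
      intro x
      by_cases hx : x ∈ V
      · rw [indicator_of_mem hx]
        simp only [preimage_ofPred_eq, hx, true_and]
        exact measure_preimage_add_right volume x W
      · simp [hx]
    rw [lintegral_congr this, lintegral_indicator_const hV, mul_comm]
  have h2 : (m.prod volume) {q : Euc d × Euc d | q.1 ∈ W ∧ -q.2 + q.1 ∈ V} =
      m W * volume V := by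
    rw [Measure.prod_apply hB]
    have : ∀ x, volume (Prod.mk x ⁻¹' {q : Euc d × Euc d | q.1 ∈ W ∧ -q.2 + q.1 ∈ V}) =
        W.indicator (fun _ => volume V) x := by
      intro x
      by_cases hx : x ∈ W
      · rw [indicator_of_mem hx]
        simp only [preimage_ofPred_eq, hx, true_and, neg_add_eq_sub]
        exact (Measure.measurePreserving_sub_left volume x).measure_preimage hV.nullMeasurableSet
      · simp [hx]
    rw [lintegral_congr this, lintegral_indicator_const hW, mul_comm]
  rw [← h1, ← h2, Measure.prod_apply_symm hA, Measure.prod_apply_symm hB]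
  refine lintegral_congr fun t => ?_
  have ht : (fun x => (x, t)) ⁻¹' {q : Euc d × Euc d | q.1 ∈ W ∧ -q.2 + q.1 ∈ V} =
      t +ᵥ (fun x => (x, t)) ⁻¹' {q : Euc d × Euc d | q.1 ∈ V ∧ q.2 + q.1 ∈ W} := by
    ext x
    rw [mem_vadd_set_iff_neg_vadd_mem]
    simp only [mem_preimage, mem_ofPred_eq, vadd_eq_add, add_neg_cancel_left]
    exact and_comm
  rw [ht, hinv t _ (measurable_prodMk_right hA) (fun x hx => hVU hx.1)]
  rw [← ht]
  exact fun x hx => hWU hx.1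

end

section

variable {d : ℕ} {X : Set (Set (Euc d))} {T : Tiling X}

/-! ### Transversals of tiles -/

/-- The tilings of the hull that contain the tile `p`. -/
def cylinder (T : Tiling X) (p : Set (Euc d)) : Set (Hull T) := {x | p ∈ x.1.tiles}

theorem vadd_mem_cylinder_iff {p : Set (Euc d)} {v : Euc d} {x : Hull T} :
    v +ᵥ x ∈ cylinder T (v +ᵥ p) ↔ x ∈ cylinder T p := by
  change v +ᵥ p ∈ (v +ᵥ x).1.tiles ↔ _
  rw [Hull.mem_vadd_tiles, neg_vadd_vadd]
  rfl

namespace EFS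

variable (𝓕 : EFS T)

theorem vert_zero (i : Fin (𝓕.level 0).card) :
    (𝓕.level 0).vert i = cylinder T ((𝓕.level 0).block i) := 𝓕.prototile_vert i

theorem tile_eq_block (hX : IsPrototileSet X) (R : 𝓕.Region 0) :
    R.tile = (𝓕.level 0).block R.idx := by
  obtain ⟨S, hS⟩ := R.exists_vert
  obtain ⟨v, hv⟩ := R.nonempty_interior_tile hX
  have hb : (𝓕.level 0).block R.idx ∈ S.1.tiles := by
    rw [𝓕.vert_zero] at hS
    exact hS
  exact Tiling.eq_of_mem_interior hX (R.tile_mem S hS) hb hv (R.tile_subset (interior_subset hv))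

theorem isCompact_cylinder (𝓕 : EFS T) (hX : IsPrototileSet X) (hrect : ∀ p ∈ X, IsRectangle p)
    (p : Set (Euc d)) : IsCompact (cylinder T p) := by
  rcases (cylinder T p).eq_empty_or_nonempty with h | ⟨x, hx⟩
  · rw [h]
    exact isCompact_empty
  · obtain ⟨R, u, -, rfl⟩ := 𝓕.exists_occurs hX hrect 0 x hx
    convert ((𝓕.level 0).vert_isCompact R.idx).image (Hull.continuous_vadd u) using 1
    rw [𝓕.vert_zero, ← 𝓕.tile_eq_block hX]
    ext y
    constructor
    · intro hy
      refine ⟨-u +ᵥ y, ?_, vadd_neg_vadd u y⟩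
      rwa [← vadd_mem_cylinder_iff (v := u), vadd_neg_vadd]
    · rintro ⟨y, hy, rfl⟩
      exact vadd_mem_cylinder_iff.2 hy

theorem measurableSet_cylinder (𝓕 : EFS T) (hX : IsPrototileSet X) (hrect : ∀ p ∈ X, IsRectangle p)
    (p : Set (Euc d)) : MeasurableSet (cylinder T p) :=
  have := Hull.t2Space hX T
  (𝓕.isCompact_cylinder hX hrect p).isClosed.measurableSet

end EFS

theorem BoxDecomposition.measurableSet_occurs (hX : IsPrototileSet X) (𝓑 : BoxDecomposition T)
    (R : 𝓑.Region) (u : Euc d) : MeasurableSet {x | 𝓑.Occurs x R u} :=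
  have := Hull.t2Space hX T
  ((𝓑.vert_isCompact R.idx).isClosed.preimage (Hull.continuous_vadd (-u))).measurableSet

namespace EFS

variable (𝓕 : EFS T)

/-- The region of `B_n` which is represented by the tile `p` of a tiling. -/
noncomputable def address (hX : IsPrototileSet X) (hrect : ∀ p ∈ X, IsRectangle p)
    (p : Set (Euc d)) (n : ℕ) (x : cylinder T p) : 𝓕.Region n :=
  (𝓕.exists_occurs hX hrect n x.1 x.2).choose

theorem exists_occurs_address (hX : IsPrototileSet X) (hrect : ∀ p ∈ X, IsRectangle p)
    (p : Set (Euc d)) (n : ℕ) (x : cylinder T p) :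
    ∃ u, (𝓕.level n).Occurs x.1 (𝓕.address hX hrect p n x) u ∧
      u +ᵥ (𝓕.address hX hrect p n x).tile = p :=
  (𝓕.exists_occurs hX hrect n x.1 x.2).choose_spec

theorem address_eq (hX : IsPrototileSet X) (hrect : ∀ p ∈ X, IsRectangle p)
    {p : Set (Euc d)} {n : ℕ} {x : cylinder T p} {R : 𝓕.Region n} {u : Euc d}
    (h : (𝓕.level n).Occurs x.1 R u) (hu : u +ᵥ R.tile = p) : 𝓕.address hX hrect p n x = R := by
  obtain ⟨u', h', hu'⟩ := 𝓕.exists_occurs_address hX hrect p n x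
  exact (h'.unique hX h (hu'.trans hu.symm)).1

theorem address_eq_iff (hX : IsPrototileSet X) (hrect : ∀ p ∈ X, IsRectangle p)
    {p : Set (Euc d)} {n : ℕ} {x : cylinder T p} {R : 𝓕.Region n} {u : Euc d}
    (hu : u +ᵥ R.tile = p) :
    𝓕.address hX hrect p n x = R ↔ (𝓕.level n).Occurs x.1 R u := by
  refine ⟨?_, fun h => 𝓕.address_eq hX hrect h hu⟩
  rintro rfl
  obtain ⟨u', h', hu'⟩ := 𝓕.exists_occurs_address hX hrect p n x
  obtain ⟨v, hv⟩ := (𝓕.address hX hrect p n x).nonempty_interior_tile hX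
  rwa [vadd_set_injective ((𝓕.address hX hrect p n x).isCompact_tile hX) ⟨v, interior_subset hv⟩
    (hu.trans hu'.symm)]

/-- The fibres of the address map are the translated verticals. -/
theorem image_fiber_address (hX : IsPrototileSet X) (hrect : ∀ p ∈ X, IsRectangle p)
    {p : Set (Euc d)} {n : ℕ} {R : 𝓕.Region n} {u : Euc d} (hu : u +ᵥ R.tile = p) :
    Subtype.val '' {x : cylinder T p | 𝓕.address hX hrect p n x = R} =
      {x | (𝓕.level n).Occurs x R u} := by
  ext x
  constructor
  · rintro ⟨x, hx, rfl⟩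
    exact (𝓕.address_eq_iff hX hrect hu).1 hx
  · intro hx
    exact ⟨⟨x, hu ▸ hx.mem_tiles⟩, (𝓕.address_eq_iff hX hrect hu).2 hx, rfl⟩

/-- The addresses of a tile at all levels present its transversal as an inverse limit of finite
sets. -/
theorem isRefining_address (hX : IsPrototileSet X) (hrect : ∀ p ∈ X, IsRectangle p)
    (p : Set (Euc d)) : IsRefining (𝓕.address hX hrect p) where
  isOpen_fiber n x := by
    obtain ⟨w, hw⟩ := Tiling.nonempty_interior_of_mem_tiles hX x.2
    have hset : {y : cylinder T p | 𝓕.address hX hrect p n y = 𝓕.address hX hrect p n x} =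
        (fun y : cylinder T p => -w +ᵥ y.1) ⁻¹'
          (𝓕.level n).tower (𝓕.address hX hrect p n x) := by
      set R := 𝓕.address hX hrect p n x
      have h0 : (0 : Euc d) ∈ interior (-w +ᵥ p) := by
        rw [interior_vadd, mem_vadd_set_iff_neg_vadd_mem]
        simpa using hw
      ext y
      rw [mem_preimage, BoxDecomposition.mem_tower_iff]
      constructor
      · rintro (hy : _ = R)
        obtain ⟨u, hu, htile⟩ := 𝓕.exists_occurs_address hX hrect p n y
        rw [hy] at hu htile
        refine ⟨-w + u, hu.vadd _, ?_⟩
        rwa [add_vadd, htile]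
      · rintro ⟨u, hu, hu0⟩
        have htile : u +ᵥ R.tile = -w +ᵥ p :=
          Tiling.eq_of_mem_interior hX hu.mem_tiles (Hull.vadd_mem_vadd_tiles y.2) hu0
            (interior_subset h0)
        refine 𝓕.address_eq hX hrect (u := w + u) ?_ ?_
        · have := hu.vadd w
          rwa [vadd_neg_vadd] at this
        · rw [add_vadd, htile, vadd_neg_vadd]
    rw [hset]
    exact ((𝓕.level n).isOpen_tower _).preimage
      ((Hull.continuous_vadd (-w)).comp continuous_subtype_val)
  refines n x y h := by
    obtain ⟨u, hu, htile⟩ := 𝓕.exists_occurs_address hX hrect p n x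
    obtain ⟨u', hu', htile'⟩ := 𝓕.exists_occurs_address hX hrect p (n + 1) x
    obtain ⟨v, hv, hvtile⟩ := 𝓕.exists_occurs_address hX hrect p n y
    obtain ⟨v', hv', hvtile'⟩ := 𝓕.exists_occurs_address hX hrect p (n + 1) y
    have h1 := 𝓕.isParent_of_occurs hX hu hu' (htile.trans htile'.symm)
    have h2 := 𝓕.isParent_of_occurs hX hv hv' (hvtile.trans hvtile'.symm)
    rw [← h] at h2
    exact h1.unique hX h2
  separates x y h := by
    refine Subtype.ext (𝓕.eq_of_forall_occurs hX hrect x.2 fun n => ?_)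
    obtain ⟨u, hu, htile⟩ := 𝓕.exists_occurs_address hX hrect p n x
    exact ⟨_, u, hu, (𝓕.address_eq_iff hX hrect htile).1 (h n).symm, htile⟩

end EFS

/-- A finite measure on a compact set is determined by its values on the fibres of a refining
sequence of maps. -/
theorem IsRefining.ext_measure_of_isCompact {H : Type*} [TopologicalSpace H] [T2Space H]
    [MeasurableSpace H] [BorelSpace H] {ι : ℕ → Type*} {K : Set H} (hK : IsCompact K)
    {ρ : ∀ n, K → ι n} (h : IsRefining ρ) {μ ν : Measure H} [IsFiniteMeasure μ]
    (hμ : μ Kᶜ = 0) (hν : ν Kᶜ = 0)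
    (hμν : ∀ n x, μ (Subtype.val '' {y | ρ n y = ρ n x}) = ν (Subtype.val '' {y | ρ n y = ρ n x})) :
    μ = ν := by
  have := isCompact_iff_compactSpace.1 hK
  have hemb : MeasurableEmbedding (Subtype.val : K → H) :=
    MeasurableEmbedding.subtype_coe hK.isClosed.measurableSet
  have hrestr : ∀ α : Measure H, α Kᶜ = 0 → α = (α.comap Subtype.val).map (Subtype.val : K → H) := by
    intro α hα
    rw [hemb.map_comap, Subtype.range_coe, Measure.restrict_eq_self_of_ae_mem]
    exact hα
  have : IsFiniteMeasure (μ.comap (Subtype.val : K → H)) := by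
    refine ⟨?_⟩
    rw [hemb.comap_apply]
    exact measure_lt_top _ _
  rw [hrestr μ hμ, hrestr ν hν]
  congr 1
  refine h.ext_measure fun n x => ?_
  rw [hemb.comap_apply, hemb.comap_apply]
  exact hμν n x

theorem EFS.ext_measure_cylinder (𝓕 : EFS T) (hX : IsPrototileSet X)
    (hrect : ∀ p ∈ X, IsRectangle p) {p : Set (Euc d)} {μ ν : Measure (Hull T)}
    [IsFiniteMeasure μ] (hμ : μ (cylinder T p)ᶜ = 0) (hν : ν (cylinder T p)ᶜ = 0)
    (h : ∀ n (R : 𝓕.Region n) u, u +ᵥ R.tile = p →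
      μ {x | (𝓕.level n).Occurs x R u} = ν {x | (𝓕.level n).Occurs x R u}) : μ = ν := by
  have := Hull.t2Space hX T
  refine (𝓕.isRefining_address hX hrect p).ext_measure_of_isCompact
    (𝓕.isCompact_cylinder hX hrect p) hμ hν fun n x => ?_
  obtain ⟨u, -, hu⟩ := 𝓕.exists_occurs_address hX hrect p n x
  rw [𝓕.image_fiber_address hX hrect hu]
  exact h n _ u hu

/-! ### Invariant measures in a box -/

/-- The set of all tilings `S - v`, where `v ∈ V` and `S ∈ D`. -/
def slab (V : Set (Euc d)) (D : Set (Hull T)) : Set (Hull T) :=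
  {x | ∃ v ∈ V, ∃ S ∈ D, x = -v +ᵥ S}

theorem slab_vadd_left (v : Euc d) (V : Set (Euc d)) (D : Set (Hull T)) :
    slab (v +ᵥ V) D = (fun x => v +ᵥ x) ⁻¹' slab V D := by
  ext x
  constructor
  · rintro ⟨_, ⟨a, ha, rfl⟩, S, hS, rfl⟩
    refine ⟨a, ha, S, hS, ?_⟩
    change v +ᵥ (-(v + a) +ᵥ S) = _
    rw [← add_vadd]
    congr 1
    abel
  · rintro ⟨a, ha, S, hS, h⟩
    refine ⟨v +ᵥ a, vadd_mem_vadd_set ha, S, hS, ?_⟩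
    rw [vadd_eq_add, neg_add_rev, add_comm, add_vadd, ← h, neg_vadd_vadd]

theorem slab_vadd_right (u : Euc d) (V : Set (Euc d)) (D : Set (Hull T)) :
    slab V ((fun x => -u +ᵥ x) ⁻¹' D) = slab (-u +ᵥ V) D := by
  ext x
  constructor
  · rintro ⟨a, ha, S, hS, rfl⟩
    refine ⟨-u +ᵥ a, vadd_mem_vadd_set ha, _, hS, ?_⟩
    rw [vadd_eq_add, ← add_vadd]
    congr 1
    abel
  · rintro ⟨_, ⟨a, ha, rfl⟩, S, hS, rfl⟩
    refine ⟨a, ha, u +ᵥ S, ?_, ?_⟩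
    · rw [mem_preimage, neg_vadd_vadd]
      exact hS
    · change -(-u + a) +ᵥ S = _
      rw [← add_vadd]
      congr 1
      abel

namespace BoxDecomposition

variable (𝓑 : BoxDecomposition T)

/-- The parametrization of a box. -/
def chartMap (i : Fin 𝓑.card) (q : ↥(interior (𝓑.block i)) × ↥(𝓑.vert i)) : Hull T :=
  -(q.1 : Euc d) +ᵥ (q.2 : Hull T)

theorem measurableEmbedding_chartMap (i : Fin 𝓑.card) : MeasurableEmbedding (𝓑.chartMap i) :=
  (𝓑.chart i).measurableEmbedding

theorem image_chartMap (i : Fin 𝓑.card) {V : Set (Euc d)} (hV : V ⊆ interior (𝓑.block i))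
    {D : Set (Hull T)} (hD : D ⊆ 𝓑.vert i) :
    𝓑.chartMap i '' ((Subtype.val ⁻¹' V) ×ˢ (Subtype.val ⁻¹' D)) = slab V D := by
  ext x
  constructor
  · rintro ⟨⟨v, S⟩, ⟨hv, hS⟩, rfl⟩
    exact ⟨v, hv, S, hS, rfl⟩
  · rintro ⟨v, hv, S, hS, rfl⟩
    exact ⟨(⟨v, hV hv⟩, ⟨S, hD hS⟩), ⟨hv, hS⟩, rfl⟩

theorem measurableSet_slab {i : Fin 𝓑.card} {V : Set (Euc d)} (hV : MeasurableSet V)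
    (hVi : V ⊆ interior (𝓑.block i)) {D : Set (Hull T)} (hD : MeasurableSet D)
    (hDi : D ⊆ 𝓑.vert i) : MeasurableSet (slab V D) := by
  rw [← 𝓑.image_chartMap i hVi hDi]
  exact (𝓑.measurableEmbedding_chartMap i).measurableSet_image.2
    ((measurable_subtype_coe hV).prod (measurable_subtype_coe hD))

/-- In a box, an invariant measure is the product of Lebesgue measure and a transverse measure. -/
theorem measure_slab_mul {μ : Measure (Hull T)} (hμ : μ ∈ invariantMeasures T) {i : Fin 𝓑.card}
    {D : Set (Hull T)} (hD : MeasurableSet D) (hDi : D ⊆ 𝓑.vert i) {V W : Set (Euc d)}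
    (hV : MeasurableSet V) (hW : MeasurableSet W) (hVi : V ⊆ interior (𝓑.block i))
    (hWi : W ⊆ interior (𝓑.block i)) :
    μ (slab V D) * volume W = μ (slab W D) * volume V := by
  have hfin := hμ.1
  have hinv := hμ.2
  have hemb := 𝓑.measurableEmbedding_chartMap i
  set m : Measure (Euc d) := ((μ.comap (𝓑.chartMap i)).restrict
    (univ ×ˢ (Subtype.val ⁻¹' D))).map fun q => (q.1 : Euc d) with hm
  have hmap : Measurable fun q : ↥(interior (𝓑.block i)) × ↥(𝓑.vert i) => (q.1 : Euc d) :=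
    measurable_subtype_coe.comp measurable_fst
  have hmV : ∀ V : Set (Euc d), MeasurableSet V → V ⊆ interior (𝓑.block i) →
      m V = μ (slab V D) := by
    intro V hV hVi
    rw [hm, Measure.map_apply hmap hV, Measure.restrict_apply (hmap hV), hemb.comap_apply,
      ← 𝓑.image_chartMap i hVi hDi]
    congr 2
    ext q
    simp [and_comm]
  have hmfin : IsFiniteMeasure m := by
    have : IsFiniteMeasure (μ.comap (𝓑.chartMap i)) := by
      refine ⟨?_⟩
      rw [hemb.comap_apply]
      exact measure_lt_top _ _
    rw [hm]
    infer_instance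
  rw [← hmV V hV hVi, ← hmV W hW hWi]
  refine measure_mul_volume_eq (U := interior (𝓑.block i)) (fun v A hA hAU hvA => ?_) hV hW hVi hWi
  rw [hmV _ (hA.const_vadd v) hvA, hmV _ hA hAU, slab_vadd_left]
  exact hinv.measure_preimage_vadd v (𝓑.measurableSet_slab hA hAU hD hDi)

end BoxDecomposition

end

section

variable {d : ℕ} {X : Set (Set (Euc d))} {T : Tiling X}

/-! ### The weights of an invariant measure -/

namespace BoxDecomposition

variable (𝓑 : BoxDecomposition T)

theorem measurableSet_vert (hX : IsPrototileSet X) (i : Fin 𝓑.card) :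
    MeasurableSet (𝓑.vert i) :=
  have := Hull.t2Space hX T
  (𝓑.vert_isCompact i).isClosed.measurableSet

variable {𝓑}

theorem Region.isRectangle (hrect : ∀ p ∈ X, IsRectangle p) (R : 𝓑.Region) :
    IsRectangle R.tile :=
  have ⟨_, hS⟩ := R.exists_vert
  Tiling.isRectangle_of_mem_tiles hrect (R.tile_mem _ hS)

end BoxDecomposition

theorem IsRectangle.volume_interior {t : Set (Euc d)} (h : IsRectangle t) :
    volume (interior t) = volume t :=
  measure_interior_of_null_frontier (h.convex.addHaar_frontier volume)

theorem BoxDecomposition.slab_occurs {𝓑 : BoxDecomposition T} (V : Set (Euc d)) (R : 𝓑.Region)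
    (u : Euc d) : slab V {x | 𝓑.Occurs x R u} = slab (-u +ᵥ V) (𝓑.vert R.idx) :=
  slab_vadd_right u V (𝓑.vert R.idx)

namespace EFS

variable (𝓕 : EFS T)

theorem τ_apply (μ : Measure (Hull T)) (n : ℕ) (R : 𝓕.Region n) :
    𝓕.τ μ n R = μ.real ((𝓕.level n).tower R) / (volume : Measure (Euc d)).real R.tile := by
  rw [τ, BoxDecomposition.preimage_cell]

theorem τ_nonneg (μ : Measure (Hull T)) (n : ℕ) (R : 𝓕.Region n) : 0 ≤ 𝓕.τ μ n R := by
  rw [τ_apply]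
  positivity

theorem measure_slab_vert (hX : IsPrototileSet X) (hrect : ∀ p ∈ X, IsRectangle p)
    {μ : Measure (Hull T)} (hμ : μ ∈ invariantMeasures T) {n : ℕ} (R : 𝓕.Region n)
    {V : Set (Euc d)} (hV : MeasurableSet V) (hVR : V ⊆ interior R.tile) :
    μ (slab V ((𝓕.level n).vert R.idx)) = ENNReal.ofReal (𝓕.τ μ n R) * volume V := by
  have hfin := hμ.1
  have hsub := interior_mono R.tile_subset
  have h := (𝓕.level n).measure_slab_mul hμ ((𝓕.level n).measurableSet_vert hX R.idx) subset_rfl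
    hV isOpen_interior.measurableSet (hVR.trans hsub) hsub
  have htower : slab (interior R.tile) ((𝓕.level n).vert R.idx) = (𝓕.level n).tower R := rfl
  have hpos := R.volume_real_tile_pos hX
  have htop : volume R.tile ≠ ⊤ := (R.isCompact_tile hX).measure_lt_top.ne
  have h0 : volume R.tile ≠ 0 := by
    intro h0
    rw [measureReal_def, h0] at hpos
    simp at hpos
  rw [htower, (R.isRectangle hrect).volume_interior] at h
  rw [τ_apply, ENNReal.ofReal_div_of_pos hpos, ofReal_measureReal, ofReal_measureReal,
    ENNReal.div_eq_inv_mul, mul_assoc, ← h, mul_comm (μ _), ← mul_assoc,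
    ENNReal.inv_mul_cancel h0 htop, one_mul]

theorem measure_slab_occurs (hX : IsPrototileSet X) (hrect : ∀ p ∈ X, IsRectangle p)
    {μ : Measure (Hull T)} (hμ : μ ∈ invariantMeasures T) {n : ℕ} (R : 𝓕.Region n) (u : Euc d)
    {V : Set (Euc d)} (hV : MeasurableSet V) (hVR : V ⊆ interior (u +ᵥ R.tile)) :
    μ (slab V {x | (𝓕.level n).Occurs x R u}) = ENNReal.ofReal (𝓕.τ μ n R) * volume V := by
  rw [BoxDecomposition.slab_occurs, 𝓕.measure_slab_vert hX hrect hμ R (hV.const_vadd (-u)),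
    measure_vadd]
  intro x hx
  rw [mem_vadd_set_iff_neg_vadd_mem, neg_neg] at hx
  have := hVR hx
  rwa [interior_vadd, vadd_mem_vadd_set_iff] at this

theorem measurableSet_compl_interior_tiles (𝓕 : EFS T) (hX : IsPrototileSet X)
    (hrect : ∀ p ∈ X, IsRectangle p) :
    MeasurableSet {x : Hull T | ∀ t ∈ x.1.tiles, (0 : Euc d) ∉ interior t} := by
  have hc : {x : Hull T | ∀ t ∈ x.1.tiles, (0 : Euc d) ∉ interior t} =
      (⋃ R, (𝓕.level 0).tower R)ᶜ := by
    ext x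
    simp only [mem_ofPred_eq, mem_compl_iff, mem_iUnion, BoxDecomposition.mem_tower_iff,
      not_exists, not_and]
    refine ⟨fun h R u hu => h _ hu.mem_tiles, fun h t ht => ?_⟩
    obtain ⟨R, u, hu, rfl⟩ := 𝓕.exists_occurs hX hrect 0 x ht
    exact h R u hu
  rw [hc]
  exact (isOpen_iUnion fun R => (𝓕.level 0).isOpen_tower R).measurableSet.compl

/-- Almost no tiling has the origin on the boundary of a tile: for each tiling, almost all points
of `ℝ^d` are interior to tiles, so the claim follows from the invariance by Fubini's theorem. -/
theorem measure_compl_interior_tiles (𝓕 : EFS T) (hX : IsPrototileSet X)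
    (hrect : ∀ p ∈ X, IsRectangle p) {μ : Measure (Hull T)} (hμ : μ ∈ invariantMeasures T) :
    μ {x | ∀ t ∈ x.1.tiles, (0 : Euc d) ∉ interior t} = 0 := by
  have hfin := hμ.1
  have hinv := hμ.2
  set N : Set (Hull T) := {x | ∀ t ∈ x.1.tiles, (0 : Euc d) ∉ interior t} with hN
  have hNmeas : MeasurableSet N := 𝓕.measurableSet_compl_interior_tiles hX hrect
  have hmeas : MeasurableSet {q : Euc d × Hull T | -q.1 +ᵥ q.2 ∈ N} :=
    (Hull.measurable_vadd_prod.comp (measurable_fst.neg.prodMk measurable_snd)) hNmeas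
  have h1 : ((volume : Measure (Euc d)).prod μ) {q : Euc d × Hull T | -q.1 +ᵥ q.2 ∈ N} =
      μ N * volume (univ : Set (Euc d)) := by
    rw [Measure.prod_apply hmeas]
    have : ∀ v : Euc d, μ (Prod.mk v ⁻¹' {q : Euc d × Hull T | -q.1 +ᵥ q.2 ∈ N}) = μ N :=
      fun v => hinv.measure_preimage_vadd (-v) hNmeas
    simp only [this, lintegral_const]
  have h2 : ((volume : Measure (Euc d)).prod μ) {q : Euc d × Hull T | -q.1 +ᵥ q.2 ∈ N} = 0 := by
    rw [Measure.prod_apply_symm hmeas]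
    have : ∀ x : Hull T,
        volume ((fun v => (v, x)) ⁻¹' {q : Euc d × Hull T | -q.1 +ᵥ q.2 ∈ N}) = 0 := by
      intro x
      refine measure_mono_null ?_ (Tiling.volume_compl_interior_tiles hX hrect x.1)
      intro v hv t ht hvt
      refine hv _ (Hull.vadd_mem_vadd_tiles ht) ?_
      rw [interior_vadd, mem_vadd_set_iff_neg_vadd_mem]
      simpa using hvt
    simp only [this, lintegral_zero]
  rw [h1, mul_eq_zero] at h2
  exact h2.resolve_right (isOpen_univ.measure_pos volume univ_nonempty).ne'

theorem volume_tile_of_isParent {n : ℕ} {R' : 𝓕.Region (n + 1)} {R : 𝓕.Region n}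
    (h : 𝓕.IsParent R' R) :
    (volume : Measure (Euc d)).real R'.tile = (volume : Measure (Euc d)).real R.tile := by
  obtain ⟨u, hu, -⟩ := h
  rw [← hu, measureReal_def, measure_vadd, measureReal_def]

theorem push_τ (hX : IsPrototileSet X) (hrect : ∀ p ∈ X, IsRectangle p)
    {μ : Measure (Hull T)} (hμ : μ ∈ invariantMeasures T) (n : ℕ) :
    𝓕.push n (𝓕.τ μ (n + 1)) = 𝓕.τ μ n := by
  have hfin := hμ.1
  have := finite_region hX (𝓕.level (n + 1))
  ext R
  rw [𝓕.push_apply hX hrect, τ_apply]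
  have hs : {R' | 𝓕.IsParent R' R}.Finite := toFinite _
  have htower : (𝓕.level n).tower R = ⋃ R' ∈ hs.toFinset, (𝓕.level (n + 1)).tower R' := by
    ext x
    rw [𝓕.exists_isParent_iff hX hrect]
    simp only [mem_iUnion, Finite.mem_toFinset, mem_ofPred_eq,
      exists_prop]
  rw [finsum_mem_eq_finite_toFinset_sum _ hs, htower, measureReal_biUnion_finset, Finset.sum_div]
  · refine Finset.sum_congr rfl fun R' hR' => ?_
    rw [τ_apply, 𝓕.volume_tile_of_isParent (hs.mem_toFinset.1 hR')]
  · intro R₁ _ R₂ _ hne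
    rw [Function.onFun, Set.disjoint_left]
    exact fun x h1 h2 => hne (BoxDecomposition.eq_of_mem_tower hX h1 h2)
  · exact fun R' _ => ((𝓕.level (n + 1)).isOpen_tower R').measurableSet

/-- An invariant measure is determined by its weights. -/
theorem injOn_τ (hX : IsPrototileSet X) (hrect : ∀ p ∈ X, IsRectangle p) :
    InjOn 𝓕.τ (invariantMeasures T) := by
  intro μ hμ ν hν hμν
  have hfμ := hμ.1
  have hfν := hν.1
  -- almost every point lies in one of the boxes of the prototiles
  have hbox : ∀ α ∈ invariantMeasures T, α.restrict (⋃ i, (𝓕.level 0).box i) = α := by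
    intro α hα
    refine Measure.restrict_eq_self_of_ae_mem ?_
    refine measure_mono_null ?_ (𝓕.measure_compl_interior_tiles hX hrect hα)
    intro x hx t ht h0
    refine hx ?_
    obtain ⟨R, u, hu, rfl⟩ := 𝓕.exists_occurs hX hrect 0 x ht
    obtain ⟨v, hv, S, hS, rfl⟩ := BoxDecomposition.mem_tower_iff _ |>.2 ⟨u, hu, h0⟩
    exact mem_iUnion.2 ⟨R.idx, v, interior_mono R.tile_subset hv, S, hS, rfl⟩
  rw [← hbox μ hμ, ← hbox ν hν, Measure.restrict_iUnion_congr]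
  intro i
  have hemb := (𝓕.level 0).measurableEmbedding_chartMap i
  have hrange : range ((𝓕.level 0).chartMap i) = (𝓕.level 0).box i := by
    ext x
    constructor
    · rintro ⟨⟨v, S⟩, rfl⟩
      exact ⟨v, v.2, S, S.2, rfl⟩
    · rintro ⟨v, hv, S, hS, rfl⟩
      exact ⟨(⟨v, hv⟩, ⟨S, hS⟩), rfl⟩
  rw [← hrange, ← hemb.map_comap, ← hemb.map_comap]
  congr 1
  have hfin : ∀ α : Measure (Hull T), IsFiniteMeasure α →
      IsFiniteMeasure (α.comap ((𝓕.level 0).chartMap i)) := by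
    intro α hα
    refine ⟨?_⟩
    rw [hemb.comap_apply]
    exact measure_lt_top _ _
  have := hfin μ hfμ
  refine Measure.ext_prod fun {s t} hs ht => ?_
  set V : Set (Euc d) := Subtype.val '' s with hV
  have hVmeas : MeasurableSet V :=
    (MeasurableEmbedding.subtype_coe isOpen_interior.measurableSet).measurableSet_image.2 hs
  have hVi : V ⊆ interior ((𝓕.level 0).block i) := by
    rintro _ ⟨v, -, rfl⟩
    exact v.2
  have hvert := (𝓕.level 0).measurableSet_vert hX i
  -- the transverse measure of the part `s` of the block
  set tr : Measure (Hull T) → Measure (Hull T) := fun α =>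
    ((α.comap ((𝓕.level 0).chartMap i)).restrict (s ×ˢ univ)).map fun q => (q.2 : Hull T) with htr
  have hmap : Measurable fun q : ↥(interior ((𝓕.level 0).block i)) × ↥((𝓕.level 0).vert i) =>
      (q.2 : Hull T) := measurable_subtype_coe.comp measurable_snd
  have htr_prod : ∀ α, ∀ D, MeasurableSet D →
      tr α D = (α.comap ((𝓕.level 0).chartMap i)) (s ×ˢ (Subtype.val ⁻¹' D)) := by
    intro α D hD
    simp only [htr]
    rw [Measure.map_apply hmap hD, Measure.restrict_apply (hmap hD)]
    congr 1
    ext q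
    simp [and_comm]
  have hs' : s = Subtype.val ⁻¹' V := by rw [hV, preimage_image_eq _ Subtype.val_injective]
  have htr_apply : ∀ α, ∀ D, MeasurableSet D → D ⊆ (𝓕.level 0).vert i →
      tr α D = α (slab V D) := by
    intro α D hD hDi
    rw [htr_prod α D hD, hemb.comap_apply, hs', (𝓕.level 0).image_chartMap i hVi hDi]
  have htr_compl : ∀ α, tr α (cylinder T ((𝓕.level 0).block i))ᶜ = 0 := by
    intro α
    rw [← 𝓕.vert_zero, htr_prod α _ hvert.compl]
    convert measure_empty (μ := α.comap ((𝓕.level 0).chartMap i))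
    ext ⟨v, S⟩
    simp
  have htr_fin : IsFiniteMeasure (tr μ) := by
    simp only [htr]
    infer_instance
  have htr_eq : tr μ = tr ν := by
    refine 𝓕.ext_measure_cylinder hX hrect (htr_compl μ) (htr_compl ν) fun n R u hu => ?_
    have hD := BoxDecomposition.measurableSet_occurs hX (𝓕.level n) R u
    have hDi : {x | (𝓕.level n).Occurs x R u} ⊆ (𝓕.level 0).vert i := by
      rw [𝓕.vert_zero, ← hu]
      exact fun x hx => hx.mem_tiles
    have hVR : V ⊆ interior (u +ᵥ R.tile) := hu ▸ hVi
    rw [htr_apply μ _ hD hDi, htr_apply ν _ hD hDi,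
      𝓕.measure_slab_occurs hX hrect hμ R u hVmeas hVR,
      𝓕.measure_slab_occurs hX hrect hν R u hVmeas hVR, hμν]
  have ht' : t = Subtype.val ⁻¹' (Subtype.val '' t : Set (Hull T)) :=
    (preimage_image_eq _ Subtype.val_injective).symm
  have htmeas : MeasurableSet (Subtype.val '' t : Set (Hull T)) :=
    (MeasurableEmbedding.subtype_coe hvert).measurableSet_image.2 ht
  rw [ht', ← htr_prod μ _ htmeas, ← htr_prod ν _ htmeas, htr_eq]

/-- A nonzero invariant measure has positive weights, as the hull is minimal. -/
theorem τ_pos (hX : IsPrototileSet X) (hT : T.Repetitive) {μ : Measure (Hull T)}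
    (hμ : μ ∈ invariantMeasures T) (h0 : μ ≠ 0) (n : ℕ) (R : 𝓕.Region n) : 0 < 𝓕.τ μ n R := by
  have hfin := hμ.1
  have hinv := hμ.2
  have hopen := (𝓕.level n).isOpen_tower R
  rw [τ_apply]
  refine div_pos ?_ (R.volume_real_tile_pos hX)
  refine ENNReal.toReal_pos (fun hzero => h0 ?_) (measure_ne_top _ _)
  -- countably many translates of a nonempty open set cover the hull
  obtain ⟨Q, hQc, hQd⟩ := TopologicalSpace.exists_countable_dense (Euc d)
  rw [← Measure.measure_univ_eq_zero]
  refine measure_mono_null (t := ⋃ v ∈ Q, (fun x : Hull T => v +ᵥ x) ⁻¹' (𝓕.level n).tower R)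
    (fun x _ => ?_) ((measure_biUnion_null_iff hQc).2 fun v _ => ?_)
  · obtain ⟨v, hv⟩ := Hull.exists_vadd_mem hX hT hopen ((𝓕.level n).nonempty_tower hX R) x
    obtain ⟨q, hq, hqQ⟩ := hQd.inter_open_nonempty _
      (hopen.preimage (Hull.continuous_vadd_left x)) ⟨v, hv⟩
    exact mem_biUnion hqQ hq
  · rw [hinv.measure_preimage_vadd v hopen.measurableSet, hzero]

end EFS

end

section

variable {d : ℕ} {X : Set (Set (Euc d))} {T : Tiling X}

/-! ### The switching rules for invariant measures -/

/-- A half-cube of size `ε` at the origin, on the negative side of the hyperplane orthogonal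
to the `k`-th axis. -/
def halfCube (k : Fin d) (ε : ℝ) : Set (Euc d) :=
  interior (rect (WithLp.toLp 2 fun _ => -ε) (WithLp.toLp 2 fun l => if l = k then 0 else ε))

theorem mem_halfCube {k : Fin d} {ε : ℝ} {x : Euc d} :
    x ∈ halfCube k ε ↔ ∀ l, -ε < x l ∧ x l < if l = k then 0 else ε := by
  rw [halfCube, interior_rect]
  rfl

theorem isOpen_halfCube (k : Fin d) (ε : ℝ) : IsOpen (halfCube k ε) := isOpen_interior

theorem volume_halfCube_ne_zero (k : Fin d) {ε : ℝ} (hε : 0 < ε) :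
    volume (halfCube k ε) ≠ 0 := by
  refine ((isOpen_halfCube k ε).measure_pos volume (nonempty_interior_rect fun l => ?_)).ne'
  change -ε < if l = k then 0 else ε
  split_ifs <;> linarith

theorem volume_halfCube_ne_top (k : Fin d) (ε : ℝ) : volume (halfCube k ε) ≠ ⊤ :=
  ((measure_mono interior_subset).trans_lt (isCompact_rect _ _).measure_lt_top).ne

theorem eventually_lt_nhdsGT_zero {c : ℝ} (hc : 0 < c) : ∀ᶠ ε : ℝ in 𝓝[>] 0, ε < c :=
  mem_of_superset (Ioo_mem_nhdsGT hc) fun _ h => h.2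

theorem eventually_vadd_halfCube_subset {t : Set (Euc d)} {k : Fin d} {x : Euc d}
    (hx : x ∈ upperFacet t k) : ∀ᶠ ε : ℝ in 𝓝[>] 0, x +ᵥ halfCube k ε ⊆ interior t := by
  obtain ⟨a, b, hab, rfl, hk, hl⟩ := hx
  have h1 : ∀ᶠ ε : ℝ in 𝓝[>] 0, ∀ l, ε < b l - a l := by
    rw [eventually_all]
    exact fun l => eventually_lt_nhdsGT_zero (sub_pos.2 (hab l))
  have h2 : ∀ᶠ ε : ℝ in 𝓝[>] 0, ∀ l, l ≠ k → ε < x l - a l ∧ ε < b l - x l := by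
    rw [eventually_all]
    intro l
    by_cases h : l = k
    · exact Eventually.of_forall fun _ h' => absurd h h'
    · filter_upwards [eventually_lt_nhdsGT_zero (sub_pos.2 (hl l h).1),
        eventually_lt_nhdsGT_zero (sub_pos.2 (hl l h).2)] with ε h1 h2 _ using ⟨h1, h2⟩
  filter_upwards [h1, h2] with ε h1 h2
  rintro _ ⟨v, hv, rfl⟩
  rw [interior_rect]
  intro l
  have hvl := mem_halfCube.1 hv l
  change a l < x l + v l ∧ x l + v l < b l
  by_cases h : l = k
  · subst h
    rw [if_pos rfl] at hvl
    have := h1 l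
    constructor <;> linarith [hvl.1, hvl.2]
  · rw [if_neg h] at hvl
    have := h2 l h
    constructor <;> linarith [hvl.1, hvl.2, this.1, this.2]

theorem eventually_vadd_single_vadd_halfCube_subset {t : Set (Euc d)} {k : Fin d} {x : Euc d}
    (hx : x ∈ lowerFacet t k) :
    ∀ᶠ ε : ℝ in 𝓝[>] 0, x +ᵥ (EuclideanSpace.single k ε +ᵥ halfCube k ε) ⊆ interior t := by
  obtain ⟨a, b, hab, rfl, hk, hl⟩ := hx
  have h1 : ∀ᶠ ε : ℝ in 𝓝[>] 0, ∀ l, ε < b l - a l := by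
    rw [eventually_all]
    exact fun l => eventually_lt_nhdsGT_zero (sub_pos.2 (hab l))
  have h2 : ∀ᶠ ε : ℝ in 𝓝[>] 0, ∀ l, l ≠ k → ε < x l - a l ∧ ε < b l - x l := by
    rw [eventually_all]
    intro l
    by_cases h : l = k
    · exact Eventually.of_forall fun _ h' => absurd h h'
    · filter_upwards [eventually_lt_nhdsGT_zero (sub_pos.2 (hl l h).1),
        eventually_lt_nhdsGT_zero (sub_pos.2 (hl l h).2)] with ε h1 h2 _ using ⟨h1, h2⟩
  filter_upwards [h1, h2] with ε h1 h2
  rintro _ ⟨_, ⟨v, hv, rfl⟩, rfl⟩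
  rw [interior_rect]
  intro l
  have hvl := mem_halfCube.1 hv l
  change a l < x l + (EuclideanSpace.single k ε l + v l) ∧
    x l + (EuclideanSpace.single k ε l + v l) < b l
  rw [PiLp.single_apply]
  by_cases h : l = k
  · subst h
    rw [if_pos rfl] at hvl ⊢
    have := h1 l
    constructor <;> linarith [hvl.1, hvl.2]
  · rw [if_neg h] at hvl ⊢
    have := h2 l h
    constructor <;> linarith [hvl.1, hvl.2, this.1, this.2]

theorem eventually_disjoint_vadd_halfCube {k : Fin d} {x x' : Euc d} (h : x ≠ x') :
    ∀ᶠ ε : ℝ in 𝓝[>] 0, Disjoint (x +ᵥ halfCube k ε) (x' +ᵥ halfCube k ε) := by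
  obtain ⟨l, hl⟩ : ∃ l, x l ≠ x' l := by
    by_contra hne
    push Not at hne
    exact h (PiLp.ext hne)
  have hpos : 0 < |x l - x' l| / 2 := by
    have := abs_pos.2 (sub_ne_zero.2 hl)
    positivity
  filter_upwards [eventually_lt_nhdsGT_zero hpos, self_mem_nhdsWithin] with ε hε (h0 : 0 < ε)
  rw [Set.disjoint_left]
  rintro _ ⟨v, hv, rfl⟩ ⟨v', hv', he⟩
  have hel : x' l + v' l = x l + v l := congrArg (fun z : Euc d => z l) he
  have h1 := mem_halfCube.1 hv l
  have h2 := mem_halfCube.1 hv' l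
  have hle : (if l = k then 0 else ε) ≤ ε := by split_ifs <;> linarith
  rw [lt_div_iff₀ two_pos] at hε
  rcases abs_cases (x l - x' l) with ⟨h3, _⟩ | ⟨h3, _⟩ <;>
    linarith [h1.1, h1.2, h2.1, h2.2]

/-- In every direction some tile at the origin contains points of the ray. -/
theorem Tiling.exists_mem_tile_ray (hX : IsPrototileSet X) (S : Tiling X) (e : Euc d) :
    ∃ t ∈ S.tiles, (0 : Euc d) ∈ t ∧ ∃ s : ℝ, 0 < s ∧ s • e ∈ t := by
  set A : Set (Euc d) := (fun s : ℝ => s • e) '' Ioc 0 1 with hA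
  have hAb : Bornology.IsBounded A :=
    (isCompact_Icc.image (f := fun s : ℝ => s • e) (by fun_prop)).isBounded.subset
      (image_mono Ioc_subset_Icc_self)
  have h0 : (0 : Euc d) ∈ closure A := by
    have h1 : (0 : ℝ) ∈ closure (Ioc (0 : ℝ) 1) := by
      rw [closure_Ioc zero_ne_one]
      exact ⟨le_rfl, zero_le_one⟩
    have := image_closure_subset_closure_image (f := fun s : ℝ => s • e) (by fun_prop)
      (mem_image_of_mem _ h1)
    simpa using this
  have hfin := finite_tiles_inter hX S hAb
  have hsub : A ⊆ ⋃ t ∈ {t ∈ S.tiles | (t ∩ A).Nonempty}, t ∩ A := by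
    intro x hx
    obtain ⟨t, ht, hxt⟩ := S.exists_mem_tile x
    exact mem_biUnion (show t ∈ {t ∈ S.tiles | (t ∩ A).Nonempty} from ⟨ht, x, hxt, hx⟩) ⟨hxt, hx⟩
  have h1 := closure_mono hsub h0
  rw [hfin.closure_biUnion] at h1
  obtain ⟨t, ⟨ht, _, hst, s, hs, rfl⟩, h0t⟩ := mem_iUnion₂.1 h1
  refine ⟨t, ht, ?_, s, hs.1, hst⟩
  rw [← (isCompact_of_mem_tiles hX ht).isClosed.closure_eq]
  exact closure_mono inter_subset_left h0t

namespace BoxDecomposition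

variable {𝓑 : BoxDecomposition T}

theorem proj_eq_of_mem_germs {p : 𝓑.BOF} {g : 𝓑.Region × Euc d} (hg : g ∈ 𝓑.germs p)
    {S : Hull T} (hS : S ∈ 𝓑.vert g.1.idx) : 𝓑.proj (-g.2 +ᵥ S) = p := by
  obtain ⟨hgt, S', hS', h⟩ := hg
  rw [← h]
  exact 𝓑.proj_eq_of_mem_vert (g.1.tile_subset hgt) hS hS'

theorem Occurs.mem_germs {y : Hull T} {R : 𝓑.Region} {u : Euc d} (h : 𝓑.Occurs y R u)
    (h0 : (0 : Euc d) ∈ u +ᵥ R.tile) : (R, -u) ∈ 𝓑.germs (𝓑.proj y) := by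
  refine ⟨?_, -u +ᵥ y, h, ?_⟩
  · rwa [mem_vadd_set_iff_neg_vadd_mem, vadd_eq_add, add_zero] at h0
  · rw [neg_neg, vadd_neg_vadd]

end BoxDecomposition

namespace EFS

variable (𝓕 : EFS T)

theorem exists_upper_germ (hX : IsPrototileSet X) (hrect : ∀ p ∈ X, IsRectangle p) {n : ℕ}
    {k : Fin d} {y : Hull T} (hw : (𝓕.level n).IsWallPoint k ((𝓕.level n).proj y)) :
    ∃ g ∈ (𝓕.level n).germs ((𝓕.level n).proj y), g.2 ∈ upperFacet g.1.tile k ∧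
      (𝓕.level n).Occurs y g.1 (-g.2) := by
  obtain ⟨t, ht, h0, s, hs, hst⟩ := y.1.exists_mem_tile_ray hX (-EuclideanSpace.single k 1)
  obtain ⟨R, u, hu, rfl⟩ := 𝓕.exists_occurs hX hrect n y ht
  have hg := hu.mem_germs h0
  refine ⟨_, hg, (hw _ hg).resolve_right ?_, by rwa [neg_neg]⟩
  rintro ⟨a, b, -, htile, hk, -⟩
  rw [mem_vadd_set_iff_neg_vadd_mem] at hst
  simp only at htile
  rw [htile] at hst
  have h1 := (hst k).1
  simp at h1 hk
  linarith

theorem exists_lower_germ (hX : IsPrototileSet X) (hrect : ∀ p ∈ X, IsRectangle p) {n : ℕ}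
    {k : Fin d} {y : Hull T} (hw : (𝓕.level n).IsWallPoint k ((𝓕.level n).proj y)) :
    ∃ g ∈ (𝓕.level n).germs ((𝓕.level n).proj y), g.2 ∈ lowerFacet g.1.tile k ∧
      (𝓕.level n).Occurs y g.1 (-g.2) := by
  obtain ⟨t, ht, h0, s, hs, hst⟩ := y.1.exists_mem_tile_ray hX (EuclideanSpace.single k 1)
  obtain ⟨R, u, hu, rfl⟩ := 𝓕.exists_occurs hX hrect n y ht
  have hg := hu.mem_germs h0
  refine ⟨_, hg, (hw _ hg).resolve_left ?_, by rwa [neg_neg]⟩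
  rintro ⟨a, b, -, htile, hk, -⟩
  rw [mem_vadd_set_iff_neg_vadd_mem] at hst
  simp only at htile
  rw [htile] at hst
  have h1 := (hst k).2
  simp at h1 hk
  linarith

/-- The measure of a small set of translates of the fibre over the point `p`, computed from
germs of regions at `p` that contain these translates. -/
theorem measure_slab_fiber (hX : IsPrototileSet X) (hrect : ∀ p ∈ X, IsRectangle p)
    {μ : Measure (Hull T)} (hμ : μ ∈ invariantMeasures T) {n : ℕ} {p : 𝓕.B n}
    {G : Set (𝓕.Region n × Euc d)} (hG : G.Finite) (hGp : G ⊆ (𝓕.level n).germs p)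
    {V : Set (Euc d)} (hV : MeasurableSet V) (hVt : ∀ g ∈ G, g.2 +ᵥ V ⊆ interior g.1.tile)
    (hsep : ∀ g ∈ G, ∀ g' ∈ G, g.2 ≠ g'.2 → Disjoint (g.2 +ᵥ V) (g'.2 +ᵥ V))
    (hcov : ∀ y, (𝓕.level n).proj y = p → ∃ g ∈ G, (𝓕.level n).Occurs y g.1 (-g.2)) :
    MeasurableSet (slab V {y | (𝓕.level n).proj y = p}) ∧
    μ (slab V {y | (𝓕.level n).proj y = p}) =
      ENNReal.ofReal (∑ᶠ g ∈ G, 𝓕.τ μ n g.1) * volume V := by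
  have hU : slab V {y | (𝓕.level n).proj y = p} =
      ⋃ g ∈ hG.toFinset, slab (g.2 +ᵥ V) ((𝓕.level n).vert g.1.idx) := by
    ext x
    simp only [mem_iUnion, Finite.mem_toFinset, exists_prop]
    constructor
    · rintro ⟨v, hv, y, hy, rfl⟩
      obtain ⟨g, hg, hyg⟩ := hcov y hy
      refine ⟨g, hg, _, vadd_mem_vadd_set hv, _, hyg, ?_⟩
      rw [vadd_eq_add, ← add_vadd]
      congr 1
      abel
    · rintro ⟨g, hg, _, ⟨v, hv, rfl⟩, S, hS, rfl⟩
      refine ⟨v, hv, -g.2 +ᵥ S, BoxDecomposition.proj_eq_of_mem_germs (hGp hg) hS, ?_⟩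
      change -(g.2 + v) +ᵥ S = _
      rw [← add_vadd]
      congr 1
      abel
  have hmeas : ∀ g ∈ hG.toFinset,
      MeasurableSet (slab (g.2 +ᵥ V) ((𝓕.level n).vert g.1.idx)) := fun g hg =>
    (𝓕.level n).measurableSet_slab (hV.const_vadd _)
      ((hVt g (hG.mem_toFinset.1 hg)).trans (interior_mono g.1.tile_subset))
      ((𝓕.level n).measurableSet_vert hX _) subset_rfl
  have hdisj : PairwiseDisjoint (↑hG.toFinset)
      fun g : 𝓕.Region n × Euc d => slab (g.2 +ᵥ V) ((𝓕.level n).vert g.1.idx) := by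
    intro g hg g' hg' hne
    rw [Finite.coe_toFinset] at hg hg'
    rw [Function.onFun, Set.disjoint_left]
    rintro x ⟨v, hv, S, hS, rfl⟩ ⟨v', hv', S', hS', he⟩
    have hvt := hVt g hg hv
    have hvt' := hVt g' hg' hv'
    obtain ⟨hidx, rfl, rfl⟩ := (𝓕.level n).eq_of_mem_block (interior_mono g.1.tile_subset hvt) hS
      (g'.1.tile_subset (interior_subset hvt')) hS' he
    have htile := Tiling.eq_of_mem_interior hX (g.1.tile_mem S hS) (g'.1.tile_mem S hS') hvt
      (interior_subset hvt')
    have h1 : g.1 = g'.1 := BoxDecomposition.Region.ext' hidx htile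
    have h2 : g.2 ≠ g'.2 := fun h2 => hne (Prod.ext h1 h2)
    exact (hsep g hg g' hg' h2).le_bot ⟨hv, hv'⟩
  rw [hU]
  refine ⟨Finset.measurableSet_biUnion _ hmeas, ?_⟩
  rw [measure_biUnion_finset hdisj hmeas, finsum_mem_eq_finite_toFinset_sum _ hG,
    ENNReal.ofReal_sum_of_nonneg fun g _ => 𝓕.τ_nonneg μ n g.1, Finset.sum_mul]
  refine Finset.sum_congr rfl fun g hg => ?_
  rw [𝓕.measure_slab_vert hX hrect hμ g.1 (hV.const_vadd _) (hVt g (hG.mem_toFinset.1 hg)),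
    measure_vadd]

/-- The two sides of a switching rule are the measures, divided by the same volume, of two translates
of one set: the fibre over the wall point, thickened by a small half-cube on one or on the other
side of the wall. -/
theorem switching_τ (hX : IsPrototileSet X) (hrect : ∀ p ∈ X, IsRectangle p)
    {μ : Measure (Hull T)} (hμ : μ ∈ invariantMeasures T) (n : ℕ) :
    (𝓕.level n).Switching (𝓕.τ μ n) := by
  have hinv := hμ.2
  intro k p hwall hfin
  set G₁ := {g ∈ (𝓕.level n).germs p | g.2 ∈ upperFacet g.1.tile k} with hG₁
  set G₂ := {g ∈ (𝓕.level n).germs p | g.2 ∈ lowerFacet g.1.tile k} with hG₂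
  have hf₁ : G₁.Finite := hfin.subset fun g hg => hg.1
  have hf₂ : G₂.Finite := hfin.subset fun g hg => hg.1
  -- half-cubes so small that they fit into the germs and have disjoint translates
  obtain ⟨ε, hε, h₁, h₂, hsep⟩ : ∃ ε : ℝ, 0 < ε ∧
      (∀ g ∈ G₁, g.2 +ᵥ halfCube k ε ⊆ interior g.1.tile) ∧
      (∀ g ∈ G₂, g.2 +ᵥ (EuclideanSpace.single k ε +ᵥ halfCube k ε) ⊆ interior g.1.tile) ∧
      (∀ g ∈ (𝓕.level n).germs p, ∀ g' ∈ (𝓕.level n).germs p, g.2 ≠ g'.2 →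
        Disjoint (g.2 +ᵥ halfCube k ε) (g'.2 +ᵥ halfCube k ε)) := by
    have e₁ := (eventually_all_finite hf₁).2 fun g hg => eventually_vadd_halfCube_subset hg.2
    have e₂ := (eventually_all_finite hf₂).2 fun g hg =>
      eventually_vadd_single_vadd_halfCube_subset hg.2
    have e₃ : ∀ᶠ ε : ℝ in 𝓝[>] 0, ∀ g ∈ (𝓕.level n).germs p, ∀ g' ∈ (𝓕.level n).germs p,
        g.2 ≠ g'.2 → Disjoint (g.2 +ᵥ halfCube k ε) (g'.2 +ᵥ halfCube k ε) := by
      refine (eventually_all_finite hfin).2 fun g _ => (eventually_all_finite hfin).2 fun g' _ => ?_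
      by_cases h : g.2 = g'.2
      · exact Eventually.of_forall fun _ h' => absurd h h'
      · filter_upwards [eventually_disjoint_vadd_halfCube h] with ε hε _ using hε
    have e₀ : ∀ᶠ ε : ℝ in 𝓝[>] 0, 0 < ε := self_mem_nhdsWithin
    exact (e₀.and (e₁.and (e₂.and e₃))).exists
  have hV := (isOpen_halfCube k ε).measurableSet
  obtain ⟨hm₁, hs₁⟩ := 𝓕.measure_slab_fiber hX hrect hμ (p := p) hf₁ (fun g hg => hg.1) hV h₁
    (fun g hg g' hg' => hsep g hg.1 g' hg'.1) (by
      rintro y rfl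
      obtain ⟨g, hg, hgu, hgy⟩ := 𝓕.exists_upper_germ hX hrect hwall
      exact ⟨g, ⟨hg, hgu⟩, hgy⟩)
  obtain ⟨-, hs₂⟩ := 𝓕.measure_slab_fiber hX hrect hμ (p := p) hf₂ (fun g hg => hg.1)
    (hV.const_vadd (EuclideanSpace.single k ε)) h₂ (fun g hg g' hg' hne => by
      rw [vadd_comm g.2, vadd_comm g'.2]
      exact (disjoint_image_iff (add_right_injective _)).2 (hsep g hg.1 g' hg'.1 hne)) (by
      rintro y rfl
      obtain ⟨g, hg, hgl, hgy⟩ := 𝓕.exists_lower_germ hX hrect hwall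
      exact ⟨g, ⟨hg, hgl⟩, hgy⟩)
  rw [slab_vadd_left, hinv.measure_preimage_vadd _ hm₁, hs₁, measure_vadd,
    ENNReal.mul_left_inj (volume_halfCube_ne_zero k hε) (volume_halfCube_ne_top k ε)] at hs₂
  have hnn : ∀ G : Set (𝓕.Region n × Euc d), 0 ≤ ∑ᶠ g ∈ G, 𝓕.τ μ n g.1 := fun G =>
    finsum_nonneg fun g => finsum_nonneg fun _ => 𝓕.τ_nonneg μ n g.1
  exact (ENNReal.ofReal_eq_ofReal_iff (hnn _) (hnn _)).1 hs₂

theorem τ_mem_M (hX : IsPrototileSet X) (hrect : ∀ p ∈ X, IsRectangle p)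
    {μ : Measure (Hull T)} (hμ : μ ∈ invariantMeasures T) : 𝓕.τ μ ∈ 𝓕.M :=
  ⟨fun n => ⟨𝓕.τ_nonneg μ n, 𝓕.switching_τ hX hrect hμ n⟩, 𝓕.push_τ hX hrect hμ⟩

end EFS

end

section

variable {d : ℕ} {X : Set (Set (Euc d))} {T : Tiling X}

/-! ### Transverse measures -/

/-- A system of measures on the transversals of all tiles `p`, whose values on the verticals of
the boxes of all levels are the weights `β`. -/
structure IsTransverse (𝓕 : EFS T) (β : ∀ n, 𝓕.Region n → ℝ)
    (N : Set (Euc d) → Measure (Hull T)) : Prop where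
  isFiniteMeasure : ∀ p, IsFiniteMeasure (N p)
  compl_cylinder : ∀ p, N p (cylinder T p)ᶜ = 0
  occurs : ∀ p n (R : 𝓕.Region n) u, u +ᵥ R.tile = p →
    N p {x | (𝓕.level n).Occurs x R u} = ENNReal.ofReal (β n R)

namespace EFS

variable (𝓕 : EFS T)

/-- The regions of level `n + 1` that refine an address of level `n` are exactly its parents; so the
compatibility of weights is additivity on the fibres of the address map. -/
theorem image_address_fiber (hX : IsPrototileSet X) (hrect : ∀ p ∈ X, IsRectangle p)
    {p : Set (Euc d)} {n : ℕ} (x : cylinder T p) :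
    𝓕.address hX hrect p (n + 1) ''
      {y | 𝓕.address hX hrect p n y = 𝓕.address hX hrect p n x} =
    {R' | 𝓕.IsParent R' (𝓕.address hX hrect p n x)} := by
  obtain ⟨u, -, hu⟩ := 𝓕.exists_occurs_address hX hrect p n x
  ext R'
  constructor
  · rintro ⟨y, hy, rfl⟩
    obtain ⟨v, hv, hvtile⟩ := 𝓕.exists_occurs_address hX hrect p n y
    obtain ⟨v', hv', hvtile'⟩ := 𝓕.exists_occurs_address hX hrect p (n + 1) y
    have hy' : 𝓕.address hX hrect p n y = 𝓕.address hX hrect p n x := hy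
    rw [← hy']
    exact 𝓕.isParent_of_occurs hX hv hv' (hvtile.trans hvtile'.symm)
  · rintro ⟨u₀, htile, hocc⟩
    obtain ⟨S, hS⟩ := R'.exists_vert
    have hS' : (𝓕.level (n + 1)).Occurs ((u - u₀) +ᵥ S) R' (u - u₀) := by
      unfold BoxDecomposition.Occurs
      rwa [neg_vadd_vadd]
    have hp : (u - u₀) +ᵥ R'.tile = p := by
      rw [← htile, ← add_vadd, sub_add_cancel, hu]
    have hS₀ := (hocc S hS).vadd (u - u₀)
    rw [sub_add_cancel] at hS₀
    exact ⟨⟨(u - u₀) +ᵥ S, hp ▸ hS'.mem_tiles⟩, 𝓕.address_eq hX hrect hS₀ hu,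
      𝓕.address_eq hX hrect hS' hp⟩

/-- Compatible weights define measures on the transversals of all tiles, as these are inverse limits
of finite sets of addresses. -/
theorem exists_isTransverse (hX : IsPrototileSet X) (hrect : ∀ p ∈ X, IsRectangle p)
    {β : ∀ n, 𝓕.Region n → ℝ} (hβ : β ∈ 𝓕.M) : ∃ N, IsTransverse 𝓕 β N := by
  have hnn : ∀ n R, 0 ≤ β n R := fun n => (hβ.1 n).1
  have key : ∀ p : Set (Euc d), ∃ N : Measure (Hull T), IsFiniteMeasure N ∧
      N (cylinder T p)ᶜ = 0 ∧ ∀ n (R : 𝓕.Region n) u, u +ᵥ R.tile = p →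
        N {x | (𝓕.level n).Occurs x R u} = ENNReal.ofReal (β n R) := by
    intro p
    have := isCompact_iff_compactSpace.1 (𝓕.isCompact_cylinder hX hrect p)
    obtain ⟨ν, hν, hfib⟩ := (𝓕.isRefining_address hX hrect p).exists_measure
      (fun n R => (β n R).toNNReal) (fun n x => by
        have := finite_region hX (𝓕.level (n + 1))
        have hs : {R' | 𝓕.IsParent R' (𝓕.address hX hrect p n x)}.Finite := toFinite _
        rw [𝓕.image_address_fiber hX hrect, finsum_mem_eq_finite_toFinset_sum _ hs,
          ← Real.toNNReal_sum_of_nonneg fun R _ => hnn (n + 1) R,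
          ← finsum_mem_eq_finite_toFinset_sum _ hs, ← 𝓕.push_apply hX hrect, hβ.2 n])
    have hval : Measurable (Subtype.val : cylinder T p → Hull T) := measurable_subtype_coe
    refine ⟨ν.map Subtype.val, inferInstance, ?_, fun n R u hu => ?_⟩
    · rw [Measure.map_apply hval (𝓕.measurableSet_cylinder hX hrect p).compl]
      convert measure_empty (μ := ν)
      ext x
      simp
    · obtain ⟨S, hS⟩ := R.exists_vert
      have hS' : (𝓕.level n).Occurs (u +ᵥ S) R u := by
        unfold BoxDecomposition.Occurs
        rwa [neg_vadd_vadd]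
      have hx := hfib n ⟨u +ᵥ S, hu ▸ hS'.mem_tiles⟩
      rw [𝓕.address_eq hX hrect hS' hu] at hx
      rw [Measure.map_apply hval ((𝓕.level n).measurableSet_occurs hX R u)]
      refine Eq.trans (congrArg ν ?_) hx
      ext y
      exact (𝓕.address_eq_iff hX hrect hu).symm
  choose N h1 h2 h3 using key
  exact ⟨N, h1, h2, h3⟩

end EFS

/-! ### Wall points of the tilings -/

theorem vadd_mem_upperFacet {t : Set (Euc d)} {k : Fin d} {x : Euc d} (h : x ∈ upperFacet t k)
    (v : Euc d) : v +ᵥ x ∈ upperFacet (v +ᵥ t) k := by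
  obtain ⟨a, b, hab, rfl, hk, hl⟩ := h
  refine ⟨v + a, v + b, fun l => add_lt_add_right (hab l) (v l), vadd_rect v a b, ?_,
    fun l hlk => ⟨add_lt_add_right (hl l hlk).1 (v l), add_lt_add_right (hl l hlk).2 (v l)⟩⟩
  change v k + x k = v k + b k
  rw [hk]

theorem vadd_mem_lowerFacet {t : Set (Euc d)} {k : Fin d} {x : Euc d} (h : x ∈ lowerFacet t k)
    (v : Euc d) : v +ᵥ x ∈ lowerFacet (v +ᵥ t) k := by
  obtain ⟨a, b, hab, rfl, hk, hl⟩ := h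
  refine ⟨v + a, v + b, fun l => add_lt_add_right (hab l) (v l), vadd_rect v a b, ?_,
    fun l hlk => ⟨add_lt_add_right (hl l hlk).1 (v l), add_lt_add_right (hl l hlk).2 (v l)⟩⟩
  change v k + x k = v k + a k
  rw [hk]

theorem mem_of_mem_upperFacet {t : Set (Euc d)} {k : Fin d} {x : Euc d}
    (h : x ∈ upperFacet t k) : x ∈ t := by
  obtain ⟨a, b, hab, rfl, hk, hl⟩ := h
  intro l
  by_cases hlk : l = k
  · subst hlk
    exact ⟨hk ▸ (hab l).le, hk.le⟩
  · exact ⟨(hl l hlk).1.le, (hl l hlk).2.le⟩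

theorem mem_of_mem_lowerFacet {t : Set (Euc d)} {k : Fin d} {x : Euc d}
    (h : x ∈ lowerFacet t k) : x ∈ t := by
  obtain ⟨a, b, hab, rfl, hk, hl⟩ := h
  intro l
  by_cases hlk : l = k
  · subst hlk
    exact ⟨hk.ge, hk ▸ (hab l).le⟩
  · exact ⟨(hl l hlk).1.le, (hl l hlk).2.le⟩

/-- Two tiles that abut in a wall point cover a neighbourhood of it. -/
theorem union_mem_nhds_of_facets {t t' : Set (Euc d)} {k : Fin d} {x : Euc d}
    (h : x ∈ upperFacet t k) (h' : x ∈ lowerFacet t' k) : t ∪ t' ∈ 𝓝 x := by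
  obtain ⟨a, b, hab, rfl, hk, hl⟩ := h
  obtain ⟨a', b', hab', rfl, hk', hl'⟩ := h'
  have hcont : ∀ l, Tendsto (fun y : Euc d => y l) (𝓝 x) (𝓝 (x l)) := fun l =>
    (EuclideanSpace.proj (𝕜 := ℝ) l).continuous.tendsto x
  have h1 : ∀ᶠ y in 𝓝 x, ∀ l, l ≠ k → (a l < y l ∧ y l < b l) ∧ (a' l < y l ∧ y l < b' l) := by
    rw [eventually_all]
    intro l
    by_cases hlk : l = k
    · exact Eventually.of_forall fun _ h => absurd hlk h
    · filter_upwards [(hcont l).eventually (lt_mem_nhds (hl l hlk).1),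
        (hcont l).eventually (gt_mem_nhds (hl l hlk).2),
        (hcont l).eventually (lt_mem_nhds (hl' l hlk).1),
        (hcont l).eventually (gt_mem_nhds (hl' l hlk).2)] with y h1 h2 h3 h4 _
      exact ⟨⟨h1, h2⟩, h3, h4⟩
  have h2 : ∀ᶠ y in 𝓝 x, a k < y k := (hcont k).eventually (lt_mem_nhds (hk ▸ hab k))
  have h3 : ∀ᶠ y in 𝓝 x, y k < b' k := (hcont k).eventually (gt_mem_nhds (hk' ▸ hab' k))
  filter_upwards [h1, h2, h3] with y h1 h2 h3
  rcases le_total (y k) (x k) with h | h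
  · refine Or.inl fun l => ?_
    by_cases hlk : l = k
    · subst hlk
      exact ⟨h2.le, hk ▸ h⟩
    · exact ⟨(h1 l hlk).1.1.le, (h1 l hlk).1.2.le⟩
  · refine Or.inr fun l => ?_
    by_cases hlk : l = k
    · subst hlk
      exact ⟨hk' ▸ h, h3.le⟩
    · exact ⟨(h1 l hlk).2.1.le, (h1 l hlk).2.2.le⟩

theorem Tiling.eq_or_eq_of_mem_facets (hX : IsPrototileSet X) {S : Tiling X}
    {s t t' : Set (Euc d)} (hs : s ∈ S.tiles) (ht : t ∈ S.tiles) (ht' : t' ∈ S.tiles)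
    {k : Fin d} {x : Euc d} (h : x ∈ upperFacet t k) (h' : x ∈ lowerFacet t' k) (hx : x ∈ s) :
    s = t ∨ s = t' := by
  rw [← closure_interior_of_mem_tiles hX hs] at hx
  obtain ⟨y, hy, hys⟩ := mem_closure_iff_nhds.1 hx _ (union_mem_nhds_of_facets h h')
  exact hy.imp (eq_of_mem_interior hX hs ht hys) (eq_of_mem_interior hX hs ht' hys)

theorem notMem_lowerFacet_of_mem_upperFacet {t : Set (Euc d)} {k : Fin d} {x : Euc d}
    (h : x ∈ upperFacet t k) : x ∉ lowerFacet t k := by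
  obtain ⟨a, b, hab, rfl, hk, -⟩ := h
  rintro ⟨a', b', -, he, hk', -⟩
  obtain ⟨rfl, rfl⟩ := rect_injective hab he
  exact (hab k).ne (hk'.symm.trans hk)

namespace IsTransverse

variable {𝓕 : EFS T} {β : ∀ n, 𝓕.Region n → ℝ} {N : Set (Euc d) → Measure (Hull T)}

theorem map_vadd (hN : IsTransverse 𝓕 β N) (hX : IsPrototileSet X)
    (hrect : ∀ p ∈ X, IsRectangle p) (v : Euc d) (p : Set (Euc d)) :
    N (v +ᵥ p) = (N p).map fun x => v +ᵥ x := by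
  have hf := hN.isFiniteMeasure (v +ᵥ p)
  have hmeas : Measurable fun x : Hull T => v +ᵥ x := (Hull.continuous_vadd v).measurable
  refine 𝓕.ext_measure_cylinder hX hrect (hN.compl_cylinder _) ?_ fun n R u hu => ?_
  · rw [Measure.map_apply hmeas (𝓕.measurableSet_cylinder hX hrect _).compl]
    convert hN.compl_cylinder p using 2
    ext x
    exact not_congr vadd_mem_cylinder_iff
  · rw [hN.occurs _ n R u hu, Measure.map_apply hmeas ((𝓕.level n).measurableSet_occurs hX R u),
      ← hN.occurs p n R (-v + u) (by rw [add_vadd, hu, neg_vadd_vadd])]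
    congr 1
    ext x
    constructor
    · intro h
      have := h.vadd v
      rwa [add_neg_cancel_left] at this
    · intro h
      have := BoxDecomposition.Occurs.vadd h (-v)
      rwa [neg_vadd_vadd] at this

/-- The transverse measure of the fibre over a point of `B_{n+1}`, seen from one of the tiles at
this point. -/
theorem measure_fiber (hN : IsTransverse 𝓕 β N) (hX : IsPrototileSet X)
    (hrect : ∀ p ∈ X, IsRectangle p) (hβ : ∀ n R, 0 ≤ β n R) {n : ℕ} {x : Hull T}
    {t : Set (Euc d)} (ht : t ∈ x.1.tiles) {w : Euc d} (hw : w ∈ t) :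
    {g ∈ (𝓕.level (n + 1)).germs ((𝓕.level (n + 1)).proj (-w +ᵥ x)) |
      -g.2 +ᵥ g.1.tile = -w +ᵥ t}.Finite ∧
    N t {y | (𝓕.level (n + 1)).proj (-w +ᵥ y) = (𝓕.level (n + 1)).proj (-w +ᵥ x)} =
      ENNReal.ofReal (∑ᶠ g ∈ {g ∈ (𝓕.level (n + 1)).germs ((𝓕.level (n + 1)).proj (-w +ᵥ x)) |
        -g.2 +ᵥ g.1.tile = -w +ᵥ t}, β (n + 1) g.1) := by
  set p := (𝓕.level (n + 1)).proj (-w +ᵥ x) with hp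
  set G := {g ∈ (𝓕.level (n + 1)).germs p | -g.2 +ᵥ g.1.tile = -w +ᵥ t} with hG
  have h0t : (0 : Euc d) ∈ -w +ᵥ t := by
    rw [mem_vadd_set_iff_neg_vadd_mem]
    simpa using hw
  have htile : ∀ g ∈ G, (w - g.2) +ᵥ g.1.tile = t := by
    intro g hg
    rw [sub_eq_add_neg, add_vadd, hg.2, vadd_neg_vadd]
  have hGfin : G.Finite := by
    have := finite_region hX (𝓕.level (n + 1))
    refine Finite.of_finite_image (f := Prod.fst) (toFinite _) ?_
    rintro ⟨R, z⟩ hg ⟨R', z'⟩ hg' (rfl : R = R')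
    obtain ⟨v, hv⟩ := R.nonempty_interior_tile hX
    have := vadd_set_injective (R.isCompact_tile hX) ⟨v, interior_subset hv⟩
      (hg.2.trans hg'.2.symm)
    rw [neg_inj] at this
    exact Prod.ext rfl this
  refine ⟨hGfin, ?_⟩
  have hU : {y | (𝓕.level (n + 1)).proj (-w +ᵥ y) = p} =
      ⋃ g ∈ hGfin.toFinset, {y | (𝓕.level (n + 1)).Occurs y g.1 (w - g.2)} := by
    ext y
    simp only [mem_iUnion, Finite.mem_toFinset, exists_prop, mem_ofPred_eq]
    constructor
    · intro hy
      have hty : -w +ᵥ t ∈ (-w +ᵥ y).1.tiles :=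
        𝓕.mem_tiles_of_proj_eq hX hrect hy.symm (Hull.vadd_mem_vadd_tiles ht) h0t
      obtain ⟨R, u, hu, hut⟩ := 𝓕.exists_occurs hX hrect (n + 1) _ hty
      have hg := hu.mem_germs (hut ▸ h0t)
      rw [hy] at hg
      refine ⟨(R, -u), ⟨hg, by rwa [neg_neg]⟩, ?_⟩
      have := hu.vadd w
      rwa [vadd_neg_vadd, ← sub_neg_eq_add] at this
    · rintro ⟨g, hg, hy⟩
      rw [← BoxDecomposition.proj_eq_of_mem_germs hg.1 hy, ← add_vadd]
      congr 2
      abel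
  have hdisj : PairwiseDisjoint (↑hGfin.toFinset)
      fun g : 𝓕.Region (n + 1) × Euc d => {y | (𝓕.level (n + 1)).Occurs y g.1 (w - g.2)} := by
    intro g hg g' hg' hne
    rw [Finite.coe_toFinset] at hg hg'
    rw [Function.onFun, Set.disjoint_left]
    intro y hy hy'
    obtain ⟨h1, h2⟩ := hy.unique hX hy' ((htile g hg).trans (htile g' hg').symm)
    exact hne (Prod.ext h1 (sub_right_injective h2))
  rw [hU, measure_biUnion_finset hdisj fun g _ => (𝓕.level (n + 1)).measurableSet_occurs hX _ _,
    finsum_mem_eq_finite_toFinset_sum _ hGfin,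
    ENNReal.ofReal_sum_of_nonneg fun g _ => hβ _ g.1]
  refine Finset.sum_congr rfl fun g hg => hN.occurs _ _ _ _ (htile g (hGfin.mem_toFinset.1 hg))

/-- The transverse measures of two tiles that abut in a wall point coincide on the tilings that
contain both: by the switching rules they agree on the fibres over the wall points of all `B_n`,
and as borders are forced these fibres separate the tilings. -/
theorem restrict_cylinder_eq (hN : IsTransverse 𝓕 β N) (hX : IsPrototileSet X)
    (hrect : ∀ p ∈ X, IsRectangle p) (hβ : β ∈ 𝓕.M) {t t' : Set (Euc d)} {k : Fin d} {w : Euc d}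
    (hw : w ∈ upperFacet t k) (hw' : w ∈ lowerFacet t' k) :
    (N t).restrict (cylinder T t') = (N t').restrict (cylinder T t) := by
  have := Hull.t2Space hX T
  have hf := hN.isFiniteMeasure t
  have hf' := hN.isFiniteMeasure t'
  have hnn : ∀ n R, 0 ≤ β n R := fun n => (hβ.1 n).1
  have hwt := mem_of_mem_upperFacet hw
  have hwt' := mem_of_mem_lowerFacet hw'
  have hmem0 : ∀ {s : Set (Euc d)}, w ∈ s → (0 : Euc d) ∈ -w +ᵥ s := by
    intro s hs
    rw [mem_vadd_set_iff_neg_vadd_mem]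
    simpa using hs
  have hmt := 𝓕.measurableSet_cylinder hX hrect t
  have hmt' := 𝓕.measurableSet_cylinder hX hrect t'
  set K : Set (Hull T) := cylinder T t ∩ cylinder T t' with hK
  have hKc : IsCompact K :=
    (𝓕.isCompact_cylinder hX hrect t).inter_right (𝓕.isCompact_cylinder hX hrect t').isClosed
  set ρ : ∀ n, K → 𝓕.B (n + 1) := fun n x => (𝓕.level (n + 1)).proj (-w +ᵥ x.1) with hρ
  have hρ_ref : IsRefining ρ := by
    refine ⟨fun n x => ?_, fun n x y h => 𝓕.proj_eq_of_proj_succ_eq hX hrect h, fun x y h => ?_⟩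
    · rw [isOpen_iff_mem_nhds]
      intro y hy
      set ι : K → cylinder T t := fun z => ⟨z.1, z.2.1⟩
      have hopen := ((𝓕.isRefining_address hX hrect t).isOpen_fiber (n + 1) (ι y)).preimage
        (f := ι) (by fun_prop)
      refine mem_of_superset (hopen.mem_nhds rfl) fun z hz => ?_
      obtain ⟨u, hu, hut⟩ := 𝓕.exists_occurs_address hX hrect t (n + 1) (ι y)
      have hz' := (𝓕.address_eq_iff hX hrect hut).1 hz
      have h0 : (0 : Euc d) ∈ (-w + u) +ᵥ (𝓕.address hX hrect t (n + 1) (ι y)).tile := by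
        rw [add_vadd, hut]
        exact hmem0 hwt
      exact ((hz'.vadd (-w)).proj_eq (hu.vadd (-w)) h0).trans hy
    · refine Subtype.ext (𝓕.eq_of_forall_occurs hX hrect x.2.1 fun n => ?_)
      obtain ⟨R, u, hu, hut⟩ := 𝓕.exists_occurs hX hrect n x.1 x.2.1
      refine ⟨R, u, hu, ?_, hut⟩
      have h1 := 𝓕.occurs_of_proj_eq (h n) (hu.vadd (-w)) (by
        rw [add_vadd, hut]
        exact hmem0 hwt)
      have := h1.vadd w
      rwa [vadd_neg_vadd, add_neg_cancel_left] at this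
  refine hρ_ref.ext_measure_of_isCompact hKc ?_ ?_ fun n x => ?_
  · rw [Measure.restrict_apply hKc.isClosed.measurableSet.compl]
    refine measure_mono_null (fun y hy => ?_) (hN.compl_cylinder t)
    exact fun hyt => hy.1 ⟨hyt, hy.2⟩
  · rw [Measure.restrict_apply hKc.isClosed.measurableSet.compl]
    refine measure_mono_null (fun y hy => ?_) (hN.compl_cylinder t')
    exact fun hyt => hy.1 ⟨hy.2, hyt⟩
  · set p := (𝓕.level (n + 1)).proj (-w +ᵥ x.1) with hp
    have hxt : -w +ᵥ t ∈ (-w +ᵥ x.1).1.tiles := Hull.vadd_mem_vadd_tiles x.2.1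
    have hxt' : -w +ᵥ t' ∈ (-w +ᵥ x.1).1.tiles := Hull.vadd_mem_vadd_tiles x.2.2
    have hfib : Subtype.val '' {y | ρ n y = ρ n x} =
        {y | (𝓕.level (n + 1)).proj (-w +ᵥ y) = p} := by
      ext y
      constructor
      · rintro ⟨y, hy, rfl⟩
        exact hy
      · intro hy
        have h1 := 𝓕.mem_tiles_of_proj_eq hX hrect (Eq.symm hy) hxt (hmem0 hwt)
        have h2 := 𝓕.mem_tiles_of_proj_eq hX hrect (Eq.symm hy) hxt' (hmem0 hwt')
        rw [Hull.mem_vadd_tiles, neg_neg, vadd_neg_vadd] at h1 h2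
        exact ⟨⟨y, h1, h2⟩, hy, rfl⟩
    have hsub : {y | (𝓕.level (n + 1)).proj (-w +ᵥ y) = p} ⊆ K := by
      rw [← hfib]
      rintro _ ⟨y, -, rfl⟩
      exact y.2
    -- the wall point `p` and its germs
    have hu0 : (0 : Euc d) ∈ upperFacet (-w +ᵥ t) k := by
      simpa using vadd_mem_upperFacet hw (-w)
    have hl0 : (0 : Euc d) ∈ lowerFacet (-w +ᵥ t') k := by
      simpa using vadd_mem_lowerFacet hw' (-w)
    have hgerm : ∀ g ∈ (𝓕.level (n + 1)).germs p,
        -g.2 +ᵥ g.1.tile = -w +ᵥ t ∨ -g.2 +ᵥ g.1.tile = -w +ᵥ t' := by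
      rintro g ⟨hgt, S, hS, hSp⟩
      have h0 : (0 : Euc d) ∈ -g.2 +ᵥ g.1.tile := by
        rw [mem_vadd_set_iff_neg_vadd_mem]
        simpa using hgt
      exact Tiling.eq_or_eq_of_mem_facets hX (𝓕.mem_tiles_of_proj_eq hX hrect hSp
        (Hull.vadd_mem_vadd_tiles (g.1.tile_mem S hS)) h0) hxt hxt' hu0 hl0 h0
    have hup : ∀ g : 𝓕.Region (n + 1) × Euc d, -g.2 +ᵥ g.1.tile = -w +ᵥ t →
        g.2 ∈ upperFacet g.1.tile k := by
      intro g hg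
      have := vadd_mem_upperFacet hu0 g.2
      rwa [← hg, vadd_neg_vadd, vadd_eq_add, add_zero] at this
    have hlow : ∀ g : 𝓕.Region (n + 1) × Euc d, -g.2 +ᵥ g.1.tile = -w +ᵥ t' →
        g.2 ∈ lowerFacet g.1.tile k := by
      intro g hg
      have := vadd_mem_lowerFacet hl0 g.2
      rwa [← hg, vadd_neg_vadd, vadd_eq_add, add_zero] at this
    obtain ⟨hfin, hmeas⟩ := hN.measure_fiber hX hrect hnn (n := n) x.2.1 hwt
    obtain ⟨hfin', hmeas'⟩ := hN.measure_fiber hX hrect hnn (n := n) x.2.2 hwt'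
    have hsw := (hβ.1 (n + 1)).2 k p (fun g hg => (hgerm g hg).imp (hup g) (hlow g))
      ((hfin.union hfin').subset fun g hg => (hgerm g hg).imp (fun h => ⟨hg, h⟩) fun h => ⟨hg, h⟩)
    have hset : {g ∈ (𝓕.level (n + 1)).germs p | g.2 ∈ upperFacet g.1.tile k} =
        {g ∈ (𝓕.level (n + 1)).germs p | -g.2 +ᵥ g.1.tile = -w +ᵥ t} := by
      ext g
      refine and_congr_right fun hg => ⟨fun h => (hgerm g hg).resolve_right fun h' => ?_, hup g⟩
      exact notMem_lowerFacet_of_mem_upperFacet h (hlow g h')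
    have hset' : {g ∈ (𝓕.level (n + 1)).germs p | g.2 ∈ lowerFacet g.1.tile k} =
        {g ∈ (𝓕.level (n + 1)).germs p | -g.2 +ᵥ g.1.tile = -w +ᵥ t'} := by
      ext g
      refine and_congr_right fun hg => ⟨fun h => (hgerm g hg).resolve_left fun h' => ?_, hlow g⟩
      exact notMem_lowerFacet_of_mem_upperFacet (hup g h') h
    rw [hset, hset'] at hsw
    rw [hfib, Measure.restrict_apply' hmt', Measure.restrict_apply' hmt,
      inter_eq_left.2 (hsub.trans inter_subset_right),
      inter_eq_left.2 (hsub.trans inter_subset_left), hmeas, hmeas', hsw]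

end IsTransverse

end

section

variable {d : ℕ} {X : Set (Set (Euc d))} {T : Tiling X}

/-! ### The measure on the hull defined by transverse measures -/

/-- The map `(v, S) ↦ S - v`. -/
def displace (q : Euc d × Hull T) : Hull T := -q.1 +ᵥ q.2

theorem measurable_displace : Measurable (displace : Euc d × Hull T → Hull T) :=
  Hull.measurable_vadd_prod.comp (measurable_fst.neg.prodMk measurable_snd)

theorem restrict_vadd_eq_map (u : Euc d) {V : Set (Euc d)}
    (hV : MeasurableSet V) :
    (volume : Measure (Euc d)).restrict (u +ᵥ V) = (volume.restrict V).map fun x => u + x := by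
  conv_lhs => rw [← map_add_left_eq_self (volume : Measure (Euc d)) u]
  rw [Measure.restrict_map (measurable_const_add u) (hV.const_vadd u)]
  congr 2
  exact preimage_image_eq V (add_right_injective u)

/-- The measure on the hull which is locally the product of Lebesgue measure and the transverse
measures of the prototiles. -/
noncomputable def EFS.ofTransverse (𝓕 : EFS T) (N : Set (Euc d) → Measure (Hull T)) :
    Measure (Hull T) :=
  ∑ i, (((volume : Measure (Euc d)).restrict (interior ((𝓕.level 0).block i))).prod
    (N ((𝓕.level 0).block i))).map displace

namespace IsTransverse

variable {𝓕 : EFS T} {β : ∀ n, 𝓕.Region n → ℝ} {N : Set (Euc d) → Measure (Hull T)}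

theorem ofTransverse_apply (hN : IsTransverse 𝓕 β N) {E : Set (Hull T)} (hE : MeasurableSet E) :
    𝓕.ofTransverse N E = ∑ i, ((volume : Measure (Euc d)).prod (N ((𝓕.level 0).block i)))
      (displace ⁻¹' E ∩ interior ((𝓕.level 0).block i) ×ˢ (𝓕.level 0).vert i) := by
  rw [EFS.ofTransverse, Measure.finsetSum_apply]
  refine Finset.sum_congr rfl fun i _ => ?_
  have hf := hN.isFiniteMeasure ((𝓕.level 0).block i)
  have hr : N ((𝓕.level 0).block i) =
      (N ((𝓕.level 0).block i)).restrict ((𝓕.level 0).vert i) := by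
    refine (Measure.restrict_eq_self_of_ae_mem ?_).symm
    rw [𝓕.vert_zero]
    exact hN.compl_cylinder _
  rw [Measure.map_apply measurable_displace hE]
  nth_rw 1 [hr]
  rw [Measure.prod_restrict, Measure.restrict_apply (measurable_displace hE)]

theorem isFiniteMeasure_ofTransverse (hN : IsTransverse 𝓕 β N) :
    IsFiniteMeasure (𝓕.ofTransverse N) := by
  refine ⟨?_⟩
  rw [EFS.ofTransverse, Measure.finsetSum_apply]
  refine ENNReal.sum_lt_top.2 fun i _ => ?_
  have hf := hN.isFiniteMeasure ((𝓕.level 0).block i)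
  rw [Measure.map_apply measurable_displace .univ, preimage_univ, ← univ_prod_univ,
    Measure.prod_prod, Measure.restrict_apply_univ]
  exact ENNReal.mul_lt_top ((measure_mono interior_subset).trans_lt
    ((𝓕.level 0).isBlock i).isCompact.measure_lt_top) (measure_lt_top _ _)

theorem restrict_slab_block (hN : IsTransverse 𝓕 β N) {i : Fin (𝓕.level 0).card} {V : Set (Euc d)}
    (hV : MeasurableSet V) (hVi : V ⊆ interior ((𝓕.level 0).block i)) {D : Set (Hull T)}
    (hD : MeasurableSet D) (hDi : D ⊆ (𝓕.level 0).vert i) :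
    (𝓕.ofTransverse N).restrict (slab V D) =
      ((volume.restrict V).prod ((N ((𝓕.level 0).block i)).restrict D)).map displace := by
  have hf := hN.isFiniteMeasure ((𝓕.level 0).block i)
  have hslab := (𝓕.level 0).measurableSet_slab hV hVi hD hDi
  ext E hE
  rw [Measure.restrict_apply hE, hN.ofTransverse_apply (hE.inter hslab),
    Measure.map_apply measurable_displace hE, Measure.prod_restrict,
    Measure.restrict_apply (measurable_displace hE), Finset.sum_eq_single i]
  · congr 1
    ext ⟨v', S'⟩
    constructor
    · rintro ⟨⟨hE', v, hv, S, hS, h⟩, hv', hS'⟩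
      obtain ⟨-, rfl, rfl⟩ := (𝓕.level 0).eq_of_mem_block (hVi hv) (hDi hS)
        (interior_subset hv') hS' h.symm
      exact ⟨hE', hv, hS⟩
    · rintro ⟨hE', hv, hS⟩
      exact ⟨⟨hE', v', hv, S', hS, rfl⟩, hVi hv, hDi hS⟩
  · intro j _ hj
    convert measure_empty (μ := (volume : Measure (Euc d)).prod (N ((𝓕.level 0).block j)))
    rw [eq_empty_iff_forall_notMem]
    rintro ⟨v', S'⟩ ⟨⟨-, v, hv, S, hS, h⟩, hv', hS'⟩
    exact hj ((𝓕.level 0).eq_of_mem_block (hVi hv) (hDi hS) (interior_subset hv') hS' h.symm).1.symm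
  · exact fun h => absurd (Finset.mem_univ i) h

theorem map_displace_vadd (hN : IsTransverse 𝓕 β N) (hX : IsPrototileSet X)
    (hrect : ∀ p ∈ X, IsRectangle p) (u : Euc d) (p : Set (Euc d)) {V : Set (Euc d)}
    (hV : MeasurableSet V) {D : Set (Hull T)} (hD : MeasurableSet D) :
    ((volume.restrict (u +ᵥ V)).prod
      ((N (u +ᵥ p)).restrict ((fun x => -u +ᵥ x) ⁻¹' D))).map displace =
    ((volume.restrict V).prod ((N p).restrict D)).map displace := by
  have hf := hN.isFiniteMeasure p
  have hm : Measurable fun x : Euc d => u + x := measurable_const_add u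
  have hmH : ∀ u : Euc d, Measurable fun x : Hull T => u +ᵥ x := fun u =>
    (Hull.continuous_vadd u).measurable
  have h2 : (N (u +ᵥ p)).restrict ((fun x => -u +ᵥ x) ⁻¹' D) =
      ((N p).restrict D).map fun x => u +ᵥ x := by
    rw [hN.map_vadd hX hrect, Measure.restrict_map (hmH u) (hmH (-u) hD)]
    congr 2
    ext x
    simp only [mem_preimage, neg_vadd_vadd]
  rw [restrict_vadd_eq_map u hV, h2, Measure.map_prod_map _ _ hm (hmH u),
    Measure.map_map measurable_displace (hm.prodMap (hmH u))]
  congr 1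
  ext1 ⟨v, S⟩
  change -(u + v) +ᵥ (u +ᵥ S) = -v +ᵥ S
  rw [← add_vadd]
  congr 1
  abel

/-- The measure is the product of Lebesgue measure and a transverse measure near every tile. -/
theorem restrict_slab (hN : IsTransverse 𝓕 β N) (hX : IsPrototileSet X)
    (hrect : ∀ p ∈ X, IsRectangle p) {p : Set (Euc d)} {x : Hull T} (hp : p ∈ x.1.tiles)
    {V : Set (Euc d)} (hV : MeasurableSet V) (hVp : V ⊆ interior p) {D : Set (Hull T)}
    (hD : MeasurableSet D) (hDp : D ⊆ cylinder T p) :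
    (𝓕.ofTransverse N).restrict (slab V D) =
      ((volume.restrict V).prod ((N p).restrict D)).map displace := by
  obtain ⟨R, u, -, rfl⟩ := 𝓕.exists_occurs hX hrect 0 x hp
  rw [𝓕.tile_eq_block hX] at *
  set D' : Set (Hull T) := (fun x => u +ᵥ x) ⁻¹' D with hD'
  have hD'm : MeasurableSet D' := (Hull.continuous_vadd u).measurable hD
  have hDD' : D = (fun x => -u +ᵥ x) ⁻¹' D' := by
    ext x
    simp only [hD', mem_preimage, vadd_neg_vadd]
  have hslab : slab V D = slab (-u +ᵥ V) D' := by
    rw [hDD', slab_vadd_right]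
  have h := hN.restrict_slab_block (i := R.idx) (hV.const_vadd (-u)) (fun v hv => by
    rw [mem_vadd_set_iff_neg_vadd_mem, neg_neg] at hv
    have := hVp hv
    rwa [interior_vadd, vadd_mem_vadd_set_iff] at this) hD'm (fun x hx => by
    rw [𝓕.vert_zero]
    exact vadd_mem_cylinder_iff.1 (hDp hx))
  rw [hslab, h, ← hN.map_displace_vadd hX hrect u _ (hV.const_vadd (-u)) hD'm, vadd_neg_vadd,
    ← hDD']

theorem measure_slab (hN : IsTransverse 𝓕 β N) (hX : IsPrototileSet X)
    (hrect : ∀ p ∈ X, IsRectangle p) {p : Set (Euc d)} {x : Hull T} (hp : p ∈ x.1.tiles)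
    {V : Set (Euc d)} (hV : MeasurableSet V) (hVp : V ⊆ interior p) {D : Set (Hull T)}
    (hD : MeasurableSet D) (hDp : D ⊆ cylinder T p) :
    𝓕.ofTransverse N (slab V D) = volume V * N p D := by
  have hf := hN.isFiniteMeasure p
  rw [← Measure.restrict_apply_univ, hN.restrict_slab hX hrect hp hV hVp hD hDp,
    Measure.map_apply measurable_displace .univ, preimage_univ, ← univ_prod_univ,
    Measure.prod_prod, Measure.restrict_apply_univ, Measure.restrict_apply_univ]

theorem τ_ofTransverse (hN : IsTransverse 𝓕 β N) (hX : IsPrototileSet X)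
    (hrect : ∀ p ∈ X, IsRectangle p) (hβ : ∀ n R, 0 ≤ β n R) : 𝓕.τ (𝓕.ofTransverse N) = β := by
  ext n R
  obtain ⟨S, hS⟩ := R.exists_vert
  have htower : (𝓕.level n).tower R = slab (interior R.tile) ((𝓕.level n).vert R.idx) := rfl
  have hN0 : N R.tile ((𝓕.level n).vert R.idx) = ENNReal.ofReal (β n R) := by
    rw [← hN.occurs R.tile n R 0 (zero_vadd _ _)]
    congr 1
    ext x
    simp [BoxDecomposition.Occurs]
  have h := hN.measure_slab hX hrect (R.tile_mem S hS) isOpen_interior.measurableSet subset_rfl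
    ((𝓕.level n).measurableSet_vert hX R.idx) fun S hS => R.tile_mem S hS
  rw [EFS.τ_apply, htower, measureReal_def, h, hN0, ENNReal.toReal_mul,
    ENNReal.toReal_ofReal (hβ n R), (R.isRectangle hrect).volume_interior, measureReal_def,
    mul_div_cancel_left₀]
  exact (R.volume_real_tile_pos hX).ne'

end IsTransverse

/-! ### Crossing a wall -/

theorem Tiling.exists_pos_le_side (hX : IsPrototileSet X) :
    ∃ r : ℝ, 0 < r ∧ ∀ S : Tiling X, ∀ a b : Euc d, rect a b ∈ S.tiles →
      ∀ k, r ≤ b k - a k := by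
  obtain ⟨r, hr, h⟩ := exists_ball_subset hX
  refine ⟨r, hr, fun S a b ht k => ?_⟩
  obtain ⟨c, hc⟩ := h S _ ht
  have hmem : ∀ s : ℝ, |s| < r → c + EuclideanSpace.single k s ∈ rect a b := by
    intro s hs
    refine interior_subset (hc ?_)
    rw [mem_ball, dist_eq_norm, add_sub_cancel_left, PiLp.norm_single]
    exact hs
  have h1 := (hmem (r / 2) (by rw [abs_of_pos (by positivity)]; linarith) k).2
  have h2 := (hmem (-(r / 2)) (by rw [abs_neg, abs_of_pos (by positivity)]; linarith) k).1
  simp only [PiLp.add_apply, PiLp.single_apply, if_true] at h1 h2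
  linarith

/-- If a small step in the direction of a coordinate axis leads from the interior of a tile to the
interior of another one, then the tiles abut in a wall point. -/
theorem Tiling.exists_mem_facets (hX : IsPrototileSet X) (hrect : ∀ p ∈ X, IsRectangle p)
    {r : ℝ} (hr : ∀ S : Tiling X, ∀ a b : Euc d, rect a b ∈ S.tiles → ∀ k, r ≤ b k - a k)
    {S : Tiling X} {p t : Set (Euc d)} (hp : p ∈ S.tiles) (ht : t ∈ S.tiles) {k : Fin d} {s : ℝ}
    (hs : 0 < s) (hsr : s < r) {v : Euc d} (hv : v ∈ interior p)
    (hvt : EuclideanSpace.single k s + v ∈ interior t) (hne : p ≠ t) :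
    ∃ w, w ∈ upperFacet p k ∧ w ∈ lowerFacet t k := by
  obtain ⟨a, b, hab, rfl⟩ := isRectangle_of_mem_tiles hrect hp
  rw [interior_rect] at hv
  -- the point at which the step leaves the first tile
  set w : Euc d := EuclideanSpace.single k (b k - v k) + v with hw
  have hstep : ∀ (c : ℝ) (l : Fin d),
      (EuclideanSpace.single k c + v) l = (if l = k then c else 0) + v l := by
    intro c l
    rw [PiLp.add_apply, PiLp.single_apply]
  have hwk : w k = b k := by rw [hw, hstep, if_pos rfl]; ring
  have hwl : ∀ l, l ≠ k → w l = v l := fun l hl => by rw [hw, hstep, if_neg hl, zero_add]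
  have hwu : w ∈ upperFacet (rect a b) k :=
    ⟨a, b, hab, rfl, hwk, fun l hl => by rw [hwl l hl]; exact hv l⟩
  have hout : b k < v k + s := by
    by_contra hle
    push Not at hle
    refine hne (eq_of_mem_interior hX ht hp hvt fun l => ?_).symm
    rw [hstep]
    by_cases hl : l = k
    · subst hl
      rw [if_pos rfl]
      constructor <;> linarith [(hv l).1]
    · rw [if_neg hl, zero_add]
      exact ⟨(hv l).1.le, (hv l).2.le⟩
  -- the tile entered there
  obtain ⟨q, hq, hq0, η, hη, hqη⟩ :=
    (-w +ᵥ S).exists_mem_tile_ray hX (EuclideanSpace.single k 1)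
  rw [mem_vadd_tiles, neg_neg] at hq
  have hwq : w ∈ w +ᵥ q := by
    rw [mem_vadd_set_iff_neg_vadd_mem]
    simpa using hq0
  have hwq' : w + η • EuclideanSpace.single k 1 ∈ w +ᵥ q := by
    rw [mem_vadd_set_iff_neg_vadd_mem, vadd_eq_add, neg_add_cancel_left]
    exact hqη
  generalize w +ᵥ q = q' at hq hwq hwq'
  obtain ⟨a', b', hab', rfl⟩ := isRectangle_of_mem_tiles hrect hq
  have hside := hr S a' b' hq k
  have hneq : rect a b ≠ rect a' b' := by
    intro h
    rw [← h] at hwq'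
    have := (hwq' k).2
    simp [hwk] at this
    linarith
  have ha' : a' k = b k := by
    refine le_antisymm (hwk ▸ (hwq k).1) ?_
    by_contra hlt
    push Not at hlt
    -- otherwise the tile would contain interior points of the first one
    set c := max (a' k) (v k) with hc
    have hcb : c < b k := max_lt hlt (hv k).2
    refine hneq (eq_of_mem_interior hX hp hq (x := EuclideanSpace.single k (c - v k) + v) ?_ ?_)
    · rw [interior_rect]
      intro l
      rw [hstep]
      by_cases hl : l = k
      · subst hl
        rw [if_pos rfl, sub_add_cancel]
        exact ⟨(hv l).1.trans_le (le_max_right _ _), hcb⟩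
      · rw [if_neg hl, zero_add]
        exact hv l
    · intro l
      rw [hstep]
      by_cases hl : l = k
      · subst hl
        rw [if_pos rfl, sub_add_cancel]
        exact ⟨le_max_left _ _, hcb.le.trans (hwk ▸ (hwq l).2)⟩
      · rw [if_neg hl, zero_add, ← hwl l hl]
        exact hwq l
  have hvq : EuclideanSpace.single k s + v ∈ rect a' b' := by
    intro l
    rw [hstep]
    by_cases hl : l = k
    · subst hl
      rw [if_pos rfl]
      constructor <;> linarith [(hv l).2]
    · rw [if_neg hl, zero_add, ← hwl l hl]
      exact hwq l
  obtain rfl := eq_of_mem_interior hX ht hq hvt hvq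
  refine ⟨w, hwu, a', b', hab', rfl, hwk.trans ha'.symm, fun l hl => ?_⟩
  rw [interior_rect] at hvt
  have := hvt l
  rwa [hstep, if_neg hl, zero_add, ← hwl l hl] at this

end

section

variable {d : ℕ} {X : Set (Set (Euc d))} {T : Tiling X}

/-! ### Invariance -/

/-- By the forced border, the tiles that touch a region of `B_1` are common to all tilings of its
vertical. -/
theorem EFS.mem_tiles_of_mem_vert_one (𝓕 : EFS T) (hX : IsPrototileSet X)
    (hrect : ∀ p ∈ X, IsRectangle p) (R : 𝓕.Region 1) {S S' : Hull T}
    (hS : S ∈ (𝓕.level 1).vert R.idx) (hS' : S' ∈ (𝓕.level 1).vert R.idx) {t : Set (Euc d)}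
    (ht : t ∈ S.1.tiles) {w : Euc d} (hw : w ∈ R.tile) (hwt : w ∈ t) : t ∈ S'.1.tiles := by
  obtain ⟨R₀, u, hu, rfl⟩ := 𝓕.exists_occurs hX hrect 0 S ht
  have hne : ((u +ᵥ (𝓕.level 0).block R₀.idx) ∩ (𝓕.level 1).block R.idx).Nonempty :=
    ⟨w, 𝓕.tile_eq_block hX R₀ ▸ hwt, R.tile_subset hw⟩
  exact BoxDecomposition.Occurs.mem_tiles (R := R₀)
    (𝓕.forcesBorder 0 R.idx S hS S' hS' R₀.idx u hu hne)

/-- The vectors that preserve a measure on the hull. -/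
def stabilizer (μ : Measure (Hull T)) : AddSubgroup (Euc d) where
  carrier := {v | μ.map (fun x => v +ᵥ x) = μ}
  zero_mem' := by
    simp only [mem_ofPred_eq, zero_vadd]
    exact Measure.map_id
  add_mem' {v w} hv hw := by
    have hm : ∀ v : Euc d, Measurable fun x : Hull T => v +ᵥ x := fun v =>
      (Hull.continuous_vadd v).measurable
    change μ.map (fun x => (v + w) +ᵥ x) = μ
    have hv' : μ.map (fun x => v +ᵥ x) = μ := hv
    have hw' : μ.map (fun x => w +ᵥ x) = μ := hw
    have h := Measure.map_map (μ := μ) (hm v) (hm w)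
    rw [hw', hv'] at h
    simp only [add_vadd]
    exact h.symm
  neg_mem' {v} hv := by
    have hm : ∀ v : Euc d, Measurable fun x : Hull T => v +ᵥ x := fun v =>
      (Hull.continuous_vadd v).measurable
    have hv' : μ.map (fun x => v +ᵥ x) = μ := hv
    change μ.map (fun x => -v +ᵥ x) = μ
    conv_lhs => rw [← hv']
    rw [Measure.map_map (hm _) (hm _)]
    convert Measure.map_id (μ := μ)
    ext1 x
    exact neg_vadd_vadd v x

namespace IsTransverse

variable {𝓕 : EFS T} {β : ∀ n, 𝓕.Region n → ℝ} {N : Set (Euc d) → Measure (Hull T)}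

/-- Almost no tiling has the origin on the boundary of a tile. -/
theorem ofTransverse_compl_interior_tiles (hN : IsTransverse 𝓕 β N) (hX : IsPrototileSet X)
    (hrect : ∀ p ∈ X, IsRectangle p) :
    𝓕.ofTransverse N {x | ∀ t ∈ x.1.tiles, (0 : Euc d) ∉ interior t} = 0 := by
  rw [hN.ofTransverse_apply (𝓕.measurableSet_compl_interior_tiles hX hrect)]
  refine Finset.sum_eq_zero fun i _ => ?_
  convert measure_empty (μ := (volume : Measure (Euc d)).prod (N ((𝓕.level 0).block i)))
  rw [eq_empty_iff_forall_notMem]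
  rintro ⟨v, S⟩ ⟨h, hv, hS⟩
  rw [𝓕.vert_zero] at hS
  refine h _ (Hull.vadd_mem_vadd_tiles hS) ?_
  rw [interior_vadd, mem_vadd_set_iff_neg_vadd_mem]
  simpa using hv

/-- A translation preserves the measure on those tilings that it moves from one tile to another
one with the same transverse measure. -/
theorem measure_preimage_inter_slab (hN : IsTransverse 𝓕 β N) (hX : IsPrototileSet X)
    (hrect : ∀ p ∈ X, IsRectangle p) {p t : Set (Euc d)} {e : Euc d} {V : Set (Euc d)}
    (hV : MeasurableSet V) (hVp : V ⊆ interior p) (hVt : e +ᵥ V ⊆ interior t) {D : Set (Hull T)}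
    (hD : MeasurableSet D) (hDp : D ⊆ cylinder T p) (hDt : D ⊆ cylinder T t)
    (h : (N p).restrict D = (N t).restrict D) {E : Set (Hull T)} (hE : MeasurableSet E) :
    𝓕.ofTransverse N ((fun x => -e +ᵥ x) ⁻¹' E ∩ slab V D) =
      𝓕.ofTransverse N (E ∩ slab (e +ᵥ V) D) := by
  rcases D.eq_empty_or_nonempty with rfl | ⟨S, hS⟩
  · simp [slab]
  have hft := hN.isFiniteMeasure t
  have hφ : Measurable fun x : Hull T => -e +ᵥ x := (Hull.continuous_vadd (-e)).measurable
  have hm : Measurable fun x : Euc d => e + x := measurable_const_add e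
  rw [← Measure.restrict_apply (hφ hE), ← Measure.restrict_apply hE,
    hN.restrict_slab hX hrect (hDp hS) hV hVp hD hDp,
    hN.restrict_slab hX hrect (hDt hS) (hV.const_vadd e) hVt hD hDt, h,
    restrict_vadd_eq_map e hV]
  conv_rhs => rw [← Measure.map_id (μ := (N t).restrict D)]
  rw [Measure.map_prod_map _ _ hm measurable_id,
    Measure.map_map measurable_displace (hm.prodMap measurable_id),
    ← Measure.map_apply hφ hE, Measure.map_map hφ measurable_displace]
  congr 2
  ext1 ⟨v, S⟩
  change -e +ᵥ (-v +ᵥ S) = -(e + v) +ᵥ S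
  rw [← add_vadd, neg_add]

/-- Translations by small vectors parallel to a coordinate axis do not increase the measure: the
hull is cut into pieces on which they lead from one tile to the same or to an abutting one. -/
theorem ofTransverse_preimage_single_le (hN : IsTransverse 𝓕 β N) (hX : IsPrototileSet X)
    (hrect : ∀ p ∈ X, IsRectangle p) (hβ : β ∈ 𝓕.M) {r : ℝ}
    (hr : ∀ S : Tiling X, ∀ a b : Euc d, rect a b ∈ S.tiles → ∀ k, r ≤ b k - a k) (k : Fin d)
    {s : ℝ} (hs : 0 < s) (hsr : s < r) {E : Set (Hull T)} (hE : MeasurableSet E) :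
    𝓕.ofTransverse N ((fun x => -EuclideanSpace.single k s +ᵥ x) ⁻¹' E) ≤
      𝓕.ofTransverse N E := by
  set μ := 𝓕.ofTransverse N with hμ
  set e : Euc d := EuclideanSpace.single k s with he
  have hfin := finite_region hX (𝓕.level 1)
  choose S hS using fun R : 𝓕.Region 1 => R.exists_vert
  have hcount : ∀ R : 𝓕.Region 1, Countable (S R).1.tiles := fun R =>
    (Tiling.countable_tiles hX (S R).1).to_subtype
  let V : (Σ R : 𝓕.Region 1, (S R).1.tiles) → Set (Euc d) := fun i =>
    interior i.1.tile ∩ (fun v => e + v) ⁻¹' interior i.2.1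
  have hVmeas : ∀ i, MeasurableSet (V i) := fun i =>
    isOpen_interior.measurableSet.inter
      ((measurable_const_add e) isOpen_interior.measurableSet)
  let D : (Σ R : 𝓕.Region 1, (S R).1.tiles) → Set (Hull T) := fun i => (𝓕.level 1).vert i.1.idx
  have hDmeas : ∀ i, MeasurableSet (D i) := fun i => (𝓕.level 1).measurableSet_vert hX _
  have hslab : ∀ i, MeasurableSet (slab (V i) (D i)) := fun i =>
    (𝓕.level 1).measurableSet_slab (hVmeas i)
      (inter_subset_left.trans (interior_mono i.1.tile_subset)) (hDmeas i) subset_rfl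
  have hdisj : Pairwise fun i j => Disjoint (slab (V i) (D i)) (slab (V j) (D j)) := by
    rintro ⟨R, t, ht⟩ ⟨R', t', ht'⟩ hne
    rw [Set.disjoint_left]
    rintro x ⟨v, hv, A, hA, rfl⟩ ⟨v', hv', A', hA', h⟩
    obtain rfl : R = R' := BoxDecomposition.eq_of_mem_tower hX
      (⟨v, hv.1, A, hA, rfl⟩ : -v +ᵥ A ∈ (𝓕.level 1).tower R) ⟨v', hv'.1, A', hA', h⟩
    obtain ⟨-, rfl, -⟩ := (𝓕.level 1).eq_of_mem_block (interior_mono R.tile_subset hv.1) hA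
      (interior_subset (interior_mono R.tile_subset hv'.1)) hA' h
    obtain rfl := Tiling.eq_of_mem_interior hX ht ht' hv.2 (interior_subset hv'.2)
    exact hne rfl
  -- on each piece the translation preserves the measure
  have hpiece : ∀ i, μ ((fun x => -e +ᵥ x) ⁻¹' E ∩ slab (V i) (D i)) =
      μ (E ∩ slab (e +ᵥ V i) (D i)) := by
    rintro ⟨R, t, ht⟩
    rcases (V ⟨R, t, ht⟩).eq_empty_or_nonempty with h0 | ⟨v, hv⟩
    · rw [h0]
      simp [slab]
    have hsub : e +ᵥ V ⟨R, t, ht⟩ ⊆ interior t := by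
      rintro _ ⟨v, hv, rfl⟩
      exact hv.2
    have hDp : D ⟨R, t, ht⟩ ⊆ cylinder T R.tile := fun A hA => R.tile_mem A hA
    by_cases hne : R.tile = t
    · exact hN.measure_preimage_inter_slab hX hrect (hVmeas _) inter_subset_left hsub (hDmeas _)
        hDp (hne ▸ hDp) (by rw [hne]) hE
    obtain ⟨w, hw, hw'⟩ := Tiling.exists_mem_facets hX hrect hr (R.tile_mem _ (hS R)) ht hs hsr
      hv.1 hv.2 hne
    have hDt : D ⟨R, t, ht⟩ ⊆ cylinder T t := fun A hA =>
      𝓕.mem_tiles_of_mem_vert_one hX hrect R (hS R) hA ht (mem_of_mem_upperFacet hw)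
        (mem_of_mem_lowerFacet hw')
    refine hN.measure_preimage_inter_slab hX hrect (hVmeas _) inter_subset_left hsub (hDmeas _)
      hDp hDt ?_ hE
    have h := congrArg (fun ν => ν.restrict (D ⟨R, t, ht⟩))
      (hN.restrict_cylinder_eq hX hrect hβ hw hw')
    rwa [Measure.restrict_restrict (hDmeas _), Measure.restrict_restrict (hDmeas _),
      inter_eq_left.2 hDt, inter_eq_left.2 hDp] at h
  -- the points whose translate lies on the boundary of a tile
  have hbad : ∀ R : 𝓕.Region 1, μ (slab (interior R.tile ∩
      (fun v => e + v) ⁻¹' {v | ∀ t ∈ (S R).1.tiles, v ∉ interior t}) ((𝓕.level 1).vert R.idx)) =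
      0 := by
    intro R
    have hmeas : MeasurableSet {v : Euc d | ∀ t ∈ (S R).1.tiles, v ∉ interior t} := by
      have : {v : Euc d | ∀ t ∈ (S R).1.tiles, v ∉ interior t} =
          (⋃ t ∈ (S R).1.tiles, interior t)ᶜ := by
        ext v
        simp
      rw [this]
      exact (isOpen_biUnion fun _ _ => isOpen_interior).measurableSet.compl
    rw [hμ, hN.measure_slab hX hrect (R.tile_mem _ (hS R))
      (isOpen_interior.measurableSet.inter (measurable_const_add e hmeas)) inter_subset_left
      ((𝓕.level 1).measurableSet_vert hX _) fun A hA => R.tile_mem A hA]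
    refine mul_eq_zero_of_left (measure_mono_null inter_subset_right ?_) _
    rw [measure_preimage_add]
    exact Tiling.volume_compl_interior_tiles hX hrect (S R).1
  have hcover : μ (⋃ i, slab (V i) (D i))ᶜ = 0 := by
    refine measure_mono_null (t := {x | ∀ t ∈ x.1.tiles, (0 : Euc d) ∉ interior t} ∪
      ⋃ R : 𝓕.Region 1, slab (interior R.tile ∩
        (fun v => e + v) ⁻¹' {v | ∀ t ∈ (S R).1.tiles, v ∉ interior t})
        ((𝓕.level 1).vert R.idx)) (fun x hx => ?_)
      (measure_union_null (hN.ofTransverse_compl_interior_tiles hX hrect)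
        (measure_iUnion_null hbad))
    by_contra hx'
    rw [mem_union, not_or] at hx'
    obtain ⟨h0, h1⟩ := hx'
    rw [mem_ofPred_eq] at h0
    push Not at h0
    obtain ⟨t, ht, h0t⟩ := h0
    obtain ⟨R, u, hu, rfl⟩ := 𝓕.exists_occurs hX hrect 1 x ht
    obtain ⟨v, hv, A, hA, rfl⟩ := ((𝓕.level 1).mem_tower_iff).2 ⟨u, hu, h0t⟩
    by_cases hev : ∀ t ∈ (S R).1.tiles, e + v ∉ interior t
    · exact h1 (mem_iUnion.2 ⟨R, v, ⟨hv, hev⟩, A, hA, rfl⟩)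
    · push Not at hev
      obtain ⟨t, ht, hvt⟩ := hev
      exact hx (mem_iUnion.2 ⟨⟨R, t, ht⟩, v, ⟨hv, hvt⟩, A, hA, rfl⟩)
  have hφ : Measurable fun x : Hull T => e +ᵥ x := (Hull.continuous_vadd e).measurable
  calc μ ((fun x => -e +ᵥ x) ⁻¹' E)
      = μ (⋃ i, (fun x => -e +ᵥ x) ⁻¹' E ∩ slab (V i) (D i)) := by
        rw [← inter_iUnion]
        exact (measure_inter_conull hcover).symm
    _ ≤ ∑' i, μ ((fun x => -e +ᵥ x) ⁻¹' E ∩ slab (V i) (D i)) := measure_iUnion_le _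
    _ = ∑' i, μ (E ∩ slab (e +ᵥ V i) (D i)) := tsum_congr hpiece
    _ = μ (⋃ i, E ∩ slab (e +ᵥ V i) (D i)) := by
        refine (measure_iUnion (fun i j hij => ?_) fun i => ?_).symm
        · refine Disjoint.mono inter_subset_right inter_subset_right ?_
          rw [slab_vadd_left, slab_vadd_left]
          exact (hdisj hij).preimage _
        · rw [slab_vadd_left]
          exact hE.inter (hφ (hslab i))
    _ ≤ μ E := measure_mono (iUnion_subset fun i => inter_subset_left)

theorem ofTransverse_preimage_single (hN : IsTransverse 𝓕 β N) (hX : IsPrototileSet X)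
    (hrect : ∀ p ∈ X, IsRectangle p) (hβ : β ∈ 𝓕.M) {r : ℝ}
    (hr : ∀ S : Tiling X, ∀ a b : Euc d, rect a b ∈ S.tiles → ∀ k, r ≤ b k - a k) (k : Fin d)
    {s : ℝ} (hs : 0 < s) (hsr : s < r) :
    (𝓕.ofTransverse N).map (fun x => -EuclideanSpace.single k s +ᵥ x) = 𝓕.ofTransverse N := by
  have hfin := hN.isFiniteMeasure_ofTransverse
  have hφ : Measurable fun x : Hull T => -EuclideanSpace.single k s +ᵥ x :=
    (Hull.continuous_vadd _).measurable
  refine Measure.eq_of_le_of_measure_univ_eq (Measure.le_iff.2 fun E hE => ?_) ?_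
  · rw [Measure.map_apply hφ hE]
    exact hN.ofTransverse_preimage_single_le hX hrect hβ hr k hs hsr hE
  · rw [Measure.map_apply hφ .univ, preimage_univ]

theorem ofTransverse_mem_invariantMeasures (hN : IsTransverse 𝓕 β N) (hX : IsPrototileSet X)
    (hrect : ∀ p ∈ X, IsRectangle p) (hβ : β ∈ 𝓕.M) :
    𝓕.ofTransverse N ∈ invariantMeasures T := by
  obtain ⟨r, hr0, hr⟩ := Tiling.exists_pos_le_side hX
  set G := stabilizer (𝓕.ofTransverse N) with hG
  have hsmall : ∀ (k : Fin d) (s : ℝ), 0 < s → s < r → EuclideanSpace.single k s ∈ G := by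
    intro k s hs hsr
    rw [← neg_mem_iff]
    exact hN.ofTransverse_preimage_single hX hrect hβ hr k hs hsr
  have hpos : ∀ (k : Fin d) (s : ℝ), 0 < s → EuclideanSpace.single k s ∈ G := by
    intro k s hs
    obtain ⟨m, hm⟩ := exists_nat_gt (s / r)
    have hm0 : (0 : ℝ) < m := (div_pos hs hr0).trans hm
    have h : m • (EuclideanSpace.single k (s / m) : Euc d) = EuclideanSpace.single k s := by
      ext l
      simp only [PiLp.smul_apply, PiLp.single_apply, nsmul_eq_mul]
      split_ifs
      · field_simp
      · simp
    rw [← h]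
    exact nsmul_mem (hsmall k _ (div_pos hs hm0) (by
      rw [div_lt_iff₀ hm0]
      rwa [div_lt_iff₀ hr0, mul_comm] at hm)) m
  have hall : ∀ (k : Fin d) (s : ℝ), EuclideanSpace.single k s ∈ G := by
    intro k s
    rcases lt_trichotomy s 0 with h | rfl | h
    · rw [← neg_mem_iff]
      convert hpos k (-s) (neg_pos.2 h)
      ext l
      simp only [PiLp.neg_apply, PiLp.single_apply]
      split_ifs <;> simp
    · convert zero_mem G
      ext l
      simp
    · exact hpos k s h
  have huniv : ∀ v : Euc d, v ∈ G := by
    intro v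
    have : v = ∑ k, EuclideanSpace.single k (v k) := by
      ext l
      simp
    rw [this]
    exact sum_mem fun k _ => hall k _
  refine ⟨hN.isFiniteMeasure_ofTransverse, ⟨fun v E hE => ?_⟩⟩
  have hv : (𝓕.ofTransverse N).map (fun x => v +ᵥ x) = 𝓕.ofTransverse N := huniv v
  conv_rhs => rw [← hv]
  rw [Measure.map_apply (Hull.continuous_vadd v).measurable hE]

end IsTransverse

end

end TilingSpace

open TilingSpace in
theorem mainTheorem3 {d : ℕ} (X : Set (Set (Euc d))) (hX : IsPrototileSet X)
    (hrect : ∀ p ∈ X, IsRectangle p) (T : Tiling X) (hT : T.IsPerfect) (𝓕 : EFS T) :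
    Set.BijOn 𝓕.τ (invariantMeasures T \ {0}) 𝓕.Mstar ∧
    Set.BijOn 𝓕.τ (invariantMeasures T) 𝓕.M ∧
    (∀ μ ∈ invariantMeasures T, ∀ ν ∈ invariantMeasures T, 𝓕.τ (μ + ν) = 𝓕.τ μ + 𝓕.τ ν) ∧
    (∀ μ ∈ invariantMeasures T, ∀ c : NNReal, 𝓕.τ (c • μ) = (c : ℝ) • 𝓕.τ μ) := by
  have hinj := 𝓕.injOn_τ hX hrect
  have hsurj : SurjOn 𝓕.τ (invariantMeasures T) 𝓕.M := by
    intro β hβ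
    obtain ⟨N, hN⟩ := 𝓕.exists_isTransverse hX hrect hβ
    exact ⟨_, hN.ofTransverse_mem_invariantMeasures hX hrect hβ,
      hN.τ_ofTransverse hX hrect fun n => (hβ.1 n).1⟩
  refine ⟨⟨fun μ hμ => ?_, hinj.mono sdiff_subset, fun β hβ => ?_⟩,
    ⟨fun μ hμ => 𝓕.τ_mem_M hX hrect hμ, hinj, hsurj⟩, fun μ hμ ν hν => ?_, fun μ _ c => ?_⟩
  · have hM := 𝓕.τ_mem_M hX hrect hμ.1
    exact ⟨fun n => ⟨𝓕.τ_pos hX hT.repetitive hμ.1 hμ.2 n, (hM.1 n).2⟩, hM.2⟩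
  · obtain ⟨μ, hμ, rfl⟩ := hsurj
      (⟨fun n => ⟨fun R => ((hβ.1 n).1 R).le, (hβ.1 n).2⟩, hβ.2⟩ : β ∈ 𝓕.M)
    refine ⟨μ, ⟨hμ, fun h0 => ?_⟩, rfl⟩
    -- the weights of the zero measure vanish on the regions, and there is a region
    obtain ⟨t, ht, -⟩ := T.exists_mem_tile 0
    obtain ⟨R, -⟩ := 𝓕.exists_occurs hX hrect 0 (Hull.base T) ht
    have hpos := (hβ.1 0).1 R
    rw [mem_singleton_iff.1 h0, 𝓕.τ_apply] at hpos
    simp at hpos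
  · have hf := hμ.1
    have hf' := hν.1
    ext n R
    rw [Pi.add_apply, Pi.add_apply, 𝓕.τ_apply, 𝓕.τ_apply, 𝓕.τ_apply, measureReal_add_apply,
      add_div]
  · ext n R
    simp only [Pi.smul_apply, 𝓕.τ_apply, smul_eq_mul, measureReal_nnreal_smul_apply,
      mul_div_assoc]
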